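/- **Setting.** Let $F$ be a local field of characteristic $0$ (archimedean or not), $|\cdot|$ its normalized absolute value, $\psi:F\to\mathbb C^\times$ a nontrivial continuous unitary additive character, $K$ a quadratic étale $F$-algebra with nontrivial automorphism $\sigma$, and $n\ge 0$. Let $E=F\times F$ and $L=E\otimes_F K=K\times K$, so that $\mathrm{GL}_n(E)=\mathrm{GL}_n(F)^2$ and $\mathrm{GL}_n(L)=\mathrm{GL}_n(K)^2$; $\sigma_{L/K}$ and $\sigma_{E/F}$ swap the two factors and $\sigma_{L/E}$ applies $\sigma$ to both. Put $S_{n,L/K}=\{\gamma\in \mathrm{GL}_n(L):\gamma\sigma_{L/K}(\gamma)=1\}$. Subscripts $R_n$ denote row vectors, superscripts $R^n$ column vectors, $F_n\subset E_n$ diagonally, and $F^{-,n}=\{y\in E^n:\sigma_{E/F}(y)=-y\}$. Let $V=E^n$ with the skew-Hermitian form $\langle v,w\rangle=({}^{t}v_2w_1,\,-{}^{t}v_1w_2)$; then for $R=F,K$ we have $\mathrm U(V)(R)=\{(g,{}^{t}g^{-1}):g\in\mathrm{GL}_n(R)\}$, identified with $\mathrm{GL}_n(R)$. For $z=(z_1,z_2)\in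 V^\vee=E_n$ let $z^*=({}^{t}z_2,-{}^{t}z_1)\in V$, the vector with $\langle v,z^*\rangle=\sigma_{E/F}(zv)$ for all $v$, and put $\langle z,w\rangle=\langle w^*,z^*\rangle$ on $V^\vee$. Let $\mathbb L=F_n\times\{0\}$, $\mathbb L^\vee=\{0\}\times F_n$. Let $\mu$ be a continuous character of $E^\times=F^\times\times F^\times$ that is trivial on the diagonal $F^\times$, and let $j=(j_0,-j_0)$ with $j_0\in F^\times$. Fix Haar measures on $F_n$, $\mathrm{GL}_n(F)$ and $\mathrm{GL}_n(K)$; give $\mathbb L$, $\mathrm U(V)(F)$ and $\mathrm{GL}_n(E)$ the resulting (product) measures. **Representatives.** An element $\xi\in\mathrm{GL}_n(L)$ is *normal* if it commutes with $\xi\sigma_{L/E}(\xi)^{-1}$. An element $\xi$ of $S_{n,L/K}$ or $\mathrm U(V)(K)$ is *regular semisimple* if $\xi\sigma_{L/E}(\xi)^{-1}$ is regular semisimple in $\mathrm{Mat}_n(L)$ (separable characteristic polynomial). Let $S$ be a set of normal representatives of the regular semisimple $\mathrm{GL}_n(E)$-orbits of $S_{n,L/K}$ for $\gamma\cdot h=h^{-1}\gamma\sigma_{E/F}(h)$,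 and $R^V$ a set of normal representatives of those regular semisimple $\mathrm U(V)(F)\times\mathrm U(V)(F)$-orbits of $\mathrm U(V)(K)$ that contain a normal element. They are *compatible* if for $\gamma\in S$, $\zeta\in R^V$, $h\in\mathrm{GL}_n(E)$, the equality $h^{-1}\gamma\sigma_{L/E}(\gamma)^{-1}h=\zeta\sigma_{L/E}(\zeta)^{-1}$ implies $h^{-1}\gamma h=\zeta$. A triple $[\delta,x,y]\in \mathrm{Mat}_n(L)\times L_n\times L^n$ is *strongly regular semisimple* if $\delta$ is regular semisimple, the $x\delta^i$ $(0\le i<n)$ span $L_n$ and the $\delta^iy$ $(0\le i<n)$ span $L^n$. Its invariants are $\mathrm{Tr}\wedge^i\delta$ and $x\delta^{i-1}y$ $(1\le i\le n)$. Let $X_{\mathrm{rss}}$ be the set of $[\gamma,x,y]\in S\times F_n\times F^{-,n}$ with $[\gamma\sigma_{L/E}(\gamma)^{-1},x,y]$ strongly regular semisimple, and $Y^V_{\mathrm{rss}}$ the set of $[\zeta,z]\in R^V\times V^\vee$ with $[\zeta\sigma_{L/E}(\zeta)^{-1},z,z^*]$ strongly regular semisimple. Two such elements *match* if these two triples have the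 same invariants. **Orbital integrals.** For $h=(h_1,h_2)\in\mathrm{GL}_n(E)$ let $(R_\mu(h)\phi')(z)=\mu(\det h)\,|\det h_1\det h_2|^{1/2}\phi'(zh)$ for functions $\phi'$ on $E_n$, and for $h=(g,{}^{t}g^{-1})\in\mathrm U(V)(F)$ let $(\omega(h)\phi)(x)=\mu(\det g,1)|\det g|^{1/2}\phi(xg)$ for functions $\phi$ on $\mathbb L=F_n$. Put $$\phi'^\dagger(x,y)=|j_0|^n\int_{F_n}\phi'(x+jw)\,\psi(\mathrm{Tr}_{E/F}(jwy))\,dw,\qquad x\in F_n,\ y\in F^{-,n},$$ $$(\phi_1\otimes\phi_2)^\ddagger(x+y)=\int_{\mathbb L}\phi_1(x'+x)\phi_2(x-x')\,\psi(-2\,\mathrm{Tr}_{E/F}\langle x',y\rangle)\,dx',\qquad x\in\mathbb L,\ y\in\mathbb L^\vee,$$ $$\mathrm{Orb}([\xi,x,y],f',\phi')=\int_{\mathrm{GL}_n(E)}\int_{\mathrm{GL}_n(K)}f'(h_1^{-1}\xi h_2)\,\overline{(R_\mu(h_1)\phi')^\dagger(x,y)}\,\eta_{L/K}(\det h_2)^{n+1}\,dh_2\,dh_1$$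 (with $\eta_{L/K}=1$, since $L=K\times K$), and $$\mathrm{Orb}([\zeta,z],f,\phi_1\otimes\phi_2)=\int_{\mathrm U(V)(F)}\int_{\mathrm U(V)(F)}f(h_1^{-1}\zeta h_2)\,(\overline{\omega(h_2^{-1}h_1)\phi_1}\otimes\phi_2)^\ddagger(zh_2)\,dh_2\,dh_1 .$$ **Proposition.** Let $S$ and $R^V$ be compatible. Let $f_1',f_2'\in C_c^\infty(\mathrm{GL}_n(K))$ and $\phi_1,\phi_2\in\mathcal S(F_n)$, and put $f'=f_1'\otimes f_2'$, $\phi'=\phi_1\otimes\overline{\phi_2}$ and $f=f_1'*f_2'^\vee$, where $f_2'^\vee(g)=f_2'(g^{-1})$ and $*$ is convolution on $\mathrm{GL}_n(K)$. If $[\gamma,x,y]\in X_{\mathrm{rss}}$ and $[\zeta,z]\in Y^V_{\mathrm{rss}}$ match, then for every $\xi\in\mathrm{GL}_n(L)$ with $\xi\sigma_{L/K}(\xi)^{-1}=\gamma$, both orbital integrals converge absolutely and $$\mathrm{Orb}([\xi,x,y],f',\phi')=\mathrm{Orb}([\zeta,z],f,\phi_1\otimes\phi_2).$$ -/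

import Mathlib

open MeasureTheory Matrix
open scoped MatrixGroups ComplexConjugate

noncomputable section

namespace SplitTransfer

/-! ### Test functions over a local field of characteristic zero -/

/-- Real linear coordinates on an `F`-module, for an archimedean field `F`
(`ofReal` is the embedding of `ℝ` in `F`). -/
structure RealChart (F X : Type*) [Field F] [TopologicalSpace F] [AddCommGroup X] [Module F X] where
  ofReal : ℝ →+* F
  continuous_ofReal : Continuous ofReal
  dim : ℕ
  vec : Fin dim → X
  bijective : Function.Bijective fun t : Fin dim → ℝ => ∑ i, ofReal (t i) • vec i

/-- The point with given real coordinates. -/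
def RealChart.point {F X : Type*} [Field F] [TopologicalSpace F] [AddCommGroup X] [Module F X]
    (c : RealChart F X) (t : Fin c.dim → ℝ) : X :=
  ∑ i, c.ofReal (t i) • c.vec i

/-- `φ ∈ 𝓢(F_n)`: a Schwartz-Bruhat function if `F` is nonarchimedean,
a Schwartz function if `F` is archimedean. -/
def IsSchwartz {F : Type*} [NontriviallyNormedField F] {n : ℕ} (φ : (Fin n → F) → ℂ) : Prop :=
  (IsUltrametricDist F ∧ IsLocallyConstant φ ∧ HasCompactSupport φ) ∨
    ∃ (c : RealChart F (Fin n → F)) (g : SchwartzMap (Fin c.dim → ℝ) ℂ), ∀ t, g t = φ (c.point t)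

open Classical in
/-- Extension by zero of a function from `GL_n(R)` to all matrices. -/
def extendZero {R : Type*} [CommRing R] {n : ℕ} (f : GL (Fin n) R → ℂ) :
    Matrix (Fin n) (Fin n) R → ℂ :=
  fun A => if h : IsUnit A then f h.unit else 0

/-- `f ∈ C_c^∞(GL_n(K))`: compactly supported, and locally constant if `F` is nonarchimedean,
smooth (in real coordinates) if `F` is archimedean. For compactly supported `f`, smoothness on the
open set `GL_n(K)` is the same as smoothness of the extension by zero. -/
def IsTestFun (F : Type*) [NontriviallyNormedField F] {K : Type*} [CommRing K] [Algebra F K]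
    [TopologicalSpace K] {n : ℕ} (f : GL (Fin n) K → ℂ) : Prop :=
  HasCompactSupport f ∧
    ((IsUltrametricDist F ∧ IsLocallyConstant f) ∨
      ∃ c : RealChart F (Matrix (Fin n) (Fin n) K),
        ContDiff ℝ ((⊤ : ℕ∞) : WithTop ℕ∞) fun t => extendZero f (c.point t))

/-! ### Groups, involutions, normal elements

`E = F × F`, `L = E ⊗_F K = K × K`, so that `GL_n(E) = GL_n(F) × GL_n(F)`,
`GL_n(L) = GL_n(K) × GL_n(K)`. -/

/-- `GL_n(R × R)` as a product. -/
abbrev GL2 (n : ℕ) (R : Type*) [CommRing R] := GL (Fin n) R × GL (Fin n) R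

section Groups

variable {F K : Type*} [Field F] [CommRing K] [Algebra F K] {n : ℕ}

/-- `σ_{L/K}` on `GL_n(L)`. -/
def sigmaLK (g : GL2 n K) : GL2 n K := g.swap

/-- `σ_{L/E}` on `GL_n(L)`, for `σ = σ_{K/F}`. -/
def sigmaLE (σ : K ≃ₐ[F] K) : GL2 n K →* GL2 n K :=
  (GeneralLinearGroup.map (σ : K →+* K)).prodMap (GeneralLinearGroup.map (σ : K →+* K))

/-- `σ_{E/F}` on `GL_n(E)`. -/
def sigmaEF (h : GL2 n F) : GL2 n F := h.swap

/-- The inclusion `GL_n(E) → GL_n(L)`. -/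
def inclE (F K : Type*) [Field F] [CommRing K] [Algebra F K] (n : ℕ) : GL2 n F →* GL2 n K :=
  (GeneralLinearGroup.map (algebraMap F K)).prodMap (GeneralLinearGroup.map (algebraMap F K))

/-- The inclusion `GL_n(K) → GL_n(L)`. -/
def inclK (K : Type*) [CommRing K] (n : ℕ) : GL (Fin n) K →* GL2 n K :=
  (MonoidHom.id _).prod (MonoidHom.id _)

/-- `S_{n,L/K}`. -/
def symSpace (K : Type*) [CommRing K] (n : ℕ) : Set (GL2 n K) :=
  {γ | γ * sigmaLK γ = 1}

/-- `ξ σ_{L/E}(ξ)⁻¹`. -/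
def normOf (σ : K ≃ₐ[F] K) (ξ : GL2 n K) : GL2 n K := ξ * (sigmaLE σ ξ)⁻¹

/-- `ξ` is normal if it commutes with `ξ σ_{L/E}(ξ)⁻¹`. -/
def IsNormalElt (σ : K ≃ₐ[F] K) (ξ : GL2 n K) : Prop := Commute ξ (normOf σ ξ)

/-- Regular semisimple elements of `S_{n,L/K}` (for `GL_n(E)`) and of `U(V)(K)` (for
`U(V)(F) × U(V)(F)`): `ξ σ_{L/E}(ξ)⁻¹` is regular semisimple in `Mat_n(L) = Mat_n(K) × Mat_n(K)`,
that is, it has separable characteristic polynomial. -/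
def IsRegSS (σ : K ≃ₐ[F] K) (ξ : GL2 n K) : Prop :=
  ((normOf σ ξ).1 : Matrix (Fin n) (Fin n) K).charpoly.Separable ∧
    ((normOf σ ξ).2 : Matrix (Fin n) (Fin n) K).charpoly.Separable

end Groups

/-! ### The skew-Hermitian space `V = F^n × F^n` and its unitary group

A pair of column vectors `v = (v.1, v.2)` is an element of `E^n`, and the same for row vectors. -/

section Unitary

variable {R : Type*} [CommRing R] {n : ℕ}

/-- The skew-Hermitian form on `V ⊗ R`, with values in `E ⊗ R = R × R`,
conjugate-linear in `v` and linear in `w`. -/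
def skewForm (v w : (Fin n → R) × (Fin n → R)) : R × R := (v.2 ⬝ᵥ w.1, -(v.1 ⬝ᵥ w.2))

/-- The left action of `GL_n(R × R)` on column vectors. -/
def act (h : GL2 n R) (v : (Fin n → R) × (Fin n → R)) : (Fin n → R) × (Fin n → R) :=
  ((h.1 : Matrix (Fin n) (Fin n) R) *ᵥ v.1, (h.2 : Matrix (Fin n) (Fin n) R) *ᵥ v.2)

/-- The right action of `GL_n(R × R)` on row vectors. -/
def ract (z : (Fin n → R) × (Fin n → R)) (h : GL2 n R) : (Fin n → R) × (Fin n → R) :=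
  (z.1 ᵥ* (h.1 : Matrix (Fin n) (Fin n) R), z.2 ᵥ* (h.2 : Matrix (Fin n) (Fin n) R))

theorem act_mul (g h : GL2 n R) (v : (Fin n → R) × (Fin n → R)) :
    act (g * h) v = act g (act h v) := by
  simp [act]

theorem act_one (v : (Fin n → R) × (Fin n → R)) : act (1 : GL2 n R) v = v := by
  simp [act]

/-- `U(V)(R)` (for `R = F` and `R = K`). -/
def unitaryGrp (n : ℕ) (R : Type*) [CommRing R] : Subgroup (GL2 n R) where
  carrier := {h | ∀ v w, skewForm (act h v) (act h w) = skewForm v w}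
  one_mem' := by
    intro v w
    rw [act_one, act_one]
  mul_mem' := by
    intro a b ha hb v w
    rw [act_mul, act_mul, ha, hb]
  inv_mem' := by
    intro a ha v w
    rw [← ha, ← act_mul, ← act_mul, mul_inv_cancel, act_one, act_one]

/-- The inverse transpose. -/
def invTranspose (g : GL (Fin n) R) : GL (Fin n) R where
  val := ((g⁻¹ : GL (Fin n) R) : Matrix (Fin n) (Fin n) R)ᵀ
  inv := (g : Matrix (Fin n) (Fin n) R)ᵀ
  val_inv := by rw [← Matrix.transpose_mul, Units.mul_inv, Matrix.transpose_one]
  inv_val := by rw [← Matrix.transpose_mul, Units.inv_mul, Matrix.transpose_one]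

/-- The identification of `GL_n(R)` with `U(V)(R)`, inverse to the first projection. -/
def toUnitary (g : GL (Fin n) R) : GL2 n R := (g, invTranspose g)

theorem mem_unitaryGrp_iff (h : GL2 n R) : h ∈ unitaryGrp n R ↔ h = toUnitary h.1 := by
  constructor
  · intro hh
    have key : (h.2 : Matrix (Fin n) (Fin n) R)ᵀ * (h.1 : Matrix (Fin n) (Fin n) R) = 1 := by
      ext i k
      have := congrArg Prod.fst (hh (0, Pi.single i 1) (Pi.single k 1, 0))
      simpa [skewForm, act, Matrix.mul_apply, dotProduct, Matrix.one_apply, Pi.single_apply,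
        eq_comm] using this
    refine Prod.ext rfl (Units.ext ?_)
    have h2 : (h.2 : Matrix (Fin n) (Fin n) R)ᵀ
        = ((h.1⁻¹ : GL (Fin n) R) : Matrix (Fin n) (Fin n) R) :=
      (Units.inv_eq_of_mul_eq_one_left key).symm
    change (h.2 : Matrix (Fin n) (Fin n) R)
      = ((h.1⁻¹ : GL (Fin n) R) : Matrix (Fin n) (Fin n) R)ᵀ
    rw [← h2, Matrix.transpose_transpose]
  · intro hh v w
    have e2 : (h.2 : Matrix (Fin n) (Fin n) R)
        = ((h.1⁻¹ : GL (Fin n) R) : Matrix (Fin n) (Fin n) R)ᵀ := by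
      conv_lhs => rw [hh]
      rfl
    refine Prod.ext ?_ ?_
    · simp only [skewForm, act, e2]
      rw [Matrix.mulVec_transpose, ← Matrix.dotProduct_mulVec, Matrix.mulVec_mulVec, Units.inv_mul,
        Matrix.one_mulVec]
    · simp only [skewForm, act, e2]
      rw [dotProduct_comm, Matrix.mulVec_transpose, ← Matrix.dotProduct_mulVec,
        Matrix.mulVec_mulVec, Units.inv_mul, Matrix.one_mulVec, dotProduct_comm]

/-- For `z ∈ V^∨` (a row vector), the vector `z^* ∈ V` with `⟨v, z^*⟩ = σ_{E/F}(z v)` for all `v`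
(see `skewForm_starVec`). -/
def starVec (z : (Fin n → R) × (Fin n → R)) : (Fin n → R) × (Fin n → R) := (z.2, -z.1)

theorem skewForm_starVec (v z : (Fin n → R) × (Fin n → R)) :
    skewForm v (starVec z) = Prod.swap (z.1 ⬝ᵥ v.1, z.2 ⬝ᵥ v.2) := by
  simp [skewForm, starVec, dotProduct_comm]

/-- The skew-Hermitian form on `V^∨`: `⟨z, w⟩ = ⟨w^*, z^*⟩`. -/
def dualForm (z w : (Fin n → R) × (Fin n → R)) : R × R := skewForm (starVec w) (starVec z)

/-- The trace `E ⊗ R = R × R → R`. -/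
def traceE (a : R × R) : R := a.1 + a.2

end Unitary

/-! ### Representatives, orbits, matching -/

section Orbits

variable {F K : Type*} [Field F] [CommRing K] [Algebra F K] {n : ℕ}

/-- `S` is a set of normal representatives of the regular semisimple `GL_n(E)`-orbits
of `S_{n,L/K}`. -/
def IsNormalRepsGL (σ : K ≃ₐ[F] K) (S : Set (GL2 n K)) : Prop :=
  (∀ γ ∈ S, γ ∈ symSpace K n ∧ IsRegSS σ γ ∧ IsNormalElt σ γ) ∧
    ∀ γ' ∈ symSpace K n, IsRegSS σ γ' →
      ∃! γ, γ ∈ S ∧ ∃ h : GL2 n F, γ = (inclE F K n h)⁻¹ * γ' * inclE F K n (sigmaEF h)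

/-- `R` is a set of normal representatives of those regular semisimple
`U(V)(F) × U(V)(F)`-orbits of `U(V)(K)` that contain a normal element. -/
def IsNormalRepsU (σ : K ≃ₐ[F] K) (R : Set (GL2 n K)) : Prop :=
  (∀ ζ ∈ R, ζ ∈ unitaryGrp n K ∧ IsRegSS σ ζ ∧ IsNormalElt σ ζ) ∧
    ∀ ζ' ∈ unitaryGrp n K, IsRegSS σ ζ' → IsNormalElt σ ζ' →
      ∃! ζ, ζ ∈ R ∧ ∃ h₁ ∈ unitaryGrp n F, ∃ h₂ ∈ unitaryGrp n F,
        ζ = (inclE F K n h₁)⁻¹ * ζ' * inclE F K n h₂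

/-- Compatibility of `S` and `R`. -/
def Compatible (σ : K ≃ₐ[F] K) (S R : Set (GL2 n K)) : Prop :=
  ∀ γ ∈ S, ∀ ζ ∈ R, ∀ h : GL2 n F,
    (inclE F K n h)⁻¹ * normOf σ γ * inclE F K n h = normOf σ ζ →
      (inclE F K n h)⁻¹ * γ * inclE F K n h = ζ

/-- Strongly regular semisimple triples in `Mat_n(K) × K_n × K^n`. -/
def StronglyRSS₁ (δ : Matrix (Fin n) (Fin n) K) (x y : Fin n → K) : Prop :=
  δ.charpoly.Separable ∧
    Submodule.span K (Set.range fun i : Fin n => x ᵥ* δ ^ (i : ℕ)) = ⊤ ∧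
    Submodule.span K (Set.range fun i : Fin n => δ ^ (i : ℕ) *ᵥ y) = ⊤

/-- Strongly regular semisimple triples in `Mat_n(L) × E_n × E^n`, where `L = K × K`. -/
def StronglyRSS (δ : GL2 n K) (x y : (Fin n → F) × (Fin n → F)) : Prop :=
  StronglyRSS₁ (δ.1 : Matrix (Fin n) (Fin n) K) (algebraMap F K ∘ x.1) (algebraMap F K ∘ y.1) ∧
    StronglyRSS₁ (δ.2 : Matrix (Fin n) (Fin n) K) (algebraMap F K ∘ x.2) (algebraMap F K ∘ y.2)

/-- `a_i = Tr ∧^i δ`, as a coefficient of the characteristic polynomial. -/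
def invA (δ : Matrix (Fin n) (Fin n) K) (i : ℕ) : K := (-1) ^ i * δ.charpoly.coeff (n - i)

/-- `b_i = x δ^{i-1} y`. -/
def invB (δ : Matrix (Fin n) (Fin n) K) (x y : Fin n → K) (i : ℕ) : K :=
  x ⬝ᵥ (δ ^ (i - 1) *ᵥ y)

/-- Two triples in `Mat_n(K) × K_n × K^n` have the same invariants. -/
def SameInvariants₁ (δ : Matrix (Fin n) (Fin n) K) (x y : Fin n → K)
    (δ' : Matrix (Fin n) (Fin n) K) (x' y' : Fin n → K) : Prop :=
  ∀ i, 1 ≤ i → i ≤ n → invA δ i = invA δ' i ∧ invB δ x y i = invB δ' x' y' i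

/-- Two triples in `Mat_n(L) × E_n × E^n` have the same invariants. -/
def SameInvariants (δ : GL2 n K) (x y : (Fin n → F) × (Fin n → F))
    (δ' : GL2 n K) (x' y' : (Fin n → F) × (Fin n → F)) : Prop :=
  SameInvariants₁ (δ.1 : Matrix (Fin n) (Fin n) K) (algebraMap F K ∘ x.1) (algebraMap F K ∘ y.1)
      (δ'.1 : Matrix (Fin n) (Fin n) K) (algebraMap F K ∘ x'.1) (algebraMap F K ∘ y'.1) ∧
    SameInvariants₁ (δ.2 : Matrix (Fin n) (Fin n) K) (algebraMap F K ∘ x.2) (algebraMap F K ∘ y.2)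
      (δ'.2 : Matrix (Fin n) (Fin n) K) (algebraMap F K ∘ x'.2) (algebraMap F K ∘ y'.2)

/-- `[γ, x, y] ∈ X_rss`, where `X = S × F_n × F^{-,n}`. Here `F_n ⊆ E_n` is diagonal, and
`F^{-,n} ⊆ E^n` consists of the `y` with `σ_{E/F}(y) = -y`. -/
def MemXrss (σ : K ≃ₐ[F] K) (S : Set (GL2 n K)) (γ : GL2 n K) (x : Fin n → F)
    (y : (Fin n → F) × (Fin n → F)) : Prop :=
  γ ∈ S ∧ y.swap = -y ∧ StronglyRSS (normOf σ γ) (x, x) y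

/-- `[ζ, z] ∈ Y_rss`, where `Y = R × V^∨`. -/
def MemYrss (σ : K ≃ₐ[F] K) (R : Set (GL2 n K)) (ζ : GL2 n K)
    (z : (Fin n → F) × (Fin n → F)) : Prop :=
  ζ ∈ R ∧ StronglyRSS (normOf σ ζ) z (starVec z)

/-- `[γ, x, y]` and `[ζ, z]` match: their images in `Mat_n(L) × E_n × E^n`
have the same invariants. -/
def Matches (σ : K ≃ₐ[F] K) (γ : GL2 n K) (x : Fin n → F) (y : (Fin n → F) × (Fin n → F))
    (ζ : GL2 n K) (z : (Fin n → F) × (Fin n → F)) : Prop :=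
  SameInvariants (normOf σ γ) (x, x) y (normOf σ ζ) z (starVec z)

end Orbits

/-! ### Split smooth transfer of test functions -/

section Transfer

variable {F K : Type*} [NontriviallyNormedField F] [CommRing K] [Algebra F K] [TopologicalSpace K]
  {n : ℕ} [MeasurableSpace (GL (Fin n) K)]

/-- The function `f^∨(g) = f(g⁻¹)`. -/
def checkFun (f : GL (Fin n) K → ℂ) : GL (Fin n) K → ℂ := fun g => f g⁻¹

/-- Convolution on `GL_n(K)`. -/
def conv (μK : Measure (GL (Fin n) K)) (a b : GL (Fin n) K → ℂ) : GL (Fin n) K → ℂ :=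
  fun g => ∫ h, a h * b (h⁻¹ * g) ∂μK

/-- `(f', φ')` and `(f, φ₁ ⊗ φ₂)` are split smooth transfer of each other. -/
def IsSplitTransfer (μK : Measure (GL (Fin n) K)) (f' : GL2 n K → ℂ)
    (φ' : (Fin n → F) × (Fin n → F) → ℂ) (f : GL (Fin n) K → ℂ) (φ₁ φ₂ : (Fin n → F) → ℂ) : Prop :=
  IsSchwartz φ₁ ∧ IsSchwartz φ₂ ∧ (∀ z, φ' z = φ₁ z.1 * conj (φ₂ z.2)) ∧
    ∃ f₁ f₂ : GL (Fin n) K → ℂ, IsTestFun F f₁ ∧ IsTestFun F f₂ ∧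
      (∀ g, f' g = f₁ g.1 * f₂ g.2) ∧ f = conv μK f₁ (checkFun f₂)

end Transfer

/-! ### Weil representations, partial Fourier transforms and orbital integrals

The measure `ν` is a Haar measure on `F_n`, `ψ` an additive character of `F`, `μ` a character of
`E^× = F^× × F^×`, and `j = (j₀, -j₀)` a trace zero element of `E`. -/

section Orbital

variable {F K : Type*} [NontriviallyNormedField F] [LocallyCompactSpace F]
  [MeasurableSpace F] [BorelSpace F] [CommRing K] [Algebra F K] {n : ℕ}

/-- The normalized absolute value of `F`: multiplication by `a` scales Haar measures by `|a|`. -/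
def nabs (a : Fˣ) : ℝ := (distribHaarChar F a : ℝ)

/-- The Weil representation `R_μ` of `GL_n(E)` on functions on `E_n`:
`(R_μ(h)φ')(z) = μ(det h) |det h|_E^{1/2} φ'(z h)`. -/
def weilGL (μ : Fˣ × Fˣ →* ℂˣ) (h : GL2 n F) (φ' : (Fin n → F) × (Fin n → F) → ℂ) :
    (Fin n → F) × (Fin n → F) → ℂ :=
  fun z => (μ (GeneralLinearGroup.det h.1, GeneralLinearGroup.det h.2) : ℂ) *
    (Real.sqrt (nabs (GeneralLinearGroup.det h.1) * nabs (GeneralLinearGroup.det h.2)) : ℂ) *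
    φ' (ract z h)

/-- The Weil representation `ω = ω_{ψ,μ}` of `U(V)(F)` on functions on `𝕃 = F_n`, in the
polarization `V^∨ = F_n × F_n`: for `h = (g, (gᵗ)⁻¹)`,
`(ω(h)φ)(x) = μ(det g, 1) |det g|^{1/2} φ(x g)`. -/
def weilU (μ : Fˣ × Fˣ →* ℂˣ) (h : GL2 n F) (φ : (Fin n → F) → ℂ) : (Fin n → F) → ℂ :=
  fun x => (μ (GeneralLinearGroup.det h.1, 1) : ℂ) *
    (Real.sqrt (nabs (GeneralLinearGroup.det h.1)) : ℂ) *
    φ (x ᵥ* (h.1 : Matrix (Fin n) (Fin n) F))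

/-- The partial Fourier transform `φ'^†(x, y)`, for `y ∈ E^n`:
`φ'^†(x, y) = |j₀|^n ∫ φ'(x + j w) ψ(Tr_{E/F}(j w y)) dw`, over `w ∈ F_n`. -/
def dagger (ν : Measure (Fin n → F)) (ψ : AddChar F Circle) (j₀ : Fˣ)
    (φ' : (Fin n → F) × (Fin n → F) → ℂ) (x : Fin n → F) (y : (Fin n → F) × (Fin n → F)) : ℂ :=
  ((nabs j₀ ^ n : ℝ) : ℂ) * ∫ w, φ' (x + (j₀ : F) • w, x + (-(j₀ : F)) • w) *
    (ψ (traceE ((j₀ : F) * (w ⬝ᵥ y.1), -(j₀ : F) * (w ⬝ᵥ y.2))) : ℂ) ∂ν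

/-- The partial Fourier transform `(a ⊗ b)^‡(z)`, for `z = x + y ∈ V^∨` with `x = (z.1, 0)` in
`𝕃` and `y = (0, z.2)` in `𝕃^∨`:
`∫ a(x' + x) b(x - x') ψ(-2 Tr_{E/F} ⟨x', y⟩) dx'`, over `x' ∈ 𝕃`. -/
def ddagger (ν : Measure (Fin n → F)) (ψ : AddChar F Circle) (a b : (Fin n → F) → ℂ)
    (z : (Fin n → F) × (Fin n → F)) : ℂ :=
  ∫ x', a (x' + z.1) * b (z.1 - x') * (ψ (-2 * traceE (dualForm (x', 0) (0, z.2))) : ℂ) ∂ν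

/-- The quadratic character `η_{L/K}` of `K^×`: it is trivial, as `L = K × K` is split. -/
def etaLK (K : Type*) [CommRing K] : Kˣ →* ℂˣ := 1

/-- The integrand of the general linear orbital integral, on `GL_n(E) × GL_n(K)`. -/
def integrandGL (ν : Measure (Fin n → F)) (ψ : AddChar F Circle) (μ : Fˣ × Fˣ →* ℂˣ) (j₀ : Fˣ)
    (ξ : GL2 n K) (x : Fin n → F) (y : (Fin n → F) × (Fin n → F))
    (f' : GL2 n K → ℂ) (φ' : (Fin n → F) × (Fin n → F) → ℂ)
    (h₁ : GL2 n F) (h₂ : GL (Fin n) K) : ℂ :=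
  f' ((inclE F K n h₁)⁻¹ * ξ * inclK K n h₂) *
    conj (dagger ν ψ j₀ (weilGL μ h₁ φ') x y) *
    (etaLK K (GeneralLinearGroup.det h₂) : ℂ) ^ (n + 1)

/-- `Orb([ξ, x, y], f', φ')`. The measure on `GL_n(E) = GL_n(F) × GL_n(F)` is the product one. -/
def orbGL [MeasurableSpace (GL (Fin n) F)] [MeasurableSpace (GL (Fin n) K)]
    (ν : Measure (Fin n → F)) (μF : Measure (GL (Fin n) F)) (μK : Measure (GL (Fin n) K))
    (ψ : AddChar F Circle) (μ : Fˣ × Fˣ →* ℂˣ) (j₀ : Fˣ)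
    (ξ : GL2 n K) (x : Fin n → F) (y : (Fin n → F) × (Fin n → F))
    (f' : GL2 n K → ℂ) (φ' : (Fin n → F) × (Fin n → F) → ℂ) : ℂ :=
  ∫ h₁ : GL2 n F, ∫ h₂ : GL (Fin n) K, integrandGL ν ψ μ j₀ ξ x y f' φ' h₁ h₂ ∂μK ∂(μF.prod μF)

/-- The integrand of the unitary orbital integral, on `U(V)(F) × U(V)(F)`. The function `f` on
`U(V)(K) = GL_n(K)` is evaluated through the first projection. -/
def integrandU (ν : Measure (Fin n → F)) (ψ : AddChar F Circle) (μ : Fˣ × Fˣ →* ℂˣ)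
    (ζ : GL2 n K) (z : (Fin n → F) × (Fin n → F))
    (f : GL (Fin n) K → ℂ) (φ₁ φ₂ : (Fin n → F) → ℂ) (h₁ h₂ : GL2 n F) : ℂ :=
  f ((inclE F K n h₁)⁻¹ * ζ * inclE F K n h₂).1 *
    ddagger ν ψ (fun t => conj (weilU μ (h₂⁻¹ * h₁) φ₁ t)) φ₂ (ract z h₂)

/-- `Orb([ζ, z], f, φ₁ ⊗ φ₂)`, with `U(V)(F)` identified with `GL_n(F)`. -/
def orbU [MeasurableSpace (GL (Fin n) F)]
    (ν : Measure (Fin n → F)) (μF : Measure (GL (Fin n) F))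
    (ψ : AddChar F Circle) (μ : Fˣ × Fˣ →* ℂˣ)
    (ζ : GL2 n K) (z : (Fin n → F) × (Fin n → F))
    (f : GL (Fin n) K → ℂ) (φ₁ φ₂ : (Fin n → F) → ℂ) : ℂ :=
  ∫ g₁, ∫ g₂, integrandU ν ψ μ ζ z f φ₁ φ₂ (toUnitary g₁) (toUnitary g₂) ∂μF ∂μF

end Orbital

end SplitTransfer

end

/-! Both orbital integrals reduce to integrals over `GL_n(F)²` of the same shape. On the linear side
write `h₁ = (g₁, g₂)` and `ξ = (ξ₁, ξ₂)`. Integrating `f₁(g₁⁻¹ξ₁k) f₂(g₂⁻¹ξ₂k)` over `k ∈ GL_n(K)`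
gives the convolution `f₁ * f₂^∨` at `g₁⁻¹ξ₁ξ₂⁻¹g₂`, and `ξ₁ξ₂⁻¹` is the first component of `γ`
(`integral_eq_conv`). Linear changes of variable turn both partial Fourier transforms into one
kernel `weilCoeff` (`conj_dagger_weilGL`, `ddagger_weilU`). It satisfies `W_{x,y}(hg₁, hg₂) = W_{xh,
h⁻¹y}(g₁, g₂)` (`weilCoeff_mul_left`), because `μ` is trivial on the diagonal and the Jacobian
cancels `|det h|`.

Matching supplies the translation. Two triples with the same invariants are conjugate by the
quotient of their Krylov matrices. Since `σ` inverts the norms `γσ(γ)⁻¹` and `ζσ(ζ)⁻¹`, the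
`σ`-image of this conjugator is again one; uniqueness makes it fixed by `σ`, so it lies in `GL_n(F)`
(`exists_descended_conj`). Compatibility upgrades conjugacy of the norms to `h⁻¹γh = ζ`, so the two
integrands differ by left translation by `(h, h)`.

Absolute convergence is the analytic part. Put `δ = γσ(γ)⁻¹`. If `c = g₁⁻¹γg₂` stays in a compact
set, so does `cσ(c)⁻¹ = g₁⁻¹δg₁`. As `γ` is normal and `δ` has a cyclic vector, `γ^{±1}` are
polynomials in `δ`, whence `u = g₁⁻¹g₂` also stays in a compact set (`exists_compact_of_orbit`). The
kernel becomes `W_{xg₁, g₁⁻¹y}(1, u)`, which decays faster than any power of `‖xg₁‖` and `‖g₁⁻¹y‖`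
(`oscInt_decay`). Krylov matrices bound `g₁` by `‖xg₁‖` and `g₁⁻¹` by `‖g₁⁻¹y‖`, so a high power of
`(1+‖g₁‖)⁻¹(1+‖g₁⁻¹‖)⁻¹` is a majorant, and it is integrable (`lintegral_glWeight_lt_top`).

Archimedean and nonarchimedean fields are treated together: finite differences replace derivatives
(`RapidDiff`), and summation by parts against `ψ` gives the decay in `y`. -/

noncomputable section

namespace SplitTransfer

open Filter Topology Measure
open scoped ENNReal NNReal Pointwise

/-! ### Scaling of Haar measures by row action of matrices -/

section Scaling

variable {F : Type*} [NontriviallyNormedField F] {n : ℕ}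

/-- Right multiplication of row vectors by an invertible matrix, as a topological automorphism. -/
def rowEquiv (g : GL (Fin n) F) : (Fin n → F) ≃ₜ+ (Fin n → F) where
  toFun w := w ᵥ* (g : Matrix (Fin n) (Fin n) F)
  invFun w := w ᵥ* ((g⁻¹ : GL (Fin n) F) : Matrix (Fin n) (Fin n) F)
  left_inv w := by
    change (w ᵥ* _) ᵥ* _ = w
    rw [Matrix.vecMul_vecMul, Units.mul_inv, Matrix.vecMul_one]
  right_inv w := by
    change (w ᵥ* _) ᵥ* _ = w
    rw [Matrix.vecMul_vecMul, Units.inv_mul, Matrix.vecMul_one]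
  map_add' w w' := Matrix.add_vecMul _ _ _
  continuous_toFun := by fun_prop
  continuous_invFun := by fun_prop

theorem rowEquiv_apply (g : GL (Fin n) F) (w : Fin n → F) :
    rowEquiv g w = w ᵥ* (g : Matrix (Fin n) (Fin n) F) := rfl

variable [LocallyCompactSpace F] [MeasurableSpace F] [BorelSpace F]

theorem secondCountable_of_locallyCompact (F : Type*) [NontriviallyNormedField F]
    [LocallyCompactSpace F] : SecondCountableTopology F := by
  have : ProperSpace F := .of_locallyCompactSpace F
  infer_instance

theorem nabs_pos (a : Fˣ) : 0 < nabs a := distribHaarChar_pos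

/-- The factor by which `g` scales Haar measures on row vectors. -/
def rowChar (n : ℕ) : GL (Fin n) F →* ℝ≥0 :=
  haveI := secondCountable_of_locallyCompact F
  { toFun := fun g => addEquivAddHaarChar (rowEquiv g)
    map_one' := by
      have : rowEquiv (1 : GL (Fin n) F) = ContinuousAddEquiv.refl _ := by
        ext w; simp [rowEquiv_apply]
      rw [this, addEquivAddHaarChar_refl]
    map_mul' := fun g h => by
      have : rowEquiv (g * h) = (rowEquiv g).trans (rowEquiv h) := by
        ext w; simp [rowEquiv_apply]
      rw [this, addEquivAddHaarChar_trans] }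

theorem rowChar_ne_zero (g : GL (Fin n) F) : rowChar n g ≠ 0 :=
  ((Group.isUnit g).map (rowChar n)).ne_zero

theorem rowChar_preimage (ν : Measure (Fin n → F)) [ν.IsAddHaarMeasure] (g : GL (Fin n) F)
    (X : Set (Fin n → F)) : (rowChar n g : ℝ≥0∞) * ν (rowEquiv g ⁻¹' X) = ν X := by
  have := secondCountable_of_locallyCompact F
  exact addEquivAddHaarChar_smul_preimage ν (rowEquiv g)

/-- Comparing the product measure of a product of unit balls with that of its preimage splits the
factor coordinate by coordinate; both measures are positive and finite, so they can be cancelled. -/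
theorem rowChar_diagonal (D : Fin n → Fˣ) (g : GL (Fin n) F)
    (hg : (g : Matrix (Fin n) (Fin n) F) = diagonal fun i => (D i : F)) :
    rowChar n g = ∏ i, distribHaarChar F (D i) := by
  have := secondCountable_of_locallyCompact F
  have : ProperSpace F := .of_locallyCompactSpace F
  let l : Measure F := addHaar
  have key := rowChar_preimage (Measure.pi fun _ : Fin n => l) g
    (Set.univ.pi fun _ => Metric.closedBall (0 : F) 1)
  have hpre : rowEquiv g ⁻¹' (Set.univ.pi fun _ => Metric.closedBall (0 : F) 1)
      = Set.univ.pi fun i => (fun t : F => t * D i) ⁻¹' Metric.closedBall (0 : F) 1 := by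
    ext w
    simp only [Set.mem_preimage, Set.mem_pi, rowEquiv_apply, hg, Matrix.vecMul_diagonal]
  rw [hpre, Measure.pi_pi, Measure.pi_pi] at key
  have h1 : ∀ i, (distribHaarChar F (D i) : ℝ≥0∞) *
      l ((fun t : F => t * D i) ⁻¹' Metric.closedBall (0 : F) 1)
      = l (Metric.closedBall (0 : F) 1) := by
    intro i
    rw [distribHaarChar_mul]
    congr 1
    ext t
    rw [Set.mem_smul_set_iff_inv_smul_mem]
    simp only [Set.mem_preimage, Units.smul_def, smul_eq_mul]
    rw [mul_comm, ← mul_assoc, Units.mul_inv, one_mul]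
  have h2 : ((∏ i, distribHaarChar F (D i) : ℝ≥0) : ℝ≥0∞) *
      ∏ i, l ((fun t : F => t * D i) ⁻¹' Metric.closedBall (0 : F) 1)
      = ∏ i : Fin n, l (Metric.closedBall (0 : F) 1) := by
    rw [ENNReal.ofNNReal_finsetProd, ← Finset.prod_mul_distrib]
    exact Finset.prod_congr rfl fun i _ => h1 i
  rw [← h2] at key
  have hpos : 0 < l (Metric.closedBall (0 : F) 1) := Metric.measure_closedBall_pos _ _ one_pos
  have hfin : l (Metric.closedBall (0 : F) 1) ≠ ⊤ := (isCompact_closedBall _ _).measure_lt_top.ne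
  have hP0 : ∏ i, l ((fun t : F => t * D i) ⁻¹' Metric.closedBall (0 : F) 1) ≠ 0 := by
    rw [Finset.prod_ne_zero_iff]
    intro i _ h0
    have := h1 i
    rw [h0, mul_zero] at this
    exact hpos.ne this
  have hPt : ∏ i, l ((fun t : F => t * D i) ⁻¹' Metric.closedBall (0 : F) 1) ≠ ⊤ := by
    refine ENNReal.prod_ne_top fun i _ h0 => ?_
    have := h1 i
    rw [h0, ENNReal.mul_top (by simpa using (distribHaarChar_pos (A := F) (g := D i)).ne')] at this
    exact hfin this.symm
  exact_mod_cast (ENNReal.mul_left_inj hP0 hPt).1 key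

/-- Scaling the `i`-th coordinate by `2` conjugates `g` to `g²`. A character with values in a
commutative group therefore takes equal values at `g` and `g²`, so it is `1` at `g`. -/
theorem rowChar_transvection [CharZero F] (i j : Fin n) (hij : i ≠ j) (t : F)
    (g : GL (Fin n) F) (hg : (g : Matrix (Fin n) (Fin n) F) = transvection i j t) :
    rowChar n g = 1 := by
  classical
  let d : GL (Fin n) F :=
    { val := diagonal fun k => if k = i then 2 else 1
      inv := diagonal fun k => if k = i then 2⁻¹ else 1
      val_inv := by
        rw [diagonal_mul_diagonal, ← diagonal_one]; congr 1; ext k; split_ifs <;> simp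
      inv_val := by
        rw [diagonal_mul_diagonal, ← diagonal_one]; congr 1; ext k; split_ifs <;> simp }
  have hconj : d * g = g * g * d := by
    ext a b
    have hd : (d : Matrix (Fin n) (Fin n) F) = diagonal fun k => if k = i then (2 : F) else 1 := rfl
    rw [Units.val_mul, Units.val_mul, Units.val_mul, hg,
      transvection_mul_transvection_same _ _ hij, hd, diagonal_mul, mul_diagonal]
    simp only [transvection, Matrix.add_apply, Matrix.single_apply, Matrix.one_apply]
    grind
  have h := congrArg (rowChar n) hconj
  rw [map_mul, map_mul, map_mul, mul_comm] at h
  have h' := mul_right_cancel₀ (rowChar_ne_zero d) h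
  exact (mul_eq_left₀ (rowChar_ne_zero g)).1 h'.symm

/-- Right multiplication by `g` scales Haar measures on row vectors by `|det g|`. -/
theorem rowChar_eq [CharZero F] (g : GL (Fin n) F) :
    rowChar n g = distribHaarChar F (GeneralLinearGroup.det g) := by
  -- The Gaussian elimination principle runs over plain matrices, so the predicate quantifies over
  -- the units with a given underlying matrix.
  let P : Matrix (Fin n) (Fin n) F → Prop := fun A => ∀ g : GL (Fin n) F,
    (g : Matrix (Fin n) (Fin n) F) = A →
      rowChar n g = distribHaarChar F (GeneralLinearGroup.det g)
  have hP : P g := by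
    refine diagonal_transvection_induction_of_det_ne_zero P g
      (GeneralLinearGroup.det g).ne_zero ?_ ?_ ?_
    · intro D hD g hg
      rw [det_diagonal, Finset.prod_ne_zero_iff] at hD
      rw [rowChar_diagonal (fun i => Units.mk0 (D i) (hD i (Finset.mem_univ i))) g hg, ← map_prod]
      congr 1
      ext
      simp [hg]
    · intro t g hg
      rw [rowChar_transvection t.i t.j t.hij t.c g hg]
      have : GeneralLinearGroup.det g = 1 := by
        ext
        simp [hg]
      rw [this, map_one]
    · intro A B hA hB hPA hPB g hg
      have := hPA (GeneralLinearGroup.mkOfDetNeZero A hA) rfl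
      have := hPB (GeneralLinearGroup.mkOfDetNeZero B hB) rfl
      have hgg : g = GeneralLinearGroup.mkOfDetNeZero A hA * GeneralLinearGroup.mkOfDetNeZero B hB :=
        Units.ext hg
      rw [hgg, map_mul, map_mul, map_mul]
      congr 1
  exact hP g rfl

theorem integral_rowEquiv [CharZero F] (ν : Measure (Fin n → F)) [ν.IsAddHaarMeasure]
    (g : GL (Fin n) F) (φ : (Fin n → F) → ℂ) :
    ∫ w, φ w ∂ν = (nabs (GeneralLinearGroup.det g) : ℂ) *
      ∫ w, φ (w ᵥ* (g : Matrix (Fin n) (Fin n) F)) ∂ν := by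
  have := secondCountable_of_locallyCompact F
  have h : rowChar n g • ν.map (rowEquiv g) = ν := addEquivAddHaarChar_smul_map ν (rowEquiv g)
  have h2 : ∫ w, φ w ∂(ν.map (rowEquiv g)) = ∫ w, φ (rowEquiv g w) ∂ν :=
    (rowEquiv g).toHomeomorph.measurableEmbedding.integral_map _
  conv_lhs => rw [← h]
  rw [integral_smul_nnreal_measure, h2, rowChar_eq]
  rfl

end Scaling

end SplitTransfer

namespace SplitTransfer

/-! ### A common form of the two partial Fourier transforms -/

section Core

variable {F : Type*} [NontriviallyNormedField F] [LocallyCompactSpace F]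
  [MeasurableSpace F] [BorelSpace F] {n : ℕ}

/-- The oscillating integral
`∫ conj φ₁((x + w) g₁) φ₂((x - w) g₂) ψ(-2 w y) dw`. -/
def oscInt (ν : Measure (Fin n → F)) (ψ : AddChar F Circle) (φ₁ φ₂ : (Fin n → F) → ℂ)
    (x y : Fin n → F) (g₁ g₂ : GL (Fin n) F) : ℂ :=
  ∫ w, conj (φ₁ ((x + w) ᵥ* (g₁ : Matrix (Fin n) (Fin n) F))) *
    φ₂ ((x - w) ᵥ* (g₂ : Matrix (Fin n) (Fin n) F)) * (ψ (-2 * (w ⬝ᵥ y)) : ℂ) ∂ν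

/-- The oscillating integral with its automorphy factor. -/
def weilCoeff (ν : Measure (Fin n → F)) (ψ : AddChar F Circle) (μ : Fˣ × Fˣ →* ℂˣ)
    (φ₁ φ₂ : (Fin n → F) → ℂ) (x y : Fin n → F) (g₁ g₂ : GL (Fin n) F) : ℂ :=
  conj (μ (GeneralLinearGroup.det g₁, GeneralLinearGroup.det g₂) : ℂ) *
    (Real.sqrt (nabs (GeneralLinearGroup.det g₁) * nabs (GeneralLinearGroup.det g₂)) : ℂ) *
    oscInt ν ψ φ₁ φ₂ x y g₁ g₂

theorem nabs_mul (a b : Fˣ) : nabs (a * b) = nabs a * nabs b := by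
  simp [nabs]

theorem nabs_inv (a : Fˣ) : nabs a⁻¹ = (nabs a)⁻¹ := by
  simp [nabs]

variable [CharZero F] (ν : Measure (Fin n → F)) [ν.IsAddHaarMeasure] (ψ : AddChar F Circle)
  (μ : Fˣ × Fˣ →* ℂˣ) (φ₁ φ₂ : (Fin n → F) → ℂ)

theorem integral_smul_unit (a : Fˣ) (φ : (Fin n → F) → ℂ) :
    ∫ w, φ w ∂ν = ((nabs a ^ n : ℝ) : ℂ) * ∫ w, φ ((a : F) • w) ∂ν := by
  let g : GL (Fin n) F :=
    { val := Matrix.scalar (Fin n) (a : F)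
      inv := Matrix.scalar (Fin n) ((a⁻¹ : Fˣ) : F)
      val_inv := by rw [← map_mul, Units.mul_inv, map_one]
      inv_val := by rw [← map_mul, Units.inv_mul, map_one] }
  have hdet : GeneralLinearGroup.det g = a ^ n := by
    ext
    change (Matrix.scalar (Fin n) (a : F)).det = _
    simp
  have hn : nabs (a ^ n) = nabs a ^ n := by simp [nabs]
  rw [integral_rowEquiv ν g φ, hdet, hn]
  congr 2
  ext w
  congr 1
  ext i
  change (w ᵥ* Matrix.scalar (Fin n) (a : F)) i = _
  simp [mul_comm]

/-- The substitution `w ↦ j₀w` absorbs `|j₀|^n`. For an antidiagonal vector `(y, -y)` the two halves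
of the trace `Tr(jwy)` agree, which produces the factor `2`; conjugation supplies its sign. -/
theorem conj_dagger_weilGL (j₀ : Fˣ) (x y : Fin n → F) (g₁ g₂ : GL (Fin n) F) :
    conj (dagger ν ψ j₀ (weilGL μ (g₁, g₂) fun z => φ₁ z.1 * conj (φ₂ z.2)) x (y, -y))
      = weilCoeff ν ψ μ φ₁ φ₂ x y g₁ g₂ := by
  rw [weilCoeff, oscInt, integral_smul_unit ν j₀, dagger, map_mul, ← integral_conj,
    mul_left_comm, Complex.conj_ofReal]
  congr 1
  rw [← integral_const_mul]
  congr 1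
  ext w
  have hψ : ∀ t : F, conj (ψ t : ℂ) = (ψ (-t) : ℂ) := by
    intro t
    rw [AddChar.map_neg_eq_inv, Circle.coe_inv_eq_conj]
  simp only [weilGL, ract, map_mul, Complex.conj_conj, Complex.conj_ofReal, hψ, traceE]
  have h1 : -((j₀ : F) * (w ⬝ᵥ y) + -(j₀ : F) * (w ⬝ᵥ -y)) = -2 * (((j₀ : F) • w) ⬝ᵥ y) := by
    rw [dotProduct_neg, smul_dotProduct, smul_eq_mul]; ring
  have h2 : x + -(j₀ : F) • w = x - (j₀ : F) • w := by rw [neg_smul, sub_eq_add_neg]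
  rw [h1, h2]
  ring

/-- The substitution `w ↦ wh` leaves the pairing of `w` with `y` unchanged. Its Jacobian `|det h|`
is the square root of `|det h|²` coming from the two determinants, and `μ` does not see the common
factor `det h`. -/
theorem weilCoeff_mul_left (hμ : ∀ a : Fˣ, μ (a, a) = 1) (x y : Fin n → F)
    (h g₁ g₂ : GL (Fin n) F) :
    weilCoeff ν ψ μ φ₁ φ₂ x y (h * g₁) (h * g₂)
      = weilCoeff ν ψ μ φ₁ φ₂ (x ᵥ* (h : Matrix (Fin n) (Fin n) F))
          (((h⁻¹ : GL (Fin n) F) : Matrix (Fin n) (Fin n) F) *ᵥ y) g₁ g₂ := by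
  have hI : oscInt ν ψ φ₁ φ₂ (x ᵥ* (h : Matrix (Fin n) (Fin n) F))
          (((h⁻¹ : GL (Fin n) F) : Matrix (Fin n) (Fin n) F) *ᵥ y) g₁ g₂
      = (nabs (GeneralLinearGroup.det h) : ℂ) * oscInt ν ψ φ₁ φ₂ x y (h * g₁) (h * g₂) := by
    rw [oscInt, integral_rowEquiv ν h, oscInt]
    congr 2
    ext w
    have h1 : (w ᵥ* (h : Matrix (Fin n) (Fin n) F)) ⬝ᵥ
        (((h⁻¹ : GL (Fin n) F) : Matrix (Fin n) (Fin n) F) *ᵥ y) = w ⬝ᵥ y := by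
      rw [dotProduct_mulVec, vecMul_vecMul, Units.mul_inv, vecMul_one]
    rw [h1, ← add_vecMul, ← sub_vecMul, vecMul_vecMul, vecMul_vecMul, Units.val_mul, Units.val_mul]
  have hM : μ (GeneralLinearGroup.det (h * g₁), GeneralLinearGroup.det (h * g₂))
      = μ (GeneralLinearGroup.det g₁, GeneralLinearGroup.det g₂) := by
    rw [map_mul, map_mul, ← Prod.mk_mul_mk, map_mul, hμ, one_mul]
  have hpos := nabs_pos (GeneralLinearGroup.det h)
  have hS : Real.sqrt (nabs (GeneralLinearGroup.det (h * g₁)) *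
        nabs (GeneralLinearGroup.det (h * g₂)))
      = nabs (GeneralLinearGroup.det h) *
        Real.sqrt (nabs (GeneralLinearGroup.det g₁) * nabs (GeneralLinearGroup.det g₂)) := by
    rw [map_mul, map_mul, nabs_mul, nabs_mul, mul_mul_mul_comm, Real.sqrt_mul (by positivity),
      Real.sqrt_mul_self hpos.le]
  rw [weilCoeff, weilCoeff, hI, hM, hS]
  push_cast
  ring

/-- Substitute `w ↦ wg₂`: the inverse transpose acting on `z.2` cancels `g₂` in the pairing.
Triviality of `μ` on the diagonal turns `μ(det(g₂⁻¹g₁), 1)` into `μ(det g₁, det g₂)`, and the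
Jacobian `|det g₂|` turns `|det(g₂⁻¹g₁)|^{1/2}` into the symmetric factor. -/
theorem ddagger_weilU (hμ : ∀ a : Fˣ, μ (a, a) = 1) (z : (Fin n → F) × (Fin n → F))
    (g₁ g₂ : GL (Fin n) F) :
    ddagger ν ψ (fun t => conj (weilU μ ((toUnitary g₂)⁻¹ * toUnitary g₁) φ₁ t)) φ₂
        (ract z (toUnitary g₂))
      = weilCoeff ν ψ μ φ₁ φ₂ z.1 z.2 g₁ g₂ := by
  have e1 : ((toUnitary g₂)⁻¹ * toUnitary g₁).1 = g₂⁻¹ * g₁ := rfl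
  have hM : μ (GeneralLinearGroup.det (g₂⁻¹ * g₁), 1)
      = μ (GeneralLinearGroup.det g₁, GeneralLinearGroup.det g₂) := by
    rw [← mul_one (μ (GeneralLinearGroup.det (g₂⁻¹ * g₁), 1)), ← hμ (GeneralLinearGroup.det g₂),
      ← map_mul, Prod.mk_mul_mk, one_mul]
    congr 2
    rw [map_mul, map_inv, mul_right_comm, inv_mul_cancel, one_mul]
  have hp1 := nabs_pos (GeneralLinearGroup.det g₁)
  have hp2 := nabs_pos (GeneralLinearGroup.det g₂)
  have hS : Real.sqrt (nabs (GeneralLinearGroup.det g₁) * nabs (GeneralLinearGroup.det g₂))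
      = nabs (GeneralLinearGroup.det g₂) *
        Real.sqrt (nabs (GeneralLinearGroup.det (g₂⁻¹ * g₁))) := by
    rw [map_mul, nabs_mul, map_inv, nabs_inv, ← Real.sqrt_sq hp2.le,
      ← Real.sqrt_mul (by positivity), Real.sqrt_sq hp2.le]
    congr 1
    field_simp
  rw [ddagger, integral_rowEquiv ν g₂, weilCoeff, oscInt, hS, Complex.ofReal_mul,
    mul_left_comm, mul_assoc]
  congr 1
  rw [← integral_const_mul]
  congr 1
  ext w
  have h1 : (w ᵥ* (g₂ : Matrix (Fin n) (Fin n) F) + (ract z (toUnitary g₂)).1) ᵥ*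
      ((g₂⁻¹ * g₁ : GL (Fin n) F) : Matrix (Fin n) (Fin n) F)
      = (z.1 + w) ᵥ* (g₁ : Matrix (Fin n) (Fin n) F) := by
    change (w ᵥ* (g₂ : Matrix (Fin n) (Fin n) F) + z.1 ᵥ* (g₂ : Matrix (Fin n) (Fin n) F)) ᵥ* _ = _
    rw [← add_vecMul, vecMul_vecMul, Units.val_mul, ← mul_assoc, Units.mul_inv, one_mul, add_comm]
  have h2 : (ract z (toUnitary g₂)).1 - w ᵥ* (g₂ : Matrix (Fin n) (Fin n) F)
      = (z.1 - w) ᵥ* (g₂ : Matrix (Fin n) (Fin n) F) := by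
    rw [sub_vecMul]
    rfl
  have h3 : traceE (dualForm (w ᵥ* (g₂ : Matrix (Fin n) (Fin n) F), 0)
      (0, (ract z (toUnitary g₂)).2)) = w ⬝ᵥ z.2 := by
    change traceE (dualForm (w ᵥ* (g₂ : Matrix (Fin n) (Fin n) F), 0)
      (0, z.2 ᵥ* ((g₂⁻¹ : GL (Fin n) F) : Matrix (Fin n) (Fin n) F)ᵀ)) = _
    simp only [dualForm, skewForm, starVec, traceE, vecMul_transpose, neg_zero, zero_dotProduct,
      dotProduct_neg, neg_neg, zero_add]
    rw [dotProduct_comm, dotProduct_mulVec, vecMul_vecMul, Units.mul_inv, vecMul_one]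
  simp only [weilU, e1, hM, h1, h2, h3]
  rw [map_mul (starRingEnd ℂ), map_mul (starRingEnd ℂ), Complex.conj_ofReal]
  ring

end Core

end SplitTransfer

namespace SplitTransfer

/-! ### Matching triples are conjugate -/

section Matching

variable {R : Type*} [CommRing R] {n : ℕ}

/-- The matrix with rows `x δ^i`. -/
def krylovRows (δ : Matrix (Fin n) (Fin n) R) (x : Fin n → R) : Matrix (Fin n) (Fin n) R :=
  Matrix.of fun i : Fin n => x ᵥ* δ ^ (i : ℕ)

theorem isUnit_of_span_rows (X : Matrix (Fin n) (Fin n) R)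
    (h : Submodule.span R (Set.range fun i => X i) = ⊤) : IsUnit X := by
  have hs : ∀ v : Fin n → R, ∃ c : Fin n → R, c ᵥ* X = v := by
    intro v
    have hv : v ∈ Submodule.span R (Set.range fun i => X i) := by rw [h]; trivial
    obtain ⟨c, hc⟩ := (Submodule.mem_span_range_iff_exists_fun R).1 hv
    exact ⟨c, by rw [← hc, vecMul_eq_sum]⟩
  choose c hc using hs
  refine IsUnit.of_mul_eq_one_right (Matrix.of fun i => c (Pi.single i 1)) ?_
  ext i j
  change (c (Pi.single i 1) ᵥ* X) j = _
  rw [hc, Matrix.one_apply, Pi.single_apply]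
  simp [eq_comm]

theorem krylovRows_isUnit {δ : Matrix (Fin n) (Fin n) R} {x : Fin n → R}
    (h : Submodule.span R (Set.range fun i : Fin n => x ᵥ* δ ^ (i : ℕ)) = ⊤) :
    IsUnit (krylovRows δ x) :=
  isUnit_of_span_rows _ h

theorem krylovRows_mul_of_intertwine {δ ε h : Matrix (Fin n) (Fin n) R} {x z : Fin n → R}
    (hx : x ᵥ* h = z) (hδ : δ * h = h * ε) : krylovRows δ x * h = krylovRows ε z := by
  have hp : ∀ i : ℕ, δ ^ i * h = h * ε ^ i := fun i => (SemiconjBy.pow_right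
    (show SemiconjBy h ε δ from hδ.symm) i).symm
  ext i j
  change ((x ᵥ* δ ^ (i : ℕ)) ᵥ* h) j = (z ᵥ* ε ^ (i : ℕ)) j
  rw [vecMul_vecMul, hp, ← vecMul_vecMul, hx]

theorem charpoly_eq_of_invA {δ ε : Matrix (Fin n) (Fin n) R}
    (h : ∀ i, 1 ≤ i → i ≤ n → invA δ i = invA ε i) : δ.charpoly = ε.charpoly := by
  nontriviality R
  ext k
  rcases lt_trichotomy k n with hk | rfl | hk
  · have := h (n - k) (by omega) (by omega)
    simp only [invA, Nat.sub_sub_self hk.le] at this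
    exact ((isUnit_one.neg).pow _).mul_left_cancel this
  · have h1 := δ.charpoly_monic.coeff_natDegree
    have h2 := ε.charpoly_monic.coeff_natDegree
    rw [charpoly_natDegree_eq_dim, Fintype.card_fin] at h1 h2
    rw [h1, h2]
  · rw [Polynomial.coeff_eq_zero_of_natDegree_lt, Polynomial.coeff_eq_zero_of_natDegree_lt] <;>
      rwa [charpoly_natDegree_eq_dim, Fintype.card_fin]

/-- By Cayley-Hamilton `p` may be replaced by its remainder modulo the common characteristic
polynomial. That remainder has degree below `n` and involves only powers recorded in the Krylov
matrices. -/
theorem vecMul_aeval_eq {δ ε h : Matrix (Fin n) (Fin n) R} {x z : Fin n → R}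
    (hc : δ.charpoly = ε.charpoly) (hX : krylovRows δ x * h = krylovRows ε z)
    (p : Polynomial R) : x ᵥ* (Polynomial.aeval δ p * h) = z ᵥ* Polynomial.aeval ε p := by
  nontriviality R
  have hrow : ∀ i, i < n → x ᵥ* (δ ^ i * h) = z ᵥ* ε ^ i := by
    intro i hi
    have := congrFun hX ⟨i, hi⟩
    rw [← vecMul_vecMul]
    exact this
  rw [← Polynomial.aeval_modByMonic_eq_self_of_root δ.aeval_self_charpoly,
    ← Polynomial.aeval_modByMonic_eq_self_of_root ε.aeval_self_charpoly, hc]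
  set q := p %ₘ ε.charpoly with hq
  have hdeg : q.degree < n := by
    have := Polynomial.degree_modByMonic_lt p ε.charpoly_monic
    rwa [charpoly_degree_eq_dim, Fintype.card_fin] at this
  rw [Polynomial.aeval_def, Polynomial.aeval_def, Polynomial.eval₂_eq_sum, Polynomial.eval₂_eq_sum,
    Polynomial.sum_def, Polynomial.sum_def, Finset.sum_mul, vecMul_sum, vecMul_sum]
  refine Finset.sum_congr rfl fun i hi => ?_
  have hin : i < n := by
    have := (Polynomial.le_degree_of_mem_supp i hi).trans_lt hdeg
    exact_mod_cast this
  rw [← Algebra.smul_def, ← Algebra.smul_def, smul_mul_assoc, vecMul_smul, vecMul_smul,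
    hrow i hin]

/-- Triples with the same invariants and cyclic row vectors are conjugate. -/
theorem exists_conj_of_sameInvariants {δ ε : Matrix (Fin n) (Fin n) R} {x y z w : Fin n → R}
    (hx : StronglyRSS₁ δ x y) (hz : StronglyRSS₁ ε z w) (hm : SameInvariants₁ δ x y ε z w) :
    ∃ h : GL (Fin n) R, δ * h = h * ε ∧ x ᵥ* (h : Matrix (Fin n) (Fin n) R) = z ∧
      (h : Matrix (Fin n) (Fin n) R) *ᵥ w = y := by
  have hc : δ.charpoly = ε.charpoly := charpoly_eq_of_invA fun i h1 h2 => (hm i h1 h2).1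
  obtain ⟨X, hX⟩ := krylovRows_isUnit hx.2.1
  obtain ⟨Z, hZ⟩ := krylovRows_isUnit hz.2.1
  have hXh : krylovRows δ x * ((X⁻¹ * Z : GL (Fin n) R) : Matrix (Fin n) (Fin n) R)
      = krylovRows ε z := by
    rw [← hX, ← Units.val_mul, mul_inv_cancel_left, hZ]
  have key := vecMul_aeval_eq hc hXh
  have hcancel : ∀ A B : Matrix (Fin n) (Fin n) R, krylovRows δ x * A = krylovRows δ x * B →
      A = B := by
    intro A B hAB
    rw [← hX] at hAB
    exact X.isUnit.mul_left_cancel hAB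
  -- A conjugator must carry the Krylov matrix of `x` to that of `z`, so this is the only candidate.
  refine ⟨X⁻¹ * Z, ?_, ?_, ?_⟩
  · apply hcancel
    rw [← mul_assoc, ← mul_assoc, hXh]
    ext i j
    -- In the last row the exponent is `n`, one beyond the Krylov rows; this is where equality of
    -- the characteristic polynomials enters.
    have h1 := key (Polynomial.X ^ ((i : ℕ) + 1))
    simp only [map_pow, Polynomial.aeval_X, pow_succ, map_mul] at h1
    rw [mul_assoc] at h1
    change ((x ᵥ* δ ^ (i : ℕ)) ᵥ* δ ᵥ* _) j = ((z ᵥ* ε ^ (i : ℕ)) ᵥ* ε) j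
    rw [vecMul_vecMul, vecMul_vecMul, vecMul_vecMul, h1]
  · simpa using key 1
  -- The entries of both sides are the invariants `b_{i+1}` of the two triples, and the Krylov
  -- matrix is then cancelled.
  · have h1 : krylovRows δ x *ᵥ (((X⁻¹ * Z : GL (Fin n) R) : Matrix (Fin n) (Fin n) R) *ᵥ w)
        = krylovRows δ x *ᵥ y := by
      rw [mulVec_mulVec, hXh]
      ext i
      have := (hm ((i : ℕ) + 1) (by omega) (by omega)).2
      simp only [invB, Nat.add_sub_cancel] at this
      change (z ᵥ* ε ^ (i : ℕ)) ⬝ᵥ w = (x ᵥ* δ ^ (i : ℕ)) ⬝ᵥ y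
      rw [← dotProduct_mulVec, ← dotProduct_mulVec, this]
    rw [← hX] at h1
    have h2 := congrArg (fun v => ((X⁻¹ : GL (Fin n) R) : Matrix (Fin n) (Fin n) R) *ᵥ v) h1
    simpa [mulVec_mulVec, ← mul_assoc] using h2

end Matching

/-! ### Descent of the conjugating element from `K` to `F` -/

section Descent

variable {F K : Type*} [Field F] [CommRing K] [Algebra F K] {n : ℕ}

/-- The elements of a quadratic algebra fixed by a nontrivial automorphism are scalars. -/
theorem exists_algebraMap_of_fixed (hK : Module.finrank F K = 2) {σ : K ≃ₐ[F] K}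
    (hσ : σ ≠ AlgEquiv.refl) {a : K} (ha : σ a = a) : ∃ b : F, algebraMap F K b = a := by
  have hfin : Module.Finite F K := Module.finite_of_finrank_pos (by omega)
  have hnt : Nontrivial K := Module.nontrivial_of_finrank_pos (R := F) (by omega)
  let V : Submodule F K := LinearMap.eqLocus σ.toLinearMap LinearMap.id
  have hV : V ≠ ⊤ := by
    intro h
    apply hσ
    ext b
    have : b ∈ V := by rw [h]; trivial
    exact this
  have h1 : Module.finrank F V < 2 := hK ▸ Submodule.finrank_lt hV
  let W : Submodule F K := Submodule.span F {1}
  have hWV : W ≤ V := by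
    rw [Submodule.span_le, Set.singleton_subset_iff]
    change σ 1 = 1
    exact map_one σ
  have h2 : Module.finrank F W = 1 := finrank_span_singleton one_ne_zero
  -- The fixed space contains the line `F·1` and is proper in a plane.
  have h3 : W = V := Submodule.eq_of_le_of_finrank_le hWV (by omega)
  have h4 : a ∈ W := by rw [h3]; exact ha
  obtain ⟨b, hb⟩ := Submodule.mem_span_singleton.1 h4
  exact ⟨b, by rw [← hb, Algebra.algebraMap_eq_smul_one]⟩

/-- An invertible matrix over `K` fixed by `σ` comes from `F`. -/
theorem exists_map_eq_of_fixed (hK : Module.finrank F K = 2) {σ : K ≃ₐ[F] K}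
    (hσ : σ ≠ AlgEquiv.refl) (g : GL (Fin n) K)
    (hg : (g : Matrix (Fin n) (Fin n) K).map σ = g) :
    ∃ h : GL (Fin n) F, GeneralLinearGroup.map (algebraMap F K) h = g := by
  have hnt : Nontrivial K := Module.nontrivial_of_finrank_pos (R := F) (by omega)
  have hent : ∀ i j, ∃ b : F, algebraMap F K b = (g : Matrix (Fin n) (Fin n) K) i j := fun i j =>
    exists_algebraMap_of_fixed hK hσ (congrFun (congrFun hg i) j)
  choose b hb using hent
  have hb' : (Matrix.of b).map (algebraMap F K) = g := by
    ext i j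
    exact hb i j
  have hdet : (Matrix.of b).det ≠ 0 := by
    intro h0
    have h1 : (algebraMap F K) (Matrix.of b).det = (g : Matrix (Fin n) (Fin n) K).det := by
      rw [← hb', RingHom.map_det]; rfl
    rw [h0, map_zero] at h1
    exact (GeneralLinearGroup.det g).ne_zero h1.symm
  exact ⟨GeneralLinearGroup.mkOfDetNeZero _ hdet, Units.ext hb'⟩

theorem map_vec_fixed (σ : K ≃ₐ[F] K) (v : Fin n → F) :
    (σ : K → K) ∘ (algebraMap F K ∘ v) = algebraMap F K ∘ v := by
  ext i; simp

/-- A conjugation between matching triples that are compatible with `σ` descends to `F`. -/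
theorem exists_descended_conj (hK : Module.finrank F K = 2) {σ : K ≃ₐ[F] K}
    (hσ : σ ≠ AlgEquiv.refl) {δ ε : GL (Fin n) K} {x y z w : Fin n → F}
    (hδ : GeneralLinearGroup.map (σ : K →+* K) δ = δ⁻¹)
    (hε : GeneralLinearGroup.map (σ : K →+* K) ε = ε⁻¹)
    (hx : StronglyRSS₁ (δ : Matrix (Fin n) (Fin n) K) (algebraMap F K ∘ x) (algebraMap F K ∘ y))
    (hz : StronglyRSS₁ (ε : Matrix (Fin n) (Fin n) K) (algebraMap F K ∘ z) (algebraMap F K ∘ w))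
    (hm : SameInvariants₁ (δ : Matrix (Fin n) (Fin n) K) (algebraMap F K ∘ x)
      (algebraMap F K ∘ y) (ε : Matrix (Fin n) (Fin n) K) (algebraMap F K ∘ z)
      (algebraMap F K ∘ w)) :
    ∃ h : GL (Fin n) F, (GeneralLinearGroup.map (algebraMap F K) h)⁻¹ * δ *
        GeneralLinearGroup.map (algebraMap F K) h = ε ∧
      x ᵥ* (h : Matrix (Fin n) (Fin n) F) = z ∧
      (h : Matrix (Fin n) (Fin n) F) *ᵥ w = y := by
  have hnt : Nontrivial K := Module.nontrivial_of_finrank_pos (R := F) (by omega)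
  obtain ⟨g, hg1, hg2, hg3⟩ := exists_conj_of_sameInvariants hx hz hm
  have hg1' : δ * g = g * ε := Units.ext hg1
  let τ : GL (Fin n) K →* GL (Fin n) K := GeneralLinearGroup.map (σ : K →+* K)
  have hτ : ∀ a : GL (Fin n) K, ((τ a : GL (Fin n) K) : Matrix (Fin n) (Fin n) K)
      = (a : Matrix (Fin n) (Fin n) K).map σ := fun a => rfl
  -- Applying `σ` inverts `δ` and `ε`, and the relation obtained for the inverses is equivalent to
  -- one for `δ` and `ε`.
  have h1 : δ * τ g = τ g * ε := by
    have := congrArg τ hg1'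
    rw [map_mul, map_mul] at this
    change (GeneralLinearGroup.map (σ : K →+* K) δ) * _
      = _ * (GeneralLinearGroup.map (σ : K →+* K) ε) at this
    rw [hδ, hε] at this
    rw [inv_mul_eq_iff_eq_mul, ← mul_assoc, eq_mul_inv_iff_mul_eq] at this
    exact this.symm
  have h2 : (algebraMap F K ∘ x) ᵥ* ((τ g : GL (Fin n) K) : Matrix (Fin n) (Fin n) K)
      = algebraMap F K ∘ z := by
    have := congrArg (fun v => (σ : K → K) ∘ v) hg2
    simp only [map_vec_fixed] at this
    rw [← this, hτ]
    ext j
    simp [vecMul, dotProduct]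
  have hX := krylovRows_mul_of_intertwine h2 (congrArg Units.val h1)
  rw [← krylovRows_mul_of_intertwine hg2 hg1] at hX
  -- Both `g` and its `σ`-image carry the Krylov matrix of `x` to that of `z`, and the former matrix
  -- is invertible.
  have hfix : ((τ g : GL (Fin n) K) : Matrix (Fin n) (Fin n) K) = g :=
    (krylovRows_isUnit hx.2.1).mul_left_cancel hX
  rw [hτ] at hfix
  obtain ⟨h, rfl⟩ := exists_map_eq_of_fixed hK hσ g hfix
  have hinj := (algebraMap F K).injective
  refine ⟨h, ?_, ?_, ?_⟩
  · rw [mul_assoc, hg1', inv_mul_cancel_left]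
  · ext j
    apply hinj
    have := congrFun hg2 j
    rw [Function.comp_apply] at this
    rw [← this]
    simp [vecMul, dotProduct]
  · ext j
    apply hinj
    have := congrFun hg3 j
    rw [Function.comp_apply] at this
    rw [← this]
    simp [mulVec, dotProduct]

end Descent

end SplitTransfer

namespace SplitTransfer

open Filter Topology

/-! ### Finite differences of test functions -/

section Differences

theorem one_add_norm_le_mul {E : Type*} [NormedAddCommGroup E] (a b : E) :
    1 + ‖a‖ ≤ (1 + ‖a - b‖) * (1 + ‖b‖) := by
  have h := norm_sub_norm_le a b
  nlinarith [norm_nonneg (a - b), norm_nonneg b]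

/-- A shift by at most `1` changes the weight by at most `2^M`, so each difference costs a factor `1
+ 2^M`. This crude bound handles steps that are not small. -/
theorem norm_iterate_fwdDiff_le {E V : Type*} [NormedAddCommGroup E] [NormedAddCommGroup V]
    (M : ℕ) (s : E) (hs : ‖s‖ ≤ 1) (N : ℕ) (φ : E → V) (A : ℝ)
    (hφ : ∀ w, (1 + ‖w‖) ^ M * ‖φ w‖ ≤ A) (w : E) :
    (1 + ‖w‖) ^ M * ‖((fwdDiff s)^[N] φ) w‖ ≤ (1 + 2 ^ M) ^ N * A := by
  induction N generalizing φ A w with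
  | zero => simpa using hφ w
  | succ N ih =>
    rw [Function.iterate_succ_apply]
    have := ih (fwdDiff s φ) ((1 + 2 ^ M) * A) (fun w => ?_) w
    · rw [pow_succ, mul_assoc]; exact this
    · have h1 : (1 + ‖w‖) ^ M ≤ 2 ^ M * (1 + ‖w + s‖) ^ M := by
        rw [← mul_pow]
        refine pow_le_pow_left₀ (by positivity) ?_ _
        have := one_add_norm_le_mul w (w + s)
        rw [sub_add_cancel_left, norm_neg] at this
        exact this.trans (mul_le_mul_of_nonneg_right (by linarith) (by positivity))
      have h2 := norm_sub_le (φ (w + s)) (φ w)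
      have h3 := hφ w
      have h4 := hφ (w + s)
      calc (1 + ‖w‖) ^ M * ‖φ (w + s) - φ w‖
          ≤ (1 + ‖w‖) ^ M * (‖φ (w + s)‖ + ‖φ w‖) := by gcongr
        _ = (1 + ‖w‖) ^ M * ‖φ (w + s)‖ + (1 + ‖w‖) ^ M * ‖φ w‖ := by ring
        _ ≤ 2 ^ M * (1 + ‖w + s‖) ^ M * ‖φ (w + s)‖ + A := by gcongr
        _ ≤ 2 ^ M * A + A := by
          rw [mul_assoc]; gcongr
        _ = (1 + 2 ^ M) * A := by ring

theorem hasFDerivAt_iterate_fwdDiff {E V : Type*} [NormedAddCommGroup E] [NormedSpace ℝ E]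
    [NormedAddCommGroup V] [NormedSpace ℝ V] (s : E) (N : ℕ) (f : E → V) (f' : E → E →L[ℝ] V)
    (hf : ∀ x, HasFDerivAt f (f' x) x) (x : E) :
    HasFDerivAt ((fwdDiff s)^[N] f) (((fwdDiff s)^[N] f') x) x := by
  induction N generalizing f f' x with
  | zero => exact hf x
  | succ N ih =>
    rw [Function.iterate_succ_apply, Function.iterate_succ_apply]
    exact ih _ _ (fun x => ((hasFDerivAt_comp_add_right s).2 (hf (x + s))).sub (hf x)) x

/-- Differentiation commutes with differences, so the mean value inequality bounds the next
difference of `g` by `‖s‖` times the `N`-th difference of its derivative. The target `V` varies in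
the induction because the derivative takes values in a space of linear maps. -/
theorem schwartz_iterate_fwdDiff_le {d : ℕ} (N M : ℕ) {V : Type} [NormedAddCommGroup V]
    [NormedSpace ℝ V] (g : SchwartzMap (Fin d → ℝ) V) :
    ∃ C, 0 ≤ C ∧ ∀ s : Fin d → ℝ, ‖s‖ ≤ 1 → ∀ t,
      (1 + ‖t‖) ^ M * ‖((fwdDiff s)^[N] g) t‖ ≤ C * ‖s‖ ^ N := by
  induction N generalizing V with
  | zero =>
    have h := SchwartzMap.one_add_le_sup_seminorm_apply (𝕜 := ℝ) (m := (M, 0)) le_rfl le_rfl g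
    simp only [norm_iteratedFDeriv_zero] at h
    refine ⟨_, (by positivity : (0 : ℝ) ≤ (1 + ‖(0 : Fin d → ℝ)‖) ^ M * ‖g 0‖).trans (h 0),
      fun s _ t => ?_⟩
    simpa using h t
  | succ N ih =>
    obtain ⟨C, hC, h⟩ := ih (SchwartzMap.fderivCLM ℝ (Fin d → ℝ) V g)
    refine ⟨C * 2 ^ M, by positivity, fun s hs t => ?_⟩
    rw [Function.iterate_succ_apply']
    have hd := hasFDerivAt_iterate_fwdDiff s N g (SchwartzMap.fderivCLM ℝ (Fin d → ℝ) V g)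
      (fun x => by
        rw [SchwartzMap.fderivCLM_apply]
        exact g.differentiableAt.hasFDerivAt)
    have hb : ∀ ξ ∈ segment ℝ t (t + s),
        ‖((fwdDiff s)^[N] (SchwartzMap.fderivCLM ℝ (Fin d → ℝ) V g)) ξ‖
          ≤ C * 2 ^ M * ‖s‖ ^ N / (1 + ‖t‖) ^ M := by
      intro ξ hξ
      have h1 := h s hs ξ
      have h2 : ‖t - ξ‖ ≤ 1 := by
        have := norm_sub_le_of_mem_segment hξ
        rw [add_sub_cancel_left] at this
        rw [norm_sub_rev]
        exact this.trans hs
      have h3 : (1 + ‖t‖) ^ M ≤ 2 ^ M * (1 + ‖ξ‖) ^ M := by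
        rw [← mul_pow]
        refine pow_le_pow_left₀ (by positivity) ?_ _
        exact (one_add_norm_le_mul t ξ).trans
          (mul_le_mul_of_nonneg_right (by linarith) (by positivity))
      rw [le_div_iff₀ (by positivity)]
      calc _ ≤ ‖((fwdDiff s)^[N] (SchwartzMap.fderivCLM ℝ (Fin d → ℝ) V g)) ξ‖ *
            (2 ^ M * (1 + ‖ξ‖) ^ M) := by gcongr
        _ = 2 ^ M * ((1 + ‖ξ‖) ^ M *
            ‖((fwdDiff s)^[N] (SchwartzMap.fderivCLM ℝ (Fin d → ℝ) V g)) ξ‖) := by ring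
        _ ≤ 2 ^ M * (C * ‖s‖ ^ N) := by gcongr
        _ = _ := by ring
    have hmv := (convex_segment t (t + s)).norm_image_sub_le_of_norm_hasFDerivWithin_le
      (fun ξ _ => (hd ξ).hasFDerivWithinAt) hb (left_mem_segment ℝ t (t + s))
      (right_mem_segment ℝ t (t + s))
    rw [add_sub_cancel_left] at hmv
    calc (1 + ‖t‖) ^ M * ‖fwdDiff s ((fwdDiff s)^[N] g) t‖
        ≤ (1 + ‖t‖) ^ M * (C * 2 ^ M * ‖s‖ ^ N / (1 + ‖t‖) ^ M * ‖s‖) := by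
          gcongr
          exact hmv
      _ = C * 2 ^ M * ‖s‖ ^ (N + 1) := by
          rw [pow_succ]
          field_simp

/-- Continuous functions whose iterated finite differences decay rapidly: the common feature of
Schwartz and Schwartz-Bruhat functions. -/
def RapidDiff {E : Type*} [NormedAddCommGroup E] (φ : E → ℂ) : Prop :=
  Continuous φ ∧ ∀ N M : ℕ, ∃ C, 0 ≤ C ∧ ∀ s : E, ‖s‖ ≤ 1 → ∀ w,
    (1 + ‖w‖) ^ M * ‖((fwdDiff s)^[N] φ) w‖ ≤ C * ‖s‖ ^ N

/-- It is enough to bound the differences for small steps. -/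
theorem rapidDiff_of_small {E : Type*} [NormedAddCommGroup E] {φ : E → ℂ} (hφ : Continuous φ)
    (h : ∀ N M : ℕ, ∃ ε > 0, ∃ C, 0 ≤ C ∧ ∀ s : E, ‖s‖ < ε → ∀ w,
      (1 + ‖w‖) ^ M * ‖((fwdDiff s)^[N] φ) w‖ ≤ C * ‖s‖ ^ N) : RapidDiff φ := by
  refine ⟨hφ, fun N M => ?_⟩
  obtain ⟨ε, hε, C, hC, h1⟩ := h N M
  obtain ⟨ε', hε', A, hA, h2⟩ := h 0 M
  have h3 : ∀ w, (1 + ‖w‖) ^ M * ‖φ w‖ ≤ A := by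
    intro w
    have := h2 0 (by simpa using hε') w
    simpa using this
  refine ⟨max C ((1 + 2 ^ M) ^ N * A / ε ^ N), by positivity, fun s hs w => ?_⟩
  rcases lt_or_ge ‖s‖ ε with hlt | hge
  · exact (h1 s hlt w).trans (by gcongr; exact le_max_left _ _)
  -- For steps with `ε ≤ ‖s‖` the factor `‖s‖ ^ N` is bounded below by `ε ^ N`.
  · refine (norm_iterate_fwdDiff_le M s hs N φ A h3 w).trans ?_
    calc (1 + 2 ^ M) ^ N * A = (1 + 2 ^ M) ^ N * A / ε ^ N * ε ^ N := by field_simp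
      _ ≤ max C ((1 + 2 ^ M) ^ N * A / ε ^ N) * ‖s‖ ^ N := by
        gcongr
        exact le_max_right _ _

/-- A Lebesgue number on a thickening of the support makes `φ` invariant under small steps. All
differences of positive order then vanish, and order zero is a bound for a continuous compactly
supported function. -/
theorem rapidDiff_of_locallyConstant {E : Type*} [NormedAddCommGroup E] [ProperSpace E]
    {φ : E → ℂ} (hφ : IsLocallyConstant φ) (hc : HasCompactSupport φ) : RapidDiff φ := by
  refine rapidDiff_of_small hφ.continuous fun N M => ?_
  have hK : IsCompact (Metric.cthickening 1 (tsupport φ)) := hc.isCompact.cthickening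
  obtain ⟨δ, hδ, hδ'⟩ := lebesgue_number_lemma_of_metric (c := fun c : ℂ => φ ⁻¹' {c}) hK
    (fun c => hφ.isOpen_fiber c) (fun x _ => Set.mem_iUnion.2 ⟨φ x, rfl⟩)
  have hstep : ∀ s : E, ‖s‖ < min δ 1 → fwdDiff s φ = 0 := by
    intro s hs
    ext w
    have hs1 : ‖s‖ < δ := hs.trans_le (min_le_left _ _)
    have hs2 : ‖s‖ < 1 := hs.trans_le (min_le_right _ _)
    rw [fwdDiff, Pi.zero_apply, sub_eq_zero]
    by_cases hw : w ∈ Metric.cthickening 1 (tsupport φ)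
    · obtain ⟨c, hc⟩ := hδ' w hw
      have h1 : φ w = c := hc (Metric.mem_ball_self hδ)
      have h2 : φ (w + s) = c := hc (by simpa [Metric.mem_ball, dist_eq_norm] using hs1)
      rw [h1, h2]
    · have h1 : w ∉ tsupport φ := fun h => hw (Metric.self_subset_cthickening _ h)
      have h2 : w + s ∉ tsupport φ := fun h => hw
        (Metric.mem_cthickening_of_dist_le w (w + s) 1 _ h (by simpa [dist_eq_norm] using hs2.le))
      rw [image_eq_zero_of_notMem_tsupport h1, image_eq_zero_of_notMem_tsupport h2]
  obtain ⟨A, hA⟩ := (HasCompactSupport.mul_left (f := fun w : E => (((1 + ‖w‖) ^ M : ℝ) : ℂ))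
    hc).exists_bound_of_continuous
    (by have := hφ.continuous; fun_prop)
  refine ⟨min δ 1, by positivity, max A 0, le_max_right _ _, fun s hs w => ?_⟩
  cases N with
  | zero =>
    have := hA w
    rw [Pi.mul_apply, norm_mul, Complex.norm_real, Real.norm_of_nonneg (by positivity)] at this
    simpa using this.trans (le_max_left A 0)
  | succ N =>
    have hz : ((fwdDiff s)^[N] (0 : E → ℂ)) = 0 := by
      clear hA
      induction N with
      | zero => rfl
      | succ N ih =>
        rw [Function.iterate_succ_apply', ih]
        ext; simp [fwdDiff]
    rw [Function.iterate_succ_apply, hstep s hs, hz, Pi.zero_apply, norm_zero, mul_zero]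
    positivity

theorem RapidDiff.conj {E : Type*} [NormedAddCommGroup E] {φ : E → ℂ} (hφ : RapidDiff φ) :
    RapidDiff fun w => conj (φ w) := by
  refine ⟨Complex.continuous_conj.comp hφ.1, fun N M => ?_⟩
  obtain ⟨C, hC, h⟩ := hφ.2 N M
  refine ⟨C, hC, fun s hs w => ?_⟩
  have hconj : ∀ (N : ℕ) (φ : E → ℂ), (fwdDiff s)^[N] (fun w => conj (φ w))
      = fun w => conj (((fwdDiff s)^[N] φ) w) := by
    intro N
    induction N with
    | zero => intro φ; rfl
    | succ N ih =>
      intro φ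
      rw [Function.iterate_succ_apply, Function.iterate_succ_apply, ← ih]
      congr 1
      ext w
      simp [fwdDiff]
  rw [hconj, RCLike.norm_conj]
  exact h s hs w

end Differences

/-! ### Real charts as isomorphisms of topological groups -/

section Charts

variable {F X : Type*} [Field F] [TopologicalSpace F] [AddCommGroup X] [Module F X]

/-- The chart as an additive isomorphism. -/
def RealChart.addEquiv (c : RealChart F X) : (Fin c.dim → ℝ) ≃+ X :=
  AddEquiv.ofBijective
    (AddMonoidHom.mk' c.point fun s t => by
      simp [RealChart.point, add_smul, Finset.sum_add_distrib])
    c.bijective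

theorem RealChart.addEquiv_apply (c : RealChart F X) (t : Fin c.dim → ℝ) :
    c.addEquiv t = c.point t := rfl

variable [TopologicalSpace X] [IsTopologicalAddGroup X] [ContinuousSMul F X]

theorem RealChart.continuous_point (c : RealChart F X) : Continuous c.point := by
  have := c.continuous_ofReal
  unfold RealChart.point
  fun_prop

/-- The open mapping theorem for continuous surjections from a σ-compact group onto a locally
compact one. -/
theorem RealChart.continuous_symm [T2Space X] [LocallyCompactSpace X] (c : RealChart F X) :
    Continuous c.addEquiv.symm := by
  have ho : IsOpenMap c.addEquiv.toAddMonoidHom :=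
    AddMonoidHom.isOpenMap_of_sigmaCompact _ c.addEquiv.surjective c.continuous_point
  rw [continuous_def]
  intro U hU
  have h := ho U hU
  have he : c.addEquiv.symm ⁻¹' U = c.addEquiv '' U :=
    (c.addEquiv.toEquiv.image_eq_preimage_symm U).symm
  rw [he]
  exact h

end Charts

/-! ### Rapid decay of differences of Schwartz functions on `F_n` -/

section Schwartz

variable {F : Type*} [NontriviallyNormedField F] [LocallyCompactSpace F] {n : ℕ}

/-- The chart is not assumed compatible with norms, so only additivity and continuity at `0` are
used: `t` is `m` times a vector of norm below `r`, with `m` about `‖t‖ / r`. -/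
theorem RealChart.norm_point_le (c : RealChart F (Fin n → F)) :
    ∃ C, 0 ≤ C ∧ ∀ t, 1 + ‖c.point t‖ ≤ C * (1 + ‖t‖) := by
  have h0 : c.point 0 = 0 := c.addEquiv.map_zero
  have h1 := Metric.continuousAt_iff.1 (c.continuous_point.continuousAt (x := 0)) 1 one_pos
  obtain ⟨r, hr, h⟩ := h1
  refine ⟨3 + 1 / r, by positivity, fun t => ?_⟩
  set m : ℕ := ⌊‖t‖ / r⌋₊ + 1 with hm
  have hm0 : (0 : ℝ) < m := by positivity
  have hm1 : ‖t‖ / r < m := by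
    rw [hm]; push_cast; exact Nat.lt_floor_add_one _
  have hm2 : (m : ℝ) ≤ ‖t‖ / r + 1 := by
    rw [hm]; push_cast
    gcongr
    exact Nat.floor_le (by positivity)
  have ht : t = m • ((m : ℝ)⁻¹ • t) := by
    rw [← Nat.cast_smul_eq_nsmul ℝ, smul_smul, mul_inv_cancel₀ hm0.ne', one_smul]
  have h2 : ‖c.point ((m : ℝ)⁻¹ • t)‖ < 1 := by
    have := @h ((m : ℝ)⁻¹ • t) (by
      rw [dist_zero_right, norm_smul, norm_inv, Real.norm_natCast, inv_mul_lt_iff₀ hm0]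
      rwa [div_lt_iff₀ hr] at hm1)
    rwa [h0, dist_zero_right] at this
  have h3 : ‖c.point t‖ ≤ m := by
    have h4 : c.point t = m • c.point ((m : ℝ)⁻¹ • t) := by
      conv_lhs => rw [ht]
      exact map_nsmul c.addEquiv m _
    rw [h4]
    calc _ ≤ (m : ℝ) * ‖c.point ((m : ℝ)⁻¹ • t)‖ := norm_nsmul_le
      _ ≤ m * 1 := by gcongr
      _ = m := mul_one _
  have h5 : ‖t‖ / r = 1 / r * ‖t‖ := by ring
  have h6 : 0 ≤ 1 / r := by positivity
  nlinarith [norm_nonneg t]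

/-- If `τ` denotes the coordinates of `s` and `m` is about `1 / ‖τ‖`, then `mτ` has norm at least
`1`. By continuity of the inverse chart `ms` has norm at least `ε`, which bounds `‖s‖` below by a
multiple of `‖τ‖`. -/
theorem RealChart.norm_symm_le (c : RealChart F (Fin n → F)) :
    ∃ ε > 0, ∃ C, 0 ≤ C ∧ ∀ s, ‖s‖ < ε → ‖c.addEquiv.symm s‖ ≤ 1 ∧
      ‖c.addEquiv.symm s‖ ≤ C * ‖s‖ := by
  have : ProperSpace F := .of_locallyCompactSpace F
  have h1 := Metric.continuousAt_iff.1 (c.continuous_symm.continuousAt (x := 0)) 1 one_pos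
  obtain ⟨ε, hε, h⟩ := h1
  simp only [map_zero, dist_zero_right] at h
  refine ⟨ε, hε, 2 / ε, by positivity, fun s hs => ⟨(h hs).le, ?_⟩⟩
  set τ := c.addEquiv.symm s with hτ
  have hτ1 : ‖τ‖ < 1 := h hs
  rcases eq_or_ne τ 0 with h0 | h0
  · rw [h0, norm_zero]; positivity
  have hpos : 0 < ‖τ‖ := norm_pos_iff.2 h0
  set m : ℕ := ⌈1 / ‖τ‖⌉₊ with hm
  have hm1 : 1 / ‖τ‖ ≤ m := Nat.le_ceil _
  have hm2 : (m : ℝ) < 1 / ‖τ‖ + 1 := Nat.ceil_lt_add_one (by positivity)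
  have h2 : ε ≤ ‖m • s‖ := by
    by_contra hlt
    have h3 := h (not_le.1 hlt)
    rw [map_nsmul, ← Nat.cast_smul_eq_nsmul ℝ, norm_smul, Real.norm_natCast, ← hτ] at h3
    rw [div_le_iff₀ hpos] at hm1
    linarith
  have h3 : ε ≤ m * ‖s‖ := h2.trans norm_nsmul_le
  have h4 : (m : ℝ) * ‖τ‖ ≤ 2 := by
    have : (m : ℝ) * ‖τ‖ < (1 / ‖τ‖ + 1) * ‖τ‖ := by gcongr
    rw [add_mul, one_div, inv_mul_cancel₀ hpos.ne'] at this
    linarith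
  rw [div_mul_eq_mul_div, le_div_iff₀ hε]
  calc ‖τ‖ * ε ≤ ‖τ‖ * (m * ‖s‖) := by gcongr
    _ = m * ‖τ‖ * ‖s‖ := by ring
    _ ≤ 2 * ‖s‖ := by gcongr

/-- The chart is additive, so it takes differences to differences; the two norm comparisons transfer
the real estimate. The convergence argument uses only this property of `φ₁` and `φ₂`. -/
theorem IsSchwartz.rapidDiff {φ : (Fin n → F) → ℂ} (hφ : IsSchwartz φ) : RapidDiff φ := by
  have : ProperSpace F := .of_locallyCompactSpace F
  rcases hφ with ⟨_, h1, h2⟩ | ⟨c, g, hg⟩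
  · exact rapidDiff_of_locallyConstant h1 h2
  have hφ : φ = g ∘ c.addEquiv.symm := by
    ext w
    have := hg (c.addEquiv.symm w)
    rw [← c.addEquiv_apply, AddEquiv.apply_symm_apply] at this
    exact this.symm
  refine rapidDiff_of_small (hφ ▸ g.continuous.comp c.continuous_symm) fun N M => ?_
  obtain ⟨B, hB, hB'⟩ := c.norm_point_le
  obtain ⟨ε, hε, A, hA, hA'⟩ := c.norm_symm_le
  obtain ⟨C, hC, hC'⟩ := schwartz_iterate_fwdDiff_le N M g
  refine ⟨ε, hε, B ^ M * (C * A ^ N), by positivity, fun s hs w => ?_⟩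
  have hiter : ∀ (N : ℕ) (g : (Fin c.dim → ℝ) → ℂ), (fwdDiff s)^[N] (g ∘ c.addEquiv.symm)
      = ((fwdDiff (c.addEquiv.symm s))^[N] g) ∘ c.addEquiv.symm := by
    intro N
    induction N with
    | zero => intro g; rfl
    | succ N ih =>
      intro g
      rw [Function.iterate_succ_apply, Function.iterate_succ_apply, ← ih]
      congr 1
      ext w
      simp [fwdDiff]
  rw [hφ, hiter, Function.comp_apply]
  set t := c.addEquiv.symm w with ht
  have hw : w = c.point t := by
    rw [ht, ← c.addEquiv_apply, AddEquiv.apply_symm_apply]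
  obtain ⟨h3, h4⟩ := hA' s hs
  have h5 := hC' _ h3 t
  calc (1 + ‖w‖) ^ M * ‖((fwdDiff (c.addEquiv.symm s))^[N] g) t‖
      ≤ (B * (1 + ‖t‖)) ^ M * ‖((fwdDiff (c.addEquiv.symm s))^[N] g) t‖ := by
        gcongr
        rw [hw]
        exact hB' t
    _ = B ^ M * ((1 + ‖t‖) ^ M * ‖((fwdDiff (c.addEquiv.symm s))^[N] g) t‖) := by
        rw [mul_pow]; ring
    _ ≤ B ^ M * (C * ‖c.addEquiv.symm s‖ ^ N) := by gcongr
    _ ≤ B ^ M * (C * (A * ‖s‖) ^ N) := by gcongr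
    _ = B ^ M * (C * A ^ N) * ‖s‖ ^ N := by rw [mul_pow]; ring

end Schwartz

end SplitTransfer

namespace SplitTransfer

open Filter Topology
open scoped ENNReal NNReal Pointwise

/-! ### Polynomial growth of balls -/

section Growth

variable (F : Type*) [NontriviallyNormedField F] {X : Type*} [NormedAddCommGroup X]
  [NormedSpace F X] [ProperSpace X] [MeasurableSpace X] [BorelSpace X]

include F in
-- Dilation by a fixed `p` with `‖p‖ > 1` multiplies the measure by a constant `q ≤ ‖p‖ ^ A`, and
-- about `log(1 + r) / log ‖p‖` dilations of the unit ball cover the ball of radius `r`.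
theorem measure_closedBall_le (l : Measure X) [l.IsAddHaarMeasure] :
    ∃ (A : ℕ) (C : ℝ), 0 ≤ C ∧ ∀ r : ℝ, 0 ≤ r →
      l (Metric.closedBall 0 r) ≤ ENNReal.ofReal (C * (1 + r) ^ A) := by
  obtain ⟨p, hp⟩ := NormedField.exists_one_lt_norm F
  have hp0 : p ≠ 0 := norm_pos_iff.1 (one_pos.trans hp)
  let u : Fˣ := Units.mk0 p hp0
  set q : ℝ≥0 := distribHaarChar X u with hq
  obtain ⟨A, hA⟩ := pow_unbounded_of_one_lt (q : ℝ) hp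
  set b : ℝ := (l (Metric.closedBall 0 1)).toReal with hb
  have hfin : l (Metric.closedBall (0 : X) 1) ≠ ⊤ := (isCompact_closedBall _ _).measure_lt_top.ne
  refine ⟨A, ‖p‖ ^ A * b, by positivity, fun r hr => ?_⟩
  obtain ⟨k, hk1, hk2⟩ := exists_nat_pow_near (show 1 ≤ 1 + r by linarith) hp
  have hsub : Metric.closedBall (0 : X) r ⊆ (u ^ (k + 1)) • Metric.closedBall (0 : X) 1 := by
    intro v hv
    rw [Set.mem_smul_set_iff_inv_smul_mem, mem_closedBall_zero_iff, Units.smul_def, norm_smul,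
      Units.val_inv_eq_inv_val, norm_inv, Units.val_pow_eq_pow_val, norm_pow]
    rw [mem_closedBall_zero_iff] at hv
    change (‖p‖ ^ (k + 1))⁻¹ * ‖v‖ ≤ 1
    rw [inv_mul_le_iff₀ (by positivity), mul_one]
    linarith
  calc l (Metric.closedBall 0 r) ≤ l ((u ^ (k + 1)) • Metric.closedBall (0 : X) 1) :=
        measure_mono hsub
    _ = (q ^ (k + 1) : ℝ≥0) * l (Metric.closedBall (0 : X) 1) := by
        rw [← distribHaarChar_mul, map_pow]
    _ = ENNReal.ofReal ((q : ℝ) ^ (k + 1) * b) := by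
        rw [ENNReal.ofReal_mul (by positivity), hb, ENNReal.ofReal_toReal hfin]
        congr 1
        rw [← NNReal.coe_pow, ENNReal.ofReal_coe_nnreal]
    _ ≤ ENNReal.ofReal (‖p‖ ^ A * b * (1 + r) ^ A) := by
        apply ENNReal.ofReal_le_ofReal
        calc (q : ℝ) ^ (k + 1) * b ≤ (‖p‖ ^ A) ^ (k + 1) * b := by gcongr
          _ = ‖p‖ ^ A * b * (‖p‖ ^ k) ^ A := by ring
          _ ≤ ‖p‖ ^ A * b * (1 + r) ^ A := by gcongr

include F in
-- Split by the integer part `k` of `‖w‖`. Balls grow like `(1 + k) ^ A`, so exponent `A + 2` leaves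
-- the summable series of inverse squares.
theorem exists_integrable_one_add_norm (l : Measure X) [l.IsAddHaarMeasure] :
    ∃ N : ℕ, Integrable (fun w : X => ((1 + ‖w‖) ^ N)⁻¹) l := by
  obtain ⟨A, C, hC, h⟩ := measure_closedBall_le F l
  refine ⟨A + 2, ⟨by
    have : Continuous fun w : X => ((1 + ‖w‖) ^ (A + 2))⁻¹ := by
      refine Continuous.inv₀ (by fun_prop) fun w => by positivity
    exact this.aestronglyMeasurable, ?_⟩⟩
  have hle : ∀ w : X, ‖((1 + ‖w‖) ^ (A + 2))⁻¹‖ₑ ≤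
      ∑' k : ℕ, (Metric.closedBall (0 : X) (k + 1)).indicator
        (fun _ => ENNReal.ofReal (((1 + k : ℝ) ^ (A + 2))⁻¹)) w := by
    intro w
    refine le_trans ?_ (ENNReal.le_tsum ⌊‖w‖⌋₊)
    rw [Set.indicator_of_mem]
    · rw [Real.enorm_of_nonneg (by positivity)]
      apply ENNReal.ofReal_le_ofReal
      have := Nat.floor_le (norm_nonneg w)
      gcongr
    · rw [mem_closedBall_zero_iff]
      exact (Nat.lt_floor_add_one _).le
  refine (lintegral_mono hle).trans_lt ?_
  rw [lintegral_tsum fun k => (measurable_const.indicator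
    Metric.isClosed_closedBall.measurableSet).aemeasurable]
  have hterm : ∀ k : ℕ, ∫⁻ w, (Metric.closedBall (0 : X) (k + 1)).indicator
        (fun _ => ENNReal.ofReal (((1 + k : ℝ) ^ (A + 2))⁻¹)) w ∂l
      ≤ ENNReal.ofReal (C * 2 ^ A * (((k + 1 : ℕ) : ℝ) ^ 2)⁻¹) := by
    intro k
    rw [lintegral_indicator_const Metric.isClosed_closedBall.measurableSet]
    refine (mul_le_mul_right (h (k + 1) (by positivity)) _).trans ?_
    rw [← ENNReal.ofReal_mul (by positivity)]
    apply ENNReal.ofReal_le_ofReal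
    have h1 : (1 + (k + 1) : ℝ) ^ A ≤ 2 ^ A * (1 + k) ^ A := by
      rw [← mul_pow]
      gcongr
      linarith [(Nat.cast_nonneg k : (0 : ℝ) ≤ k)]
    calc ((1 + k : ℝ) ^ (A + 2))⁻¹ * (C * (1 + (k + 1)) ^ A)
        ≤ ((1 + k : ℝ) ^ (A + 2))⁻¹ * (C * (2 ^ A * (1 + k) ^ A)) := by gcongr
      _ = C * 2 ^ A * (((k + 1 : ℕ) : ℝ) ^ 2)⁻¹ := by
        push_cast
        rw [pow_add, add_comm (k : ℝ) 1]
        field_simp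
  refine (ENNReal.tsum_le_tsum hterm).trans_lt (lt_top_iff_ne_top.2 ?_)
  refine Summable.tsum_ofReal_ne_top (Summable.mul_left _ ?_)
  exact (summable_nat_add_iff 1).2 (Real.summable_nat_pow_inv.2 one_lt_two)

theorem integrable_one_add_norm_mono {l : Measure X} {N N' : ℕ} (hN : N ≤ N')
    (h : Integrable (fun w : X => ((1 + ‖w‖) ^ N)⁻¹) l) :
    Integrable (fun w : X => ((1 + ‖w‖) ^ N')⁻¹) l := by
  refine h.mono' ?_ (.of_forall fun w => ?_)
  · have : Continuous fun w : X => ((1 + ‖w‖) ^ N')⁻¹ :=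
      Continuous.inv₀ (by fun_prop) fun w => by positivity
    exact this.aestronglyMeasurable
  · rw [Real.norm_of_nonneg (by positivity)]
    gcongr
    linarith [norm_nonneg w]

end Growth

/-! ### Decay of oscillating integrals -/

section Decay

/-- Leibniz rule `Δ(fg) = Δf · g(· + s) + f · Δg`. The bounds on `g` are uniform in `w`, so the
shift does no harm; the two terms double the constant at each order. -/
theorem norm_iterate_fwdDiff_mul_le {E : Type*} [AddCommGroup E] (s : E) (r : ℝ) (hr : 0 ≤ r)
    (N : ℕ) (f g : E → ℂ) (ω : E → ℝ) (B : ℝ) (hB : 0 ≤ B)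
    (hf : ∀ k ≤ N, ∀ w, ‖((fwdDiff s)^[k] f) w‖ ≤ r ^ k * ω w)
    (hg : ∀ k ≤ N, ∀ w, ‖((fwdDiff s)^[k] g) w‖ ≤ B * r ^ k) (w : E) :
    ‖((fwdDiff s)^[N] (fun w => f w * g w)) w‖ ≤ 2 ^ N * B * r ^ N * ω w := by
  induction N generalizing f g ω B w with
  | zero =>
    have h1 := hf 0 le_rfl w
    have h2 := hg 0 le_rfl w
    simp only [Function.iterate_zero, id_eq, pow_zero, one_mul, mul_one] at h1 h2 ⊢
    rw [norm_mul, mul_comm]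
    gcongr
  | succ N ih =>
    have hsplit : fwdDiff s (fun w => f w * g w)
        = (fun w => fwdDiff s f w * g (w + s)) + fun w => f w * fwdDiff s g w := by
      ext w
      simp only [fwdDiff, Pi.add_apply]
      ring
    rw [Function.iterate_succ_apply, hsplit, fwdDiff_iter_add, Pi.add_apply]
    have h1 := ih (fwdDiff s f) (fun w => g (w + s)) (fun w => r * ω w) B hB
      (fun k hk w => by
        rw [← Function.iterate_succ_apply]
        refine (hf (k + 1) (by omega) w).trans (le_of_eq (by ring)))
      (fun k hk w => by
        rw [fwdDiff_iter_comp_add]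
        exact hg k (by omega) (w + s)) w
    have h2 := ih f (fwdDiff s g) ω (B * r) (by positivity) (fun k hk => hf k (by omega))
      (fun k hk w => by
        rw [← Function.iterate_succ_apply]
        refine (hg (k + 1) (by omega) w).trans (le_of_eq (by ring))) w
    calc _ ≤ 2 ^ N * B * r ^ N * (r * ω w) + 2 ^ N * (B * r) * r ^ N * ω w :=
          norm_add_le_of_le h1 h2
      _ = _ := by ring

/-- Summation by parts against an additive character. -/
theorem integral_iterate_fwdDiff_mul {E : Type*} [NormedAddCommGroup E] [MeasurableSpace E]
    [BorelSpace E] (l : Measure E) [l.IsAddLeftInvariant] (s : E) (θ : AddChar E Circle)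
    (hθ : Continuous θ) (N : ℕ) (H : E → ℂ) (hH : Integrable H l) :
    ∫ w, ((fwdDiff s)^[N] H) w * (θ w : ℂ) ∂l
      = ((θ (-s) : ℂ) - 1) ^ N * ∫ w, H w * (θ w : ℂ) ∂l := by
  have hint : ∀ H : E → ℂ, Integrable H l → Integrable (fun w => H w * (θ w : ℂ)) l := by
    intro H hH
    refine hH.mul_bdd (c := 1) ?_ (.of_forall fun w => (Circle.norm_coe (θ w)).le)
    exact (continuous_subtype_val.comp hθ).aestronglyMeasurable
  induction N generalizing H with
  | zero => simp
  | succ N ih =>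
    have hs : Integrable (fun w => H (w + s)) l := by
      simpa only [add_comm] using hH.comp_add_left s
    rw [Function.iterate_succ_apply, ih (fwdDiff s H) (hs.sub hH), pow_succ, mul_assoc]
    congr 1
    have h1 : ∀ w, fwdDiff s H w * (θ w : ℂ) = H (w + s) * (θ w : ℂ) - H w * (θ w : ℂ) :=
      fun w => sub_mul _ _ _
    simp_rw [h1]
    -- Translation invariance moves the shift of `H` onto the character, where it is the scalar
    -- `θ(-s)`.
    have h2 : ∀ w, H (w + s) * (θ w : ℂ) = (θ (-s) : ℂ) * (H (s + w) * (θ (s + w) : ℂ)) := by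
      intro w
      have : θ w = θ (-s) * θ (s + w) := by rw [← AddChar.map_add_eq_mul, neg_add_cancel_left]
      rw [this, add_comm w s, Circle.coe_mul]
      ring
    rw [integral_sub (hint _ hs) (hint _ hH)]
    simp_rw [h2]
    rw [integral_const_mul, integral_add_left_eq_self (fun w => H w * (θ w : ℂ)) s]
    ring

end Decay

end SplitTransfer

namespace SplitTransfer

open Filter Topology
open scoped ENNReal NNReal Pointwise

/-! ### Decay of the oscillating integral, uniform over compact sets of matrices -/

section OscDecay

variable {F : Type*} [NontriviallyNormedField F] {n : ℕ}

theorem norm_vecMul_le (v : Fin n → F) (A : Matrix (Fin n) (Fin n) F) (B : ℝ) (hB : 0 ≤ B)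
    (hA : ∀ i j, ‖A i j‖ ≤ B) : ‖v ᵥ* A‖ ≤ n * B * ‖v‖ := by
  refine (pi_norm_le_iff_of_nonneg (by positivity)).2 fun j => ?_
  calc ‖∑ i, v i * A i j‖ ≤ ∑ i : Fin n, ‖v‖ * B := norm_sum_le_of_le _ fun i _ => by
        rw [norm_mul]
        exact mul_le_mul (norm_le_pi_norm v i) (hA i j) (norm_nonneg _) (norm_nonneg _)
    _ = n * B * ‖v‖ := by simp; ring

/-- Entries of matrices in a compact set are bounded. -/
theorem exists_entry_bound {T : Type*} [TopologicalSpace T] {Ω : Set T} (hΩ : IsCompact Ω)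
    (f : T → Matrix (Fin n) (Fin n) F) (hf : ContinuousOn f Ω) :
    ∃ B : ℝ, 0 ≤ B ∧ ∀ u ∈ Ω, ∀ i j, ‖f u i j‖ ≤ B := by
  have h : ∀ p : Fin n × Fin n, ∃ B, ∀ u ∈ Ω, ‖f u p.1 p.2‖ ≤ B := fun p =>
    hΩ.exists_bound_of_continuousOn
      ((continuous_id.matrix_elem p.1 p.2).comp_continuousOn hf)
  choose B hB using h
  refine ⟨∑ p, |B p|, by positivity, fun u hu i j => ?_⟩
  exact (hB (i, j) u hu).trans ((le_abs_self _).trans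
    (Finset.single_le_sum (f := fun p => |B p|) (fun p _ => abs_nonneg _) (Finset.mem_univ (i, j))))

theorem continuous_coe_inv : Continuous fun u : GL (Fin n) F =>
    ((u⁻¹ : GL (Fin n) F) : Matrix (Fin n) (Fin n) F) :=
  Units.continuous_coe_inv

theorem RapidDiff.decay {φ : (Fin n → F) → ℂ} (h : RapidDiff φ) (M : ℕ) :
    ∃ C, 0 ≤ C ∧ ∀ w, ‖φ w‖ ≤ C * ((1 + ‖w‖) ^ M)⁻¹ := by
  obtain ⟨C, hC, h⟩ := h.2 0 M
  refine ⟨C, hC, fun w => ?_⟩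
  have := h 0 (by simp) w
  rw [← div_eq_mul_inv, le_div_iff₀ (by positivity), mul_comm]
  simpa using this

theorem RapidDiff.uniform {φ : (Fin n → F) → ℂ} (h : RapidDiff φ) (N M : ℕ) :
    ∃ C, 0 ≤ C ∧ ∀ k ≤ N, ∀ s, ‖s‖ ≤ 1 → ∀ w,
      ‖((fwdDiff s)^[k] φ) w‖ ≤ C * ‖s‖ ^ k * ((1 + ‖w‖) ^ M)⁻¹ := by
  choose C hC h using fun k => h.2 k M
  refine ⟨∑ k ∈ Finset.range (N + 1), C k, Finset.sum_nonneg fun k _ => hC k,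
    fun k hk s hs w => ?_⟩
  rw [← div_eq_mul_inv, le_div_iff₀ (by positivity), mul_comm]
  refine (h k s hs w).trans ?_
  gcongr
  exact Finset.single_le_sum (fun k _ => hC k) (Finset.mem_range.2 (by omega))

/-- Because `2x = (x + w) + (x - w)`, decay of the two test functions in their own arguments yields
decay in `x`. -/
theorem one_add_norm_le_two_inv [CharZero F] (x w : Fin n → F) :
    1 + ‖x‖ ≤ (1 + ‖(2 : F)‖⁻¹) * ((1 + ‖x + w‖) * (1 + ‖x - w‖)) := by
  have h2 : ‖(2 : F)‖ ≠ 0 := norm_ne_zero_iff.2 two_ne_zero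
  have h1 : ‖x‖ = ‖(2 : F)‖⁻¹ * ‖(x + w) + (x - w)‖ := by
    rw [add_add_sub_cancel, ← two_smul F x, norm_smul, inv_mul_cancel_left₀ h2]
  have h3 := norm_add_le (x + w) (x - w)
  have h4 : 0 ≤ ‖(2 : F)‖⁻¹ := by positivity
  have h5 : ‖x‖ ≤ ‖(2 : F)‖⁻¹ * (‖x + w‖ + ‖x - w‖) := by rw [h1]; gcongr
  have h6 : 0 ≤ ‖x + w‖ * ‖x - w‖ := by positivity
  nlinarith [norm_nonneg (x + w), norm_nonneg (x - w), mul_nonneg h4 h6]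

variable [LocallyCompactSpace F] [MeasurableSpace F] [BorelSpace F] [CharZero F]
  (ν : Measure (Fin n → F)) [ν.IsAddHaarMeasure]

/-- Uniform decay of the oscillating integral in `x`. -/
theorem oscInt_decay_left (ψ : AddChar F Circle) {φ₁ φ₂ : (Fin n → F) → ℂ}
    (h₁ : RapidDiff φ₁) (h₂ : RapidDiff φ₂) {Ω : Set (GL (Fin n) F)} (hΩ : IsCompact Ω) (N : ℕ) :
    ∃ C, 0 ≤ C ∧ ∀ x y, ∀ u ∈ Ω, ‖oscInt ν ψ φ₁ φ₂ x y 1 u‖ * (1 + ‖x‖) ^ N ≤ C := by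
  have := secondCountable_of_locallyCompact F
  have : ProperSpace F := .of_locallyCompactSpace F
  obtain ⟨B, hB, hB'⟩ := exists_entry_bound hΩ _ continuous_coe_inv.continuousOn
  obtain ⟨M, hM⟩ := exists_integrable_one_add_norm F ν
  -- Of the exponent `M + N`, the part `M` makes the `w`-integral converge and the part `N` combines
  -- with `φ₂` to give decay in `x`.
  obtain ⟨C₁, hC₁, hC₁'⟩ := h₁.decay (M + N)
  obtain ⟨C₂, hC₂, hC₂'⟩ := h₂.decay N
  set I := ∫ w, ((1 + ‖w‖) ^ M)⁻¹ ∂ν with hI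
  have hI0 : 0 ≤ I := integral_nonneg fun w => by positivity
  set D := (1 + ‖(2 : F)‖⁻¹) * (1 + n * B) with hD
  have hD0 : 0 ≤ D := by positivity
  refine ⟨C₁ * C₂ * D ^ N * I, by positivity, fun x y u hu => ?_⟩
  have hpt : ∀ w, ‖conj (φ₁ ((x + w) ᵥ* ((1 : GL (Fin n) F) : Matrix (Fin n) (Fin n) F))) *
      φ₂ ((x - w) ᵥ* (u : Matrix (Fin n) (Fin n) F)) * (ψ (-2 * (w ⬝ᵥ y)) : ℂ)‖ ≤
      C₁ * C₂ * D ^ N * ((1 + ‖x‖) ^ N)⁻¹ * ((1 + ‖x + w‖) ^ M)⁻¹ := by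
    intro w
    rw [norm_mul, norm_mul, RCLike.norm_conj, Circle.norm_coe, mul_one, Units.val_one, vecMul_one]
    have e1 := hC₁' (x + w)
    have e2 := hC₂' ((x - w) ᵥ* (u : Matrix (Fin n) (Fin n) F))
    have e3 : ‖x - w‖ ≤ n * B * ‖(x - w) ᵥ* (u : Matrix (Fin n) (Fin n) F)‖ := by
      have := norm_vecMul_le ((x - w) ᵥ* (u : Matrix (Fin n) (Fin n) F)) _ B hB (hB' u hu)
      rwa [vecMul_vecMul, Units.mul_inv, vecMul_one] at this
    have e4 := one_add_norm_le_two_inv x w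
    set a := ‖x + w‖
    set b := ‖(x - w) ᵥ* (u : Matrix (Fin n) (Fin n) F)‖
    have ha : 0 ≤ a := norm_nonneg _
    have hb : 0 ≤ b := norm_nonneg _
    have e5 : 1 + ‖x‖ ≤ D * ((1 + a) * (1 + b)) := by
      refine e4.trans ?_
      rw [hD, mul_assoc]
      refine mul_le_mul_of_nonneg_left ?_ (by positivity)
      rw [mul_left_comm]
      refine mul_le_mul_of_nonneg_left ?_ (by positivity)
      have : 0 ≤ n * B := by positivity
      nlinarith
    have e6 : ((1 + a) ^ N)⁻¹ * ((1 + b) ^ N)⁻¹ ≤ D ^ N * ((1 + ‖x‖) ^ N)⁻¹ := by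
      rw [← mul_inv, ← mul_pow, ← div_eq_mul_inv, le_div_iff₀ (by positivity),
        inv_mul_le_iff₀ (by positivity), ← mul_pow]
      refine pow_le_pow_left₀ (by positivity) ?_ _
      linarith
    calc ‖φ₁ (x + w)‖ * ‖φ₂ ((x - w) ᵥ* (u : Matrix (Fin n) (Fin n) F))‖
        ≤ (C₁ * ((1 + a) ^ (M + N))⁻¹) * (C₂ * ((1 + b) ^ N)⁻¹) := by gcongr
      _ = C₁ * C₂ * (((1 + a) ^ N)⁻¹ * ((1 + b) ^ N)⁻¹) * ((1 + a) ^ M)⁻¹ := by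
        rw [pow_add, mul_inv]; ring
      _ ≤ C₁ * C₂ * (D ^ N * ((1 + ‖x‖) ^ N)⁻¹) * ((1 + a) ^ M)⁻¹ := by gcongr
      _ = _ := by ring
  have hnorm := norm_integral_le_of_norm_le ((hM.comp_add_left x).const_mul
    (C₁ * C₂ * D ^ N * ((1 + ‖x‖) ^ N)⁻¹)) (.of_forall hpt)
  rw [integral_const_mul, integral_add_left_eq_self (fun w => ((1 + ‖w‖) ^ M)⁻¹) x, ← hI] at hnorm
  rw [oscInt]
  calc _ ≤ C₁ * C₂ * D ^ N * ((1 + ‖x‖) ^ N)⁻¹ * I * (1 + ‖x‖) ^ N := by gcongr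
    _ = _ := by field_simp

theorem iterate_fwdDiff_comp_const_add (s a : Fin n → F) (k : ℕ) (φ : (Fin n → F) → ℂ)
    (w : Fin n → F) :
    ((fwdDiff s)^[k] (fun w => φ (a + w))) w = ((fwdDiff s)^[k] φ) (a + w) := by
  have := fwdDiff_iter_comp_add s φ a k w
  simpa only [add_comm a] using this

theorem iterate_fwdDiff_comp_sub_vecMul (s a : Fin n → F) (A : Matrix (Fin n) (Fin n) F) (k : ℕ)
    (φ : (Fin n → F) → ℂ) (w : Fin n → F) :
    ((fwdDiff s)^[k] (fun w => φ ((a - w) ᵥ* A))) w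
      = ((fwdDiff (-s ᵥ* A))^[k] φ) ((a - w) ᵥ* A) := by
  induction k generalizing φ w with
  | zero => rfl
  | succ k ih =>
    rw [Function.iterate_succ_apply, Function.iterate_succ_apply, ← ih]
    refine congrFun (congrArg _ (funext fun w => ?_)) w
    simp only [fwdDiff, sub_add_eq_sub_sub, sub_vecMul _ (a - w), neg_vecMul, sub_eq_add_neg _ (s ᵥ* A)]

/-- Uniform decay of the oscillating integral in `y`. -/
theorem oscInt_decay_right {ψ : AddChar F Circle} (hψ : Continuous ψ) (hψ1 : ψ ≠ 1)
    {φ₁ φ₂ : (Fin n → F) → ℂ} (h₁ : RapidDiff φ₁) (h₂ : RapidDiff φ₂)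
    {Ω : Set (GL (Fin n) F)} (hΩ : IsCompact Ω) (N : ℕ) :
    ∃ C, 0 ≤ C ∧ ∀ x y, ∀ u ∈ Ω, ‖oscInt ν ψ φ₁ φ₂ x y 1 u‖ * (1 + ‖y‖) ^ N ≤ C := by
  have := secondCountable_of_locallyCompact F
  have : ProperSpace F := .of_locallyCompactSpace F
  obtain ⟨B₀, hB₀, hB₀'⟩ := exists_entry_bound hΩ _ Units.continuous_val.continuousOn
  set B := 1 + n * B₀ with hB
  have hB1 : 1 ≤ B := by rw [hB]; linarith [show 0 ≤ n * B₀ by positivity]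
  obtain ⟨a, ha⟩ : ∃ a, ψ a ≠ 1 := by
    by_contra! h
    exact hψ1 (by ext a; simp [h a])
  have ha0 : a ≠ 0 := by rintro rfl; exact ha (AddChar.map_zero_eq_one ψ)
  have h20 : (2 : F) ≠ 0 := two_ne_zero
  obtain ⟨M, hM⟩ := exists_integrable_one_add_norm F ν
  -- The weight that makes the `w`-integral converge is taken from `φ₁`; `φ₂` enters with weight
  -- exponent `0`.
  obtain ⟨C₁, hC₁, hC₁'⟩ := h₁.conj.uniform N M
  obtain ⟨C₂, hC₂, hC₂'⟩ := h₂.uniform N 0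
  obtain ⟨C₀, hC₀, hC₀'⟩ := oscInt_decay_left ν ψ h₁ h₂ hΩ 0
  set I := ∫ w, ((1 + ‖w‖) ^ M)⁻¹ ∂ν with hI
  have hI0 : 0 ≤ I := integral_nonneg fun w => by positivity
  set q := ‖(ψ (-a) : ℂ) - 1‖ with hq
  have hq0 : 0 < q := by
    rw [hq, norm_pos_iff, sub_ne_zero]
    intro h
    have h' : ψ (-a) = 1 := Circle.coe_eq_one.1 h
    rw [AddChar.map_neg_eq_inv, inv_eq_one] at h'
    exact ha h'
  -- For `‖y‖ ≥ Y` both the step chosen below and its image under `u` have norm at most `1`; below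
  -- this threshold boundedness suffices.
  set Y := B * (‖a‖ / ‖(2 : F)‖) with hY
  have hna : 0 < ‖a‖ := norm_pos_iff.2 ha0
  have hn2 : 0 < ‖(2 : F)‖ := norm_pos_iff.2 h20
  have hY0 : 0 < Y := by positivity
  set K := 2 ^ N * C₂ * C₁ * I * Y ^ N / q ^ N with hK
  have hK0 : 0 ≤ K := by positivity
  refine ⟨max (C₀ * (1 + Y) ^ N) (K * (1 + 1 / Y) ^ N), by positivity, fun x y u hu => ?_⟩
  rcases lt_or_ge ‖y‖ Y with hy | hy
  · refine le_trans ?_ (le_max_left _ _)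
    have := hC₀' x y u hu
    rw [pow_zero, mul_one] at this
    gcongr
  · refine le_trans ?_ (le_max_right _ _)
    have hy0 : 0 < ‖y‖ := hY0.trans_le hy
    obtain ⟨i, hi⟩ : ∃ i, ‖y i‖ = ‖y‖ := by
      have hne : Nonempty (Fin n) := by
        by_contra hemp
        rw [not_nonempty_iff] at hemp
        exact hy0.ne' (by rw [Subsingleton.elim y 0, norm_zero])
      obtain ⟨i, hi⟩ := Finite.exists_max (fun i => ‖y i‖)
      exact ⟨i, le_antisymm (norm_le_pi_norm y i)
        ((pi_norm_le_iff_of_nonneg (norm_nonneg _)).2 hi)⟩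
    have hyi : y i ≠ 0 := norm_pos_iff.1 (hi ▸ hy0)
    -- This step has size comparable to `1 / ‖y‖` and makes the character take the value `ψ(-a) ≠ 1`
    -- at `-s`. Summation by parts thus gains `‖y‖ ^ (-N)` at the fixed cost `q ^ (-N)`.
    let s : Fin n → F := Pi.single i (-(a / (2 * y i)))
    have hs : ‖s‖ = ‖a‖ / ‖(2 : F)‖ / ‖y‖ := by
      rw [Pi.norm_single, norm_neg, norm_div, norm_mul, hi, div_div]
    have hsB : B * ‖s‖ = Y / ‖y‖ := by rw [hs, hY]; ring
    have hsB1 : B * ‖s‖ ≤ 1 := by rw [hsB]; exact (div_le_one hy0).2 hy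
    have hs1 : ‖s‖ ≤ B * ‖s‖ := le_mul_of_one_le_left (norm_nonneg _) hB1
    have hsu : ‖-s ᵥ* (u : Matrix (Fin n) (Fin n) F)‖ ≤ B * ‖s‖ := by
      have := norm_vecMul_le (-s) _ B₀ hB₀ (hB₀' u hu)
      rw [norm_neg] at this
      refine this.trans ?_
      gcongr
      rw [hB]; linarith
    let θ : AddChar (Fin n → F) Circle := ψ.compAddMonoidHom
      (AddMonoidHom.mk' (fun w => -2 * (w ⬝ᵥ y)) fun v w => by rw [add_dotProduct, mul_add])
    have hθ : ∀ w, θ w = ψ (-2 * (w ⬝ᵥ y)) := fun w => rfl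
    have hθc : Continuous θ := by
      have : Continuous fun w : Fin n → F => ψ (-2 * (w ⬝ᵥ y)) := by
        unfold dotProduct
        fun_prop
      exact this
    have hθs : θ (-s) = ψ (-a) := by
      rw [hθ, neg_dotProduct, single_dotProduct]
      congr 1
      field_simp
    set f : (Fin n → F) → ℂ := fun w => conj (φ₁ (x + w)) with hf
    set g : (Fin n → F) → ℂ := fun w => φ₂ ((x - w) ᵥ* (u : Matrix (Fin n) (Fin n) F)) with hg
    have hfk : ∀ k ≤ N, ∀ w, ‖((fwdDiff s)^[k] f) w‖
        ≤ (B * ‖s‖) ^ k * (C₁ * ((1 + ‖x + w‖) ^ M)⁻¹) := by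
      intro k hk w
      rw [hf, iterate_fwdDiff_comp_const_add s x k (fun w => conj (φ₁ w))]
      refine (hC₁' k hk s (hs1.trans hsB1) (x + w)).trans ?_
      rw [mul_comm C₁, mul_assoc]
      gcongr
    have hgk : ∀ k ≤ N, ∀ w, ‖((fwdDiff s)^[k] g) w‖ ≤ C₂ * (B * ‖s‖) ^ k := by
      intro k hk w
      rw [hg, iterate_fwdDiff_comp_sub_vecMul]
      refine (hC₂' k hk _ (hsu.trans hsB1) _).trans ?_
      rw [pow_zero, inv_one, mul_one]
      gcongr
    have hfg := norm_iterate_fwdDiff_mul_le s (B * ‖s‖) (by positivity) N f g _ C₂ hC₂ hfk hgk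
    have hω : Integrable (fun w => ((1 + ‖x + w‖) ^ M)⁻¹) ν := hM.comp_add_left x
    have hHint : Integrable (fun w => f w * g w) ν := by
      refine (hω.const_mul (C₁ * C₂)).mono' ?_ (.of_forall fun w => ?_)
      · have c1 := h₁.1
        have c2 := h₂.1
        have : Continuous fun w => f w * g w := by
          rw [hf, hg]
          fun_prop
        exact this.aestronglyMeasurable
      · have e1 := hfk 0 (Nat.zero_le _) w
        have e2 := hgk 0 (Nat.zero_le _) w
        simp only [Function.iterate_zero, id_eq, pow_zero, one_mul, mul_one] at e1 e2
        rw [norm_mul]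
        calc ‖f w‖ * ‖g w‖ ≤ (C₁ * ((1 + ‖x + w‖) ^ M)⁻¹) * C₂ := by gcongr
          _ = _ := by ring
    have hparts := integral_iterate_fwdDiff_mul ν s θ hθc N _ hHint
    have hosc : oscInt ν ψ φ₁ φ₂ x y 1 u = ∫ w, f w * g w * (θ w : ℂ) ∂ν := by
      rw [oscInt]
      simp only [Units.val_one, vecMul_one]
      rfl
    rw [← hosc, hθs] at hparts
    have hbound : ‖∫ w, ((fwdDiff s)^[N] (fun w => f w * g w)) w * (θ w : ℂ) ∂ν‖
        ≤ 2 ^ N * C₂ * (B * ‖s‖) ^ N * C₁ * I := by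
      have := norm_integral_le_of_norm_le (hω.const_mul (2 ^ N * C₂ * (B * ‖s‖) ^ N * C₁))
        (.of_forall fun w => (by
          rw [norm_mul, Circle.norm_coe, mul_one]
          exact (hfg w).trans (le_of_eq (by ring)) :
          ‖((fwdDiff s)^[N] (fun w => f w * g w)) w * (θ w : ℂ)‖
            ≤ 2 ^ N * C₂ * (B * ‖s‖) ^ N * C₁ * ((1 + ‖x + w‖) ^ M)⁻¹))
      rwa [integral_const_mul, integral_add_left_eq_self (fun w => ((1 + ‖w‖) ^ M)⁻¹) x,
        ← hI] at this
    rw [hparts, norm_mul, norm_pow, ← hq, hsB] at hbound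
    have h1 : ‖oscInt ν ψ φ₁ φ₂ x y 1 u‖ * ‖y‖ ^ N ≤ K := by
      rw [hK, le_div_iff₀ (by positivity)]
      calc _ = q ^ N * ‖oscInt ν ψ φ₁ φ₂ x y 1 u‖ * ‖y‖ ^ N := by ring
        _ ≤ 2 ^ N * C₂ * (Y / ‖y‖) ^ N * C₁ * I * ‖y‖ ^ N := by gcongr
        _ = _ := by rw [div_pow]; field_simp
    have h2 : 1 + ‖y‖ ≤ (1 + 1 / Y) * ‖y‖ := by
      have : 1 ≤ 1 / Y * ‖y‖ := by
        rw [one_div, ← div_eq_inv_mul]; exact (one_le_div hY0).2 hy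
      linarith
    calc _ ≤ ‖oscInt ν ψ φ₁ φ₂ x y 1 u‖ * ((1 + 1 / Y) * ‖y‖) ^ N := by gcongr
      _ = ‖oscInt ν ψ φ₁ φ₂ x y 1 u‖ * ‖y‖ ^ N * (1 + 1 / Y) ^ N := by rw [mul_pow]; ring
      _ ≤ _ := by gcongr

/-- Uniform decay of the oscillating integral. -/
theorem oscInt_decay {ψ : AddChar F Circle} (hψ : Continuous ψ) (hψ1 : ψ ≠ 1)
    {φ₁ φ₂ : (Fin n → F) → ℂ} (h₁ : RapidDiff φ₁) (h₂ : RapidDiff φ₂)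
    {Ω : Set (GL (Fin n) F)} (hΩ : IsCompact Ω) (N : ℕ) :
    ∃ C, 0 ≤ C ∧ ∀ x y, ∀ u ∈ Ω, ‖oscInt ν ψ φ₁ φ₂ x y 1 u‖
      ≤ C * ((1 + ‖x‖) ^ N)⁻¹ * ((1 + ‖y‖) ^ N)⁻¹ := by
  obtain ⟨C₁, hC₁, h1⟩ := oscInt_decay_left ν ψ h₁ h₂ hΩ (2 * N)
  obtain ⟨C₂, hC₂, h2⟩ := oscInt_decay_right ν hψ hψ1 h₁ h₂ hΩ (2 * N)
  refine ⟨C₁ + C₂, by positivity, fun x y u hu => ?_⟩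
  have e1 := h1 x y u hu
  have e2 := h2 x y u hu
  set t := ‖oscInt ν ψ φ₁ φ₂ x y 1 u‖ with ht
  have ht0 : 0 ≤ t := norm_nonneg _
  rw [← div_eq_mul_inv, ← div_eq_mul_inv, div_div, le_div_iff₀ (by positivity)]
  rw [mul_comm 2 N, pow_mul] at e1 e2
  set a := (1 + ‖x‖) ^ N
  set b := (1 + ‖y‖) ^ N
  -- The exponent `2N` in each variable separately gives exponent `N` in both at once.
  have hab : a * b ≤ a ^ 2 + b ^ 2 := by nlinarith [sq_nonneg (a - b), sq_nonneg (a + b)]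
  calc t * (a * b) ≤ t * (a ^ 2 + b ^ 2) := by gcongr
    _ = t * a ^ 2 + t * b ^ 2 := by ring
    _ ≤ C₁ + C₂ := by gcongr

end OscDecay

end SplitTransfer

namespace SplitTransfer

open Filter Topology
open scoped ENNReal NNReal Pointwise

/-! ### Topology of general linear groups -/

section TopologyGL

variable {R : Type*} [CommRing R] [TopologicalSpace R] [IsTopologicalRing R] {n : ℕ}

theorem secondCountable_matrix [SecondCountableTopology R] :
    SecondCountableTopology (Matrix (Fin n) (Fin n) R) :=
  inferInstanceAs (SecondCountableTopology (Fin n → Fin n → R))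

theorem locallyCompact_matrix [LocallyCompactSpace R] :
    LocallyCompactSpace (Matrix (Fin n) (Fin n) R) :=
  inferInstanceAs (LocallyCompactSpace (Fin n → Fin n → R))

theorem secondCountable_GL [SecondCountableTopology R] :
    SecondCountableTopology (GL (Fin n) R) := by
  have := secondCountable_matrix (R := R) (n := n)
  have : SecondCountableTopology (Matrix (Fin n) (Fin n) R)ᵐᵒᵖ :=
    MulOpposite.opHomeomorph.symm.isEmbedding.secondCountableTopology
  exact Units.isEmbedding_embedProduct.secondCountableTopology

theorem locallyCompact_GL [T2Space R] [LocallyCompactSpace R] :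
    LocallyCompactSpace (GL (Fin n) R) := by
  have := locallyCompact_matrix (R := R) (n := n)
  infer_instance

/-- The units in a compact set whose inverses are in the same compact set form a compact set. -/
theorem isCompact_units [T2Space R] {C : Set (Matrix (Fin n) (Fin n) R)} (hC : IsCompact C) :
    IsCompact {g : GL (Fin n) R | (g : Matrix (Fin n) (Fin n) R) ∈ C ∧
      ((g⁻¹ : GL (Fin n) R) : Matrix (Fin n) (Fin n) R) ∈ C} := by
  have h := (Units.isClosedEmbedding_embedProduct (α := Matrix (Fin n) (Fin n) R)).isCompact_preimage
    (hC.prod (hC.image MulOpposite.continuous_op))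
  convert h using 1
  ext g
  simp only [Set.mem_ofPred_eq, Set.mem_preimage, Units.embedProduct_apply, Set.mem_prod,
    Set.mem_image, MulOpposite.op_inj, exists_eq_right]

end TopologyGL

/-! ### Integrability on `GL_n(F)` -/

section HaarGL

variable {F : Type*} [NontriviallyNormedField F] {n : ℕ}

/-- The largest norm of an entry. -/
def entrySup (A : Matrix (Fin n) (Fin n) F) : ℝ := ‖Matrix.of.symm A‖

theorem entrySup_nonneg (A : Matrix (Fin n) (Fin n) F) : 0 ≤ entrySup A := norm_nonneg _

theorem norm_le_entrySup (A : Matrix (Fin n) (Fin n) F) (i j : Fin n) : ‖A i j‖ ≤ entrySup A :=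
  (norm_le_pi_norm (Matrix.of.symm A i) j).trans (norm_le_pi_norm (Matrix.of.symm A) i)

theorem entrySup_le {A : Matrix (Fin n) (Fin n) F} {B : ℝ} (hB : 0 ≤ B)
    (h : ∀ i j, ‖A i j‖ ≤ B) : entrySup A ≤ B :=
  (pi_norm_le_iff_of_nonneg hB).2 fun i => (pi_norm_le_iff_of_nonneg hB).2 fun j => h i j

theorem entrySup_mul_le (A B : Matrix (Fin n) (Fin n) F) :
    entrySup (A * B) ≤ n * entrySup A * entrySup B := by
  have hA := entrySup_nonneg A
  have hB := entrySup_nonneg B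
  refine entrySup_le (by positivity) fun i j => ?_
  calc ‖(A * B) i j‖ ≤ ∑ k : Fin n, entrySup A * entrySup B := by
        rw [Matrix.mul_apply]
        refine norm_sum_le_of_le _ fun k _ => ?_
        rw [norm_mul]
        exact mul_le_mul (norm_le_entrySup A i k) (norm_le_entrySup B k j) (norm_nonneg _) hA
    _ = _ := by simp; ring

theorem continuous_entrySup : Continuous (entrySup : Matrix (Fin n) (Fin n) F → ℝ) :=
  continuous_norm (E := Fin n → Fin n → F)

/-- Left multiplication by an invertible matrix. -/
def leftMulEquiv (g : GL (Fin n) F) : (Fin n → Fin n → F) ≃ₜ+ (Fin n → Fin n → F) where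
  toFun m := Matrix.of.symm ((g : Matrix (Fin n) (Fin n) F) * Matrix.of m)
  invFun m := Matrix.of.symm (((g⁻¹ : GL (Fin n) F) : Matrix (Fin n) (Fin n) F) * Matrix.of m)
  left_inv m := by
    change Matrix.of.symm (_ * (_ * Matrix.of m)) = m
    rw [← mul_assoc, Units.inv_mul, one_mul, Equiv.symm_apply_apply]
  right_inv m := by
    change Matrix.of.symm (_ * (_ * Matrix.of m)) = m
    rw [← mul_assoc, Units.mul_inv, one_mul, Equiv.symm_apply_apply]
  map_add' m m' := mul_add (g : Matrix (Fin n) (Fin n) F) (Matrix.of m) (Matrix.of m')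
  continuous_toFun := by
    have : Continuous fun m : Matrix (Fin n) (Fin n) F => (g : Matrix (Fin n) (Fin n) F) * m := by
      fun_prop
    exact this
  continuous_invFun := by
    have : Continuous fun m : Matrix (Fin n) (Fin n) F =>
        ((g⁻¹ : GL (Fin n) F) : Matrix (Fin n) (Fin n) F) * m := by
      fun_prop
    exact this

theorem leftMulEquiv_apply (g : GL (Fin n) F) (m : Fin n → Fin n → F) :
    leftMulEquiv g m = Matrix.of.symm ((g : Matrix (Fin n) (Fin n) F) * Matrix.of m) := rfl

/-- The invertible matrices that are bounded by `b` together with their inverses. -/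
def glBall (b : ℝ) : Set (GL (Fin n) F) :=
  {g | entrySup (g : Matrix (Fin n) (Fin n) F) ≤ b ∧
    entrySup ((g⁻¹ : GL (Fin n) F) : Matrix (Fin n) (Fin n) F) ≤ b}

theorem isCompact_glBall [ProperSpace F] (b : ℝ) :
    IsCompact (glBall b : Set (GL (Fin n) F)) := by
  have h : IsCompact {A : Matrix (Fin n) (Fin n) F | entrySup A ≤ b} := by
    have hc : Continuous (Matrix.of : (Fin n → Fin n → F) → Matrix (Fin n) (Fin n) F) :=
      continuous_id
    have h := (isCompact_closedBall (0 : Fin n → Fin n → F) b).image hc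
    have he : {A : Matrix (Fin n) (Fin n) F | entrySup A ≤ b}
        = Matrix.of '' Metric.closedBall (0 : Fin n → Fin n → F) b := by
      rw [Equiv.image_eq_preimage_symm]
      exact Set.ext fun A => mem_closedBall_zero_iff.symm
    rw [he]
    exact h
  exact isCompact_units h

/-- Matrices near `1` are invertible and bounded together with their inverses. -/
theorem exists_open_near_one : ∃ (b : ℝ) (U : Set (Fin n → Fin n → F)), 0 ≤ b ∧ IsOpen U ∧
    U.Nonempty ∧ ∀ m ∈ U, ∃ g ∈ (glBall b : Set (GL (Fin n) F)),
      (g : Matrix (Fin n) (Fin n) F) = Matrix.of m := by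
  let e : Matrix (Fin n) (Fin n) F := 1
  set b : ℝ := entrySup e + 1 with hb
  have hb0 : 0 ≤ b := by have := entrySup_nonneg e; positivity
  have h1 : ∀ᶠ m : Matrix (Fin n) (Fin n) F in 𝓝 e, m.det ≠ 0 :=
    (Continuous.matrix_det continuous_id).continuousAt.eventually_ne (by simp [e])
  have h2 : ∀ᶠ m : Matrix (Fin n) (Fin n) F in 𝓝 e, entrySup m < b :=
    continuous_entrySup.continuousAt.eventually_lt continuousAt_const (by rw [hb]; linarith)
  have h3 : ∀ᶠ m : Matrix (Fin n) (Fin n) F in 𝓝 e, entrySup m⁻¹ < b := by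
    have hc : ContinuousAt (fun m : Matrix (Fin n) (Fin n) F => m⁻¹) e := by
      simp only [Matrix.inv_def, Ring.inverse_eq_inv']
      have hd : ContinuousAt (fun m : Matrix (Fin n) (Fin n) F => m.det) e :=
        (Continuous.matrix_det continuous_id).continuousAt
      refine ContinuousAt.smul (hd.inv₀ (by simp [e])) ?_
      · exact (Continuous.matrix_adjugate continuous_id).continuousAt
    refine (continuous_entrySup.continuousAt.comp hc).eventually_lt continuousAt_const ?_
    simp only [Function.comp_apply, e, inv_one]
    rw [hb]; linarith
  have h := (h1.and (h2.and h3))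
  obtain ⟨U, hU, hUo, hUe⟩ := mem_nhds_iff.1 h
  refine ⟨b, U, hb0, hUo, ⟨e, hUe⟩, fun m hm => ?_⟩
  obtain ⟨h1, h2, h3⟩ := hU hm
  refine ⟨GeneralLinearGroup.mkOfDetNeZero (Matrix.of m) h1, ⟨h2.le, ?_⟩, rfl⟩
  rw [Matrix.coe_units_inv]
  exact h3.le

variable [LocallyCompactSpace F] [MeasurableSpace F] [BorelSpace F]

/-- Left multiplication by `g` sends the unit ball into the ball of radius `n` times the entry norm
of `g`, whose volume is polynomially bounded. A bound on the modulus is enough; its exact value is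
not needed. -/
theorem leftMulEquiv_char_le (l : Measure (Fin n → Fin n → F)) [l.IsAddHaarMeasure] :
    ∃ (A : ℕ) (C : ℝ), 0 ≤ C ∧ ∀ (g : GL (Fin n) F) (U : Set (Fin n → Fin n → F)),
      l U ≤ ENNReal.ofReal (C * (1 + entrySup (g : Matrix (Fin n) (Fin n) F)) ^ A) *
        l (leftMulEquiv g ⁻¹' U) := by
  have := secondCountable_of_locallyCompact F
  have : ProperSpace F := .of_locallyCompactSpace F
  obtain ⟨A, C, hC, h⟩ := measure_closedBall_le F l
  set b := (l (Metric.closedBall 0 1)).toReal with hb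
  have hfin : l (Metric.closedBall (0 : Fin n → Fin n → F) 1) ≠ ⊤ :=
    (isCompact_closedBall _ _).measure_lt_top.ne
  have hpos : 0 < l (Metric.closedBall (0 : Fin n → Fin n → F) 1) :=
    Metric.measure_closedBall_pos _ _ one_pos
  have hb0 : 0 < b := ENNReal.toReal_pos hpos.ne' hfin
  refine ⟨A, b⁻¹ * C * (1 + n) ^ A, by positivity, fun g U => ?_⟩
  have hs := entrySup_nonneg (g : Matrix (Fin n) (Fin n) F)
  set s := entrySup (g : Matrix (Fin n) (Fin n) F) with hsdef
  set κ := addEquivAddHaarChar (leftMulEquiv g) with hκ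
  have hmul : ∀ Y, (κ : ℝ≥0∞) * l (leftMulEquiv g ⁻¹' Y) = l Y := fun Y =>
    addEquivAddHaarChar_smul_preimage l (leftMulEquiv g)
  rw [← hmul U]
  refine mul_le_mul_left ?_ _
  have hsub : Metric.closedBall (0 : Fin n → Fin n → F) 1 ⊆
      leftMulEquiv g ⁻¹' Metric.closedBall 0 (n * s) := by
    intro m hm
    rw [mem_closedBall_zero_iff] at hm
    rw [Set.mem_preimage, mem_closedBall_zero_iff]
    refine (entrySup_mul_le (g : Matrix (Fin n) (Fin n) F) (Matrix.of m)).trans ?_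
    have : entrySup (Matrix.of m) ≤ 1 := hm
    exact mul_le_of_le_one_right (by positivity) this
  have h1 : (κ : ℝ≥0∞) * l (Metric.closedBall (0 : Fin n → Fin n → F) 1)
      ≤ ENNReal.ofReal (C * (1 + n * s) ^ A) :=
    (mul_le_mul_right (measure_mono hsub) _).trans ((hmul _).le.trans (h _ (by positivity)))
  have h2 : (κ : ℝ≥0∞) = (κ : ℝ≥0∞) * l (Metric.closedBall (0 : Fin n → Fin n → F) 1) *
      ENNReal.ofReal b⁻¹ := by
    rw [ENNReal.ofReal_inv_of_pos hb0, hb, ENNReal.ofReal_toReal hfin, mul_assoc,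
      ENNReal.mul_inv_cancel hpos.ne' hfin, mul_one]
  rw [h2]
  refine (mul_le_mul_left h1 _).trans ?_
  rw [← ENNReal.ofReal_mul (by positivity)]
  apply ENNReal.ofReal_le_ofReal
  have h3 : (1 + n * s) ^ A ≤ ((1 + n) * (1 + s)) ^ A := by
    gcongr
    nlinarith [(Nat.cast_nonneg n : (0 : ℝ) ≤ n)]
  rw [mul_pow] at h3
  calc C * (1 + n * s) ^ A * b⁻¹ ≤ C * ((1 + n) ^ A * (1 + s) ^ A) * b⁻¹ := by gcongr
    _ = _ := by ring

/-- The weight `(1 + ‖g‖)^{-N} (1 + ‖g⁻¹‖)^{-N}`. -/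
def glWeight (N : ℕ) (g : GL (Fin n) F) : ℝ :=
  ((1 + entrySup (g : Matrix (Fin n) (Fin n) F)) ^ N)⁻¹ *
    ((1 + entrySup ((g⁻¹ : GL (Fin n) F) : Matrix (Fin n) (Fin n) F)) ^ N)⁻¹

variable [MeasurableSpace (GL (Fin n) F)] [BorelSpace (GL (Fin n) F)]

theorem one_add_norm_le_of_leftMul {b : ℝ} (hb : 0 ≤ b) {g v : GL (Fin n) F}
    {m : Fin n → Fin n → F} (hv : v ∈ glBall b)
    (hvm : (v : Matrix (Fin n) (Fin n) F) = Matrix.of (leftMulEquiv g⁻¹ m)) :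
    1 + ‖m‖ ≤ (1 + n * b) * (1 + entrySup (g : Matrix (Fin n) (Fin n) F)) := by
  have hs := entrySup_nonneg (g : Matrix (Fin n) (Fin n) F)
  have h1 : m = Matrix.of.symm
      ((g : Matrix (Fin n) (Fin n) F) * (v : Matrix (Fin n) (Fin n) F)) := by
    rw [hvm, leftMulEquiv_apply, Equiv.apply_symm_apply, ← mul_assoc, Units.mul_inv,
      one_mul, Equiv.symm_apply_apply]
  have h2 : ‖m‖ ≤ n * entrySup (g : Matrix (Fin n) (Fin n) F) * b := by
    rw [h1]
    refine (entrySup_mul_le _ _).trans ?_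
    have := hv.1
    gcongr
  have : 0 ≤ n * b := by positivity
  nlinarith

/-- Compare with additive Haar measure by applying Tonelli to a kernel `k(g, m)` that equals a
multiple of `(1 + ‖m‖)^{-N}` where `g⁻¹m` lies in a neighbourhood `U` of `1`, and vanishes
elsewhere. Integrating over `m` first dominates the weight times the volume of `U`, since `‖m‖` is
controlled by `g` and the slice volume is bounded below through `g⁻¹`. Integrating over `g` first,
each slice lies in a translate of a fixed compact set, which leaves an integrable power of `1 +
‖m‖`. -/
theorem lintegral_glWeight_lt_top (μF : Measure (GL (Fin n) F)) [μF.IsHaarMeasure] :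
    ∃ N : ℕ, ∫⁻ g, ENNReal.ofReal (glWeight N g) ∂μF < ⊤ := by
  have := secondCountable_of_locallyCompact F
  have : ProperSpace F := .of_locallyCompactSpace F
  have := secondCountable_GL (R := F) (n := n)
  have := locallyCompact_GL (R := F) (n := n)
  let l : Measure (Fin n → Fin n → F) := Measure.addHaar
  obtain ⟨b, U, hb, hU, hUne, hUg⟩ := exists_open_near_one (F := F) (n := n)
  obtain ⟨A, C, hC, hA⟩ := leftMulEquiv_char_le l
  obtain ⟨N₀, hN₀⟩ := exists_integrable_one_add_norm F l
  set N := max A N₀ with hN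
  have hint := integrable_one_add_norm_mono (le_max_right A N₀) hN₀
  rw [← hN] at hint
  refine ⟨N, ?_⟩
  set D : ℝ := C * (1 + n * b) ^ N with hD
  let S : Set (GL (Fin n) F × (Fin n → Fin n → F)) := {p | leftMulEquiv p.1⁻¹ p.2 ∈ U}
  have hS : MeasurableSet S := by
    refine (hU.preimage ?_).measurableSet
    have h1 : Continuous fun p : GL (Fin n) F × Matrix (Fin n) (Fin n) F =>
        ((p.1⁻¹ : GL (Fin n) F) : Matrix (Fin n) (Fin n) F) * p.2 :=
      (continuous_coe_inv.comp continuous_fst).mul continuous_snd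
    exact h1
  let k : GL (Fin n) F → (Fin n → Fin n → F) → ℝ≥0∞ := fun g m =>
    S.indicator (fun p => ENNReal.ofReal (D * ((1 + ‖p.2‖) ^ N)⁻¹)) (g, m)
  have hk : Measurable (Function.uncurry k) := by
    have : Continuous fun p : GL (Fin n) F × (Fin n → Fin n → F) =>
        ENNReal.ofReal (D * ((1 + ‖p.2‖) ^ N)⁻¹) := by
      refine ENNReal.continuous_ofReal.comp (continuous_const.mul (Continuous.inv₀ (by fun_prop) ?_))
      intro p; positivity
    exact this.measurable.indicator hS
  have hlower : ∀ g, ENNReal.ofReal (glWeight N g) * l U ≤ ∫⁻ m, k g m ∂l := by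
    intro g
    set s := entrySup (g : Matrix (Fin n) (Fin n) F) with hs
    set t := entrySup ((g⁻¹ : GL (Fin n) F) : Matrix (Fin n) (Fin n) F) with ht
    have hs0 : 0 ≤ s := entrySup_nonneg _
    have ht0 : 0 ≤ t := entrySup_nonneg _
    have hle : ∀ m, (leftMulEquiv g⁻¹ ⁻¹' U).indicator
        (fun _ => ENNReal.ofReal (C * ((1 + s) ^ N)⁻¹)) m ≤ k g m := by
      intro m
      by_cases hm : leftMulEquiv g⁻¹ m ∈ U
      · have hm' : (g, m) ∈ S := hm
        simp only [k]
        rw [Set.indicator_of_mem (show m ∈ leftMulEquiv g⁻¹ ⁻¹' U from hm),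
          Set.indicator_of_mem hm']
        apply ENNReal.ofReal_le_ofReal
        obtain ⟨v, hv, hvm⟩ := hUg _ hm
        have h2 := pow_le_pow_left₀ (by positivity) (one_add_norm_le_of_leftMul hb hv hvm) N
        rw [mul_pow, ← hs] at h2
        rw [hD, mul_assoc]
        refine mul_le_mul_of_nonneg_left ?_ hC
        rw [← div_eq_mul_inv, le_div_iff₀ (by positivity), inv_mul_le_iff₀ (by positivity)]
        linarith
      · rw [Set.indicator_of_notMem (show m ∉ leftMulEquiv g⁻¹ ⁻¹' U from hm)]
        exact zero_le
    refine le_trans ?_ (lintegral_mono hle)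
    have hmeas : MeasurableSet (leftMulEquiv g⁻¹ ⁻¹' U) :=
      (hU.preimage (leftMulEquiv g⁻¹).continuous_toFun).measurableSet
    rw [lintegral_indicator_const hmeas]
    refine (mul_le_mul_right (hA g⁻¹ U) _).trans ?_
    rw [← mul_assoc, ← ENNReal.ofReal_mul (by unfold glWeight; positivity)]
    refine mul_le_mul_left (ENNReal.ofReal_le_ofReal ?_) _
    rw [glWeight, ← hs, ← ht]
    have h3 : (1 + t) ^ A ≤ (1 + t) ^ N := pow_le_pow_right₀ (by linarith) (le_max_left _ _)
    calc ((1 + s) ^ N)⁻¹ * ((1 + t) ^ N)⁻¹ * (C * (1 + t) ^ A)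
        ≤ ((1 + s) ^ N)⁻¹ * ((1 + t) ^ N)⁻¹ * (C * (1 + t) ^ N) := by gcongr
      _ = C * ((1 + s) ^ N)⁻¹ := by field_simp
  have hupper : ∀ m, ∫⁻ g, k g m ∂μF ≤
      ENNReal.ofReal (D * ((1 + ‖m‖) ^ N)⁻¹) * μF (glBall b) := by
    intro m
    by_cases hex : ∃ g, (g, m) ∈ S
    · obtain ⟨g₀, hg₀⟩ := hex
      obtain ⟨v₀, _, hv₀⟩ := hUg _ hg₀
      -- A nonempty slice forces `m` to be invertible, and `glBall b` is stable under inversion, so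
      -- left invariance bounds the volume of the slice.
      set m₀ : GL (Fin n) F := g₀ * v₀ with hm₀
      have hm : Matrix.of m = (m₀ : Matrix (Fin n) (Fin n) F) := by
        rw [hm₀, Units.val_mul, hv₀, leftMulEquiv_apply, Equiv.apply_symm_apply, ← mul_assoc,
          Units.mul_inv, one_mul]
      have hle : ∀ g, k g m ≤ ((fun g => m₀⁻¹ * g) ⁻¹' glBall b).indicator
          (fun _ => ENNReal.ofReal (D * ((1 + ‖m‖) ^ N)⁻¹)) g := by
        intro g
        by_cases hg : (g, m) ∈ S
        · obtain ⟨v, hv, hvm⟩ := hUg _ hg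
          have hvg : v = g⁻¹ * m₀ := by
            refine Units.ext ?_
            rw [hvm, leftMulEquiv_apply, Equiv.apply_symm_apply, hm]
            rfl
          have hmem : g ∈ (fun g => m₀⁻¹ * g) ⁻¹' glBall b := by
            have hinv : m₀⁻¹ * g = v⁻¹ := by rw [hvg]; group
            rw [Set.mem_preimage, hinv]
            exact ⟨hv.2, by rw [inv_inv]; exact hv.1⟩
          simp only [k]
          rw [Set.indicator_of_mem hg, Set.indicator_of_mem hmem]
        · simp only [k]
          rw [Set.indicator_of_notMem hg]
          exact zero_le
      refine (lintegral_mono hle).trans ?_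
      rw [lintegral_indicator_const ((isCompact_glBall b).isClosed.preimage
        (continuous_const_mul m₀⁻¹)).measurableSet, measure_preimage_mul]
    · have hz : ∀ g, k g m = 0 := fun g => Set.indicator_of_notMem (fun h => hex ⟨g, h⟩) _
      simp [hz]
  have hfin : μF (glBall b : Set (GL (Fin n) F)) < ⊤ := (isCompact_glBall b).measure_lt_top
  have htot : (∫⁻ g, ENNReal.ofReal (glWeight N g) ∂μF) * l U < ⊤ := by
    rw [← lintegral_mul_const' _ _ ?_]
    · calc ∫⁻ g, ENNReal.ofReal (glWeight N g) * l U ∂μF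
          ≤ ∫⁻ g, ∫⁻ m, k g m ∂l ∂μF := lintegral_mono hlower
        _ = ∫⁻ m, ∫⁻ g, k g m ∂μF ∂l := lintegral_lintegral_swap hk.aemeasurable
        _ ≤ ∫⁻ m, ENNReal.ofReal (D * ((1 + ‖m‖) ^ N)⁻¹) * μF (glBall b) ∂l :=
            lintegral_mono hupper
        _ = (∫⁻ m, ENNReal.ofReal (D * ((1 + ‖m‖) ^ N)⁻¹) ∂l) * μF (glBall b) :=
            lintegral_mul_const' _ _ hfin.ne
        _ < ⊤ := ENNReal.mul_lt_top (hint.const_mul D).lintegral_lt_top hfin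
    · obtain ⟨m, hm⟩ := hUne
      obtain ⟨g, -, -⟩ := hUg m hm
      have hsub : U ⊆ Metric.closedBall 0 b := by
        intro m hm
        obtain ⟨g, hg, hgm⟩ := hUg m hm
        rw [mem_closedBall_zero_iff]
        have := hg.1
        rwa [hgm] at this
      exact ((measure_mono hsub).trans_lt (isCompact_closedBall _ _).measure_lt_top).ne
  -- A finite product makes both factors finite or one of them zero; the open nonempty set `U` has
  -- positive volume.
  exact (ENNReal.mul_lt_top_iff.1 htot).elim (fun h => h.1) fun h => h.elim
    (fun h => by rw [h]; exact ENNReal.zero_lt_top)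
    fun h => absurd h (hU.measure_pos l hUne).ne'

end HaarGL

end SplitTransfer

namespace SplitTransfer

open Filter Topology
open scoped ENNReal NNReal Pointwise

/-! ### The quadratic algebra as a topological ring -/

section TopologyK

variable (F K : Type*) [NontriviallyNormedField F] [CommRing K]
  [Algebra F K] [Module.Finite F K] [TopologicalSpace K] [IsModuleTopology F K]

/-- Coordinates on a finite algebra with the module topology. -/
def coordHomeo : K ≃ₜ (Fin (Module.finrank F K) → F) where
  toEquiv := (Module.finBasis F K).equivFun.toEquiv
  continuous_toFun :=
    have := IsModuleTopology.toContinuousAdd F K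
    IsModuleTopology.continuous_of_linearMap (Module.finBasis F K).equivFun.toLinearMap
  continuous_invFun :=
    have := IsModuleTopology.toContinuousAdd F K
    IsModuleTopology.continuous_of_linearMap (Module.finBasis F K).equivFun.symm.toLinearMap

include F in
theorem t2Space_of_moduleTopology : T2Space K := (coordHomeo F K).symm.t2Space

include F in
theorem locallyCompact_of_moduleTopology [LocallyCompactSpace F] : LocallyCompactSpace K :=
  (coordHomeo F K).isClosedEmbedding.locallyCompactSpace

include F in
theorem secondCountable_of_moduleTopology [LocallyCompactSpace F] : SecondCountableTopology K :=
  have := secondCountable_of_locallyCompact F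
  (coordHomeo F K).isEmbedding.secondCountableTopology

theorem continuous_algebraMap_moduleTopology : Continuous (algebraMap F K) :=
  have := IsModuleTopology.toContinuousAdd F K
  IsModuleTopology.continuous_of_linearMap (Algebra.linearMap F K)

theorem exists_continuous_retraction [Nontrivial K] :
    ∃ π : K →ₗ[F] F, Continuous π ∧ ∀ a, π (algebraMap F K a) = a := by
  have := IsModuleTopology.toContinuousAdd F K
  obtain ⟨π, hπ⟩ := (Algebra.linearMap F K).exists_leftInverse_of_injective
    (LinearMap.ker_eq_bot.2 (algebraMap F K).injective)
  exact ⟨π, IsModuleTopology.continuous_of_linearMap π, fun a => LinearMap.congr_fun hπ a⟩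

end TopologyK

section GLMaps

variable {R R' : Type*} [CommRing R] [TopologicalSpace R] [CommRing R'] [TopologicalSpace R']
  {n : ℕ}

theorem continuous_GL_map (φ : R →+* R') (hφ : Continuous φ) :
    Continuous (GeneralLinearGroup.map φ : GL (Fin n) R → GL (Fin n) R') := by
  refine Continuous.units_map _ ?_
  exact continuous_id.matrix_map hφ

end GLMaps

/-! ### Compactness of orbits of strongly regular elements -/

section Orbits

variable {F K : Type*} [NontriviallyNormedField F] [CommRing K] [Algebra F K] {n : ℕ}

/-- An element that commutes with `δ` is a polynomial in `δ` if there is a cyclic vector. -/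
theorem exists_eq_sum_pow {R : Type*} [CommRing R] {δ M : Matrix (Fin n) (Fin n) R} {x : Fin n → R}
    (hx : Submodule.span R (Set.range fun i : Fin n => x ᵥ* δ ^ (i : ℕ)) = ⊤)
    (hM : Commute M δ) : ∃ a : Fin n → R, M = ∑ i, a i • δ ^ (i : ℕ) := by
  have hv : x ᵥ* M ∈ Submodule.span R (Set.range fun i : Fin n => x ᵥ* δ ^ (i : ℕ)) := by
    rw [hx]; trivial
  obtain ⟨a, ha⟩ := (Submodule.mem_span_range_iff_exists_fun R).1 hv
  refine ⟨a, (krylovRows_isUnit hx).mul_left_cancel ?_⟩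
  have hx' : x ᵥ* (∑ i, a i • δ ^ (i : ℕ)) = x ᵥ* M := by
    rw [vecMul_sum, ← ha]
    exact Finset.sum_congr rfl fun i _ => vecMul_smul _ _ _
  have hcomm : Commute (∑ i, a i • δ ^ (i : ℕ)) δ :=
    Commute.sum_left _ _ _ fun i _ => ((Commute.refl δ).pow_left _).smul_left _
  -- Matrices that commute with `δ` and agree on the cyclic vector `x` agree on every Krylov row.
  rw [krylovRows_mul_of_intertwine rfl hM.eq.symm,
    krylovRows_mul_of_intertwine hx' hcomm.eq.symm]

theorem algebraMap_comp_vecMul (v : Fin n → F) (A : Matrix (Fin n) (Fin n) F) :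
    (algebraMap F K ∘ v) ᵥ* A.map (algebraMap F K) = algebraMap F K ∘ (v ᵥ* A) := by
  ext j
  simp [vecMul, dotProduct]

theorem krylovRows_algebraMap (c : Matrix (Fin n) (Fin n) K) (v : Fin n → F) :
    krylovRows c (algebraMap F K ∘ v)
      = ∑ k, v k • krylovRows c (algebraMap F K ∘ Pi.single k 1) := by
  ext i j
  rw [Matrix.sum_apply]
  simp only [Matrix.smul_apply, krylovRows, Matrix.of_apply, vecMul, dotProduct,
    Function.comp_apply, Pi.single_apply, Algebra.smul_def]
  refine Finset.sum_congr rfl fun k _ => ?_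
  simp [apply_ite (algebraMap F K)]

variable [TopologicalSpace K]

theorem continuous_krylovRows [IsTopologicalRing K] (x : Fin n → K) :
    Continuous fun c : Matrix (Fin n) (Fin n) K => krylovRows c x := by
  refine continuous_matrix fun i j => ?_
  have : Continuous fun c : Matrix (Fin n) (Fin n) K => x ᵥ* c ^ (i : ℕ) := by fun_prop
  exact (continuous_apply j).comp this

variable [Module.Finite F K] [IsModuleTopology F K] [Nontrivial K]

/-- If `g` conjugates `δ` into a compact set, then it is controlled by its action on a cyclic
row vector. -/
theorem exists_entrySup_le {δ : Matrix (Fin n) (Fin n) K} {x : Fin n → F}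
    (hx : Submodule.span K (Set.range fun i : Fin n => (algebraMap F K ∘ x) ᵥ* δ ^ (i : ℕ)) = ⊤)
    {C : Set (Matrix (Fin n) (Fin n) K)} (hC : IsCompact C) :
    ∃ A : ℝ, 0 ≤ A ∧ ∀ g : Matrix (Fin n) (Fin n) F, ∀ c ∈ C,
      δ * g.map (algebraMap F K) = g.map (algebraMap F K) * c → entrySup g ≤ A * ‖x ᵥ* g‖ := by
  have := IsModuleTopology.isTopologicalRing F K
  obtain ⟨π, hπ, hπ'⟩ := exists_continuous_retraction F K
  obtain ⟨X, hX⟩ := krylovRows_isUnit hx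
  let Q : Fin n → Matrix (Fin n) (Fin n) K → Matrix (Fin n) (Fin n) F := fun k c =>
    (((X⁻¹ : GL (Fin n) K) : Matrix (Fin n) (Fin n) K) *
      krylovRows c (algebraMap F K ∘ Pi.single k 1)).map π
  have hQ : ∀ k, Continuous (Q k) := fun k =>
    Continuous.matrix_map (continuous_const.matrix_mul (continuous_krylovRows _)) hπ
  choose B hB hB' using fun k => exists_entry_bound hC (Q k) (hQ k).continuousOn
  refine ⟨∑ k, B k, Finset.sum_nonneg fun k _ => hB k, fun g c hc hg => ?_⟩
  -- Solving the intertwining relation for `g` expresses it linearly in `x ᵥ* g`, with coefficients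
  -- continuous in `c`. The retraction `π` then makes these coefficients `F`-valued.
  have h1 : g.map (algebraMap F K) = ((X⁻¹ : GL (Fin n) K) : Matrix (Fin n) (Fin n) K) *
      krylovRows c (algebraMap F K ∘ (x ᵥ* g)) := by
    rw [← krylovRows_mul_of_intertwine (algebraMap_comp_vecMul x g) hg, ← hX, ← mul_assoc,
      Units.inv_mul, one_mul]
  have h2 : g = ∑ k, (x ᵥ* g) k • Q k c := by
    ext i j
    have h3 := congrArg π (congrFun (congrFun h1 i) j)
    rw [Matrix.map_apply, hπ', krylovRows_algebraMap, Finset.mul_sum, Matrix.sum_apply,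
      map_sum] at h3
    rw [h3, Matrix.sum_apply]
    refine Finset.sum_congr rfl fun k _ => ?_
    rw [Matrix.mul_smul, Matrix.smul_apply, Matrix.smul_apply, map_smul]
    rfl
  refine entrySup_le (by have := Finset.sum_nonneg fun k (_ : k ∈ Finset.univ) => hB k; positivity)
    fun i j => ?_
  conv_lhs => rw [h2]
  rw [Matrix.sum_apply, Finset.sum_mul]
  refine norm_sum_le_of_le _ fun k _ => ?_
  rw [Matrix.smul_apply, norm_smul, mul_comm]
  exact mul_le_mul (hB' k c hc i j) (norm_le_pi_norm _ k) (norm_nonneg _) (hB k)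

/-- Transposition exchanges cyclic columns and cyclic rows. Here `g` is on the other side of the
conjugation, as needed for the inverse of the conjugating element. -/
theorem exists_entrySup_inv_le {δ : Matrix (Fin n) (Fin n) K} {y : Fin n → F}
    (hy : Submodule.span K (Set.range fun i : Fin n => δ ^ (i : ℕ) *ᵥ (algebraMap F K ∘ y)) = ⊤)
    {C : Set (Matrix (Fin n) (Fin n) K)} (hC : IsCompact C) :
    ∃ A : ℝ, 0 ≤ A ∧ ∀ g : Matrix (Fin n) (Fin n) F, ∀ c ∈ C,
      g.map (algebraMap F K) * δ = c * g.map (algebraMap F K) → entrySup g ≤ A * ‖g *ᵥ y‖ := by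
  have hy' : Submodule.span K (Set.range fun i : Fin n =>
      (algebraMap F K ∘ y) ᵥ* δᵀ ^ (i : ℕ)) = ⊤ := by
    rw [← hy]
    congr 2
    ext1 i
    rw [← transpose_pow, vecMul_transpose]
  obtain ⟨A, hA, h⟩ := exists_entrySup_le hy'
    (hC.image (continuous_id.matrix_transpose (R := K) (m := Fin n) (n := Fin n)))
  refine ⟨A, hA, fun g c hc hg => ?_⟩
  have h1 := h gᵀ cᵀ ⟨c, hc, rfl⟩ (by
    have := congrArg Matrix.transpose hg
    rw [transpose_mul, transpose_mul] at this
    exact this)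
  rw [vecMul_transpose] at h1
  refine le_trans (entrySup_le (entrySup_nonneg _) fun i j => ?_) h1
  exact norm_le_entrySup gᵀ j i

/-- The preimage of a compact set under `GL_n(F) → GL_n(K)` is compact. -/
theorem isCompact_preimage_GL_map [LocallyCompactSpace F] {C : Set (GL (Fin n) K)}
    (hC : IsCompact C) :
    IsCompact ((GeneralLinearGroup.map (algebraMap F K) : GL (Fin n) F → GL (Fin n) K) ⁻¹' C) := by
  have := IsModuleTopology.isTopologicalRing F K
  have := t2Space_of_moduleTopology F K
  obtain ⟨π, hπ, hπ'⟩ := exists_continuous_retraction F K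
  have hp : Continuous fun A : Matrix (Fin n) (Fin n) K => A.map π := continuous_id.matrix_map hπ
  have h1 := hC.image (hp.comp Units.continuous_val)
  have h2 := hC.image (hp.comp Units.continuous_coe_inv)
  refine (isCompact_units (h1.union h2)).of_isClosed_subset
    (hC.isClosed.preimage (continuous_GL_map _ (continuous_algebraMap_moduleTopology F K))) ?_
  intro g hg
  have hret : ∀ A : Matrix (Fin n) (Fin n) F, (A.map (algebraMap F K)).map π = A := by
    intro A
    ext i j
    simp [hπ']
  constructor
  · left
    exact ⟨_, hg, hret _⟩
  · right
    refine ⟨_, hg, ?_⟩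
    change ((((GeneralLinearGroup.map (algebraMap F K) g)⁻¹ : GL (Fin n) K) :
      Matrix (Fin n) (Fin n) K)).map π = _
    rw [← map_inv]
    exact hret _

/-- If `g₁⁻¹ γ g₂` stays in a compact set, then `g₁` conjugates `γ σ(γ)⁻¹` into a compact set and
`g₁⁻¹ g₂` stays in a compact set. -/
theorem exists_compact_of_orbit [LocallyCompactSpace F] (σ : K ≃ₐ[F] K) {γ : GL (Fin n) K}
    {x : Fin n → K}
    (hγ : Commute γ (γ * (GeneralLinearGroup.map (σ : K →+* K) γ)⁻¹))
    (hx : Submodule.span K (Set.range fun i : Fin n => x ᵥ*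
      ((γ * (GeneralLinearGroup.map (σ : K →+* K) γ)⁻¹ : GL (Fin n) K) :
        Matrix (Fin n) (Fin n) K) ^ (i : ℕ)) = ⊤)
    {C : Set (GL (Fin n) K)} (hC : IsCompact C) :
    ∃ (C' : Set (GL (Fin n) K)) (Ω : Set (GL (Fin n) F)), IsCompact C' ∧ IsCompact Ω ∧
      ∀ g₁ g₂ : GL (Fin n) F, (GeneralLinearGroup.map (algebraMap F K) g₁)⁻¹ * γ *
          GeneralLinearGroup.map (algebraMap F K) g₂ ∈ C →
        g₁⁻¹ * g₂ ∈ Ω ∧ (GeneralLinearGroup.map (algebraMap F K) g₁)⁻¹ *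
          (γ * (GeneralLinearGroup.map (σ : K →+* K) γ)⁻¹) *
          GeneralLinearGroup.map (algebraMap F K) g₁ ∈ C' := by
  have := IsModuleTopology.isTopologicalRing F K
  have := t2Space_of_moduleTopology F K
  have hσc : Continuous (σ : K →+* K) := by
    have := IsModuleTopology.toContinuousAdd F K
    exact IsModuleTopology.continuous_of_linearMap σ.toLinearMap
  set τ : GL (Fin n) K →* GL (Fin n) K := GeneralLinearGroup.map (σ : K →+* K) with hτ
  set ι : GL (Fin n) F →* GL (Fin n) K := GeneralLinearGroup.map (algebraMap F K) with hι
  have hτι : ∀ g, τ (ι g) = ι g := by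
    intro g
    refine Units.ext ?_
    ext i j
    exact σ.commutes _
  have hτc : Continuous τ := continuous_GL_map _ hσc
  set δ := γ * (τ γ)⁻¹ with hδ
  have hγm : Commute (γ : Matrix (Fin n) (Fin n) K) (δ : Matrix (Fin n) (Fin n) K) :=
    congrArg Units.val hγ.eq
  have hγm' : Commute ((γ⁻¹ : GL (Fin n) K) : Matrix (Fin n) (Fin n) K)
      (δ : Matrix (Fin n) (Fin n) K) :=
    congrArg Units.val hγ.inv_left.eq
  -- Normality enters here: `γ` and `γ⁻¹` become polynomials in `δ`, so their conjugates by `g₁` are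
  -- controlled by that of `δ`.
  obtain ⟨a, ha⟩ := exists_eq_sum_pow hx hγm
  obtain ⟨b, hb⟩ := exists_eq_sum_pow hx hγm'
  let nm : GL (Fin n) K → GL (Fin n) K := fun c => c * (τ c)⁻¹
  have hnm : Continuous nm := continuous_id.mul hτc.inv
  let P : (Fin n → K) → Matrix (Fin n) (Fin n) K → Matrix (Fin n) (Fin n) K :=
    fun a d => ∑ i, a i • d ^ (i : ℕ)
  have hP : ∀ a, Continuous (P a) := fun a => by
    refine continuous_finsetSum _ fun i _ => ?_
    exact (continuous_pow (M := Matrix (Fin n) (Fin n) K) (i : ℕ)).const_smul (a i)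
  have hPconj : ∀ (a : Fin n → K) (g d : GL (Fin n) K),
      P a ((g⁻¹ * d * g : GL (Fin n) K) : Matrix (Fin n) (Fin n) K)
        = ((g⁻¹ : GL (Fin n) K) : Matrix (Fin n) (Fin n) K) * P a (d : Matrix (Fin n) (Fin n) K) *
          (g : Matrix (Fin n) (Fin n) K) := by
    intro a g d
    simp only [P, Finset.mul_sum, Finset.sum_mul]
    refine Finset.sum_congr rfl fun i _ => ?_
    rw [← Units.val_pow_eq_pow_val, ← Units.val_pow_eq_pow_val, Matrix.mul_smul, Matrix.smul_mul,
      ← Units.val_mul, ← Units.val_mul]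
    congr 2
    have := conj_pow (a := g⁻¹) (b := d) (i := (i : ℕ))
    rwa [inv_inv] at this
  -- With `c = g₁⁻¹γg₂`, the first piece contains `(g₁⁻¹γ⁻¹g₁)c = g₁⁻¹g₂` and the second its inverse
  -- `c⁻¹(g₁⁻¹γg₁)`.
  let K₁ : Set (Matrix (Fin n) (Fin n) K) := (fun c : GL (Fin n) K =>
      P b (nm c : Matrix (Fin n) (Fin n) K) * (c : Matrix (Fin n) (Fin n) K)) '' C ∪
    (fun c : GL (Fin n) K => ((c⁻¹ : GL (Fin n) K) : Matrix (Fin n) (Fin n) K) *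
      P a (nm c : Matrix (Fin n) (Fin n) K)) '' C
  have hK₁ : IsCompact K₁ := by
    refine (hC.image ?_).union (hC.image ?_)
    · exact ((hP b).comp (Units.continuous_val.comp hnm)).mul Units.continuous_val
    · exact Units.continuous_coe_inv.mul ((hP a).comp (Units.continuous_val.comp hnm))
  refine ⟨nm '' C, _, hC.image hnm, isCompact_preimage_GL_map (F := F) (isCompact_units hK₁),
    fun g₁ g₂ hg => ?_⟩
  -- Elements of `GL_n(F)` are fixed by `σ`, so `g₂` cancels.
  have hnmc : nm ((ι g₁)⁻¹ * γ * ι g₂) = (ι g₁)⁻¹ * δ * ι g₁ := by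
    simp only [nm, map_mul, map_inv, hτι, hδ]
    group
  refine ⟨⟨Or.inl ⟨_, hg, ?_⟩, Or.inr ⟨_, hg, ?_⟩⟩, ⟨_, hg, hnmc⟩⟩
  · have hPb : P b (δ : Matrix (Fin n) (Fin n) K) = ((γ⁻¹ : GL (Fin n) K) : Matrix _ _ K) := hb.symm
    simp only
    rw [hnmc, hPconj, hPb, ← Units.val_mul, ← Units.val_mul, ← Units.val_mul, ← hι, map_mul, map_inv]
    congr 1
    group
  · have hPa : P a (δ : Matrix (Fin n) (Fin n) K) = (γ : Matrix _ _ K) := ha.symm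
    simp only
    rw [hnmc, hPconj, hPa, ← Units.val_mul, ← Units.val_mul, ← Units.val_mul, ← hι, map_mul, map_inv]
    congr 1
    group

end Orbits

/-! ### Continuity of test functions -/

section TestFun

variable {F K : Type*} [NontriviallyNormedField F] [LocallyCompactSpace F] [CommRing K]
  [Algebra F K] [Module.Finite F K] [TopologicalSpace K] [IsModuleTopology F K] {n : ℕ}

theorem IsTestFun.continuous {f : GL (Fin n) K → ℂ} (hf : IsTestFun F f) : Continuous f := by
  have := IsModuleTopology.isTopologicalRing F K
  have := t2Space_of_moduleTopology F K
  have := locallyCompact_of_moduleTopology F K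
  have := locallyCompact_matrix (R := K) (n := n)
  rcases hf.2 with ⟨_, h⟩ | ⟨c, hc⟩
  · exact h.continuous
  · have h1 := (hc.continuous.comp c.continuous_symm).comp
      (Units.continuous_val (M := Matrix (Fin n) (Fin n) K))
    convert h1 using 1
    ext g
    have h2 : c.point (c.addEquiv.symm (g : Matrix (Fin n) (Fin n) K)) = g := by
      rw [← c.addEquiv_apply, AddEquiv.apply_symm_apply]
    have h3 : IsUnit (g : Matrix (Fin n) (Fin n) K) := g.isUnit
    simp only [Function.comp_apply]
    rw [h2, extendZero, dif_pos h3]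
    congr 1
    exact Units.ext rfl

end TestFun

end SplitTransfer

namespace SplitTransfer

open Filter Topology
open scoped ENNReal NNReal Pointwise

/-! ### Convergence of the orbital integrals -/

section Bounds

variable {F : Type*} [NontriviallyNormedField F] [LocallyCompactSpace F]
  [MeasurableSpace F] [BorelSpace F] {n : ℕ}

/-- The normalized absolute value is a ratio of volumes, and `a` maps the unit ball into the ball of
radius `‖a‖`, which has polynomial volume. -/
theorem exists_nabs_le (F : Type*) [NontriviallyNormedField F] [LocallyCompactSpace F]
    [MeasurableSpace F] [BorelSpace F] :
    ∃ (A : ℕ) (C : ℝ), 0 ≤ C ∧ ∀ a : Fˣ, nabs a ≤ C * (1 + ‖(a : F)‖) ^ A := by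
  have := secondCountable_of_locallyCompact F
  have : ProperSpace F := .of_locallyCompactSpace F
  let l : Measure F := Measure.addHaar
  obtain ⟨A, C, hC, h⟩ := measure_closedBall_le F l
  set b := (l (Metric.closedBall 0 1)).toReal with hb
  have hfin : l (Metric.closedBall (0 : F) 1) ≠ ⊤ := (isCompact_closedBall _ _).measure_lt_top.ne
  have hpos : 0 < l (Metric.closedBall (0 : F) 1) := Metric.measure_closedBall_pos _ _ one_pos
  have hb0 : 0 < b := ENNReal.toReal_pos hpos.ne' hfin
  refine ⟨A, C / b, by positivity, fun a => ?_⟩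
  have hsub : a • Metric.closedBall (0 : F) 1 ⊆ Metric.closedBall 0 ‖(a : F)‖ := by
    rintro _ ⟨t, ht, rfl⟩
    rw [mem_closedBall_zero_iff] at ht ⊢
    change ‖(a : F) * t‖ ≤ _
    rw [norm_mul]
    exact mul_le_of_le_one_right (norm_nonneg _) ht
  have h1 : (distribHaarChar F a : ℝ≥0∞) * l (Metric.closedBall (0 : F) 1)
      ≤ ENNReal.ofReal (C * (1 + ‖(a : F)‖) ^ A) := by
    rw [distribHaarChar_mul]
    exact (measure_mono hsub).trans (h _ (norm_nonneg _))
  have h2 := ENNReal.toReal_mono ENNReal.ofReal_ne_top h1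
  rw [ENNReal.toReal_mul, ENNReal.toReal_ofReal (by positivity), ENNReal.coe_toReal, ← hb] at h2
  rw [div_mul_eq_mul_div, le_div_iff₀ hb0]
  exact h2

theorem continuous_GL_det : Continuous fun g : GL (Fin n) F => GeneralLinearGroup.det g :=
  Continuous.units_map (Matrix.detMonoidHom (R := F) (n := Fin n))
    (Continuous.matrix_det continuous_id)

/-- The function is a quotient of volumes of the slices of one measurable subset of `GL_n(F) × F`.
-/
theorem measurable_nabs_det [MeasurableSpace (GL (Fin n) F)] [BorelSpace (GL (Fin n) F)] :
    Measurable fun g : GL (Fin n) F => nabs (GeneralLinearGroup.det g) := by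
  have := secondCountable_of_locallyCompact F
  have : ProperSpace F := .of_locallyCompactSpace F
  have := secondCountable_GL (R := F) (n := n)
  let l : Measure F := Measure.addHaar
  have hfin : l (Metric.closedBall (0 : F) 1) ≠ ⊤ := (isCompact_closedBall _ _).measure_lt_top.ne
  have hpos : 0 < l (Metric.closedBall (0 : F) 1) := Metric.measure_closedBall_pos _ _ one_pos
  let S : Set (GL (Fin n) F × F) :=
    {p | (((GeneralLinearGroup.det p.1)⁻¹ : Fˣ) : F) * p.2 ∈ Metric.closedBall (0 : F) 1}
  have hS : MeasurableSet S := by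
    refine (Metric.isClosed_closedBall.preimage ?_).measurableSet
    exact ((Units.continuous_coe_inv.comp continuous_GL_det).comp continuous_fst).mul continuous_snd
  have h1 : ∀ g : GL (Fin n) F, nabs (GeneralLinearGroup.det g)
      = (l (Prod.mk g ⁻¹' S) / l (Metric.closedBall (0 : F) 1)).toReal := by
    intro g
    have h2 : Prod.mk g ⁻¹' S = GeneralLinearGroup.det g • Metric.closedBall (0 : F) 1 := by
      ext t
      rw [Set.mem_smul_set_iff_inv_smul_mem]
      rfl
    rw [h2, ← distribHaarChar_mul, ENNReal.mul_div_cancel_right hpos.ne' hfin]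
    rfl
  simp_rw [h1]
  exact ((measurable_measure_prodMk_left hS).div_const _).ennreal_toReal

variable (ν : Measure (Fin n → F)) [ν.IsAddHaarMeasure]
  {ψ : AddChar F Circle} (hψ : Continuous ψ) {μ : Fˣ × Fˣ →* ℂˣ} (hμ : Continuous μ)

include hψ hμ in
theorem measurable_weilCoeff [MeasurableSpace (GL (Fin n) F)] [BorelSpace (GL (Fin n) F)]
    {φ₁ φ₂ : (Fin n → F) → ℂ} (h₁ : Continuous φ₁) (h₂ : Continuous φ₂) (x y : Fin n → F) :
    Measurable fun p : GL (Fin n) F × GL (Fin n) F => weilCoeff ν ψ μ φ₁ φ₂ x y p.1 p.2 := by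
  have := secondCountable_of_locallyCompact F
  have := secondCountable_GL (R := F) (n := n)
  have : ProperSpace F := .of_locallyCompactSpace F
  have hosc : Measurable fun p : GL (Fin n) F × GL (Fin n) F => oscInt ν ψ φ₁ φ₂ x y p.1 p.2 := by
    have hc : Continuous fun q : (GL (Fin n) F × GL (Fin n) F) × (Fin n → F) =>
        conj (φ₁ ((x + q.2) ᵥ* (q.1.1 : Matrix (Fin n) (Fin n) F))) *
          φ₂ ((x - q.2) ᵥ* (q.1.2 : Matrix (Fin n) (Fin n) F)) *
          (ψ (-2 * (q.2 ⬝ᵥ y)) : ℂ) := by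
      have c1 : Continuous fun q : (GL (Fin n) F × GL (Fin n) F) × (Fin n → F) =>
          (q.1.1 : Matrix (Fin n) (Fin n) F) :=
        Units.continuous_val.comp (continuous_fst.comp continuous_fst)
      have c2 : Continuous fun q : (GL (Fin n) F × GL (Fin n) F) × (Fin n → F) =>
          (q.1.2 : Matrix (Fin n) (Fin n) F) :=
        Units.continuous_val.comp (continuous_snd.comp continuous_fst)
      have c3 : Continuous fun q : (GL (Fin n) F × GL (Fin n) F) × (Fin n → F) =>
          (ψ (-2 * (q.2 ⬝ᵥ y)) : ℂ) := by
        refine continuous_subtype_val.comp (hψ.comp ?_)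
        unfold dotProduct
        fun_prop
      refine ((Complex.continuous_conj.comp (h₁.comp ?_)).mul (h₂.comp ?_)).mul c3
      · exact (continuous_const.add continuous_snd).matrix_vecMul c1
      · exact (continuous_const.sub continuous_snd).matrix_vecMul c2
    exact (hc.stronglyMeasurable.integral_prod_right (ν := ν)).measurable
  have hd : Continuous fun p : GL (Fin n) F × GL (Fin n) F =>
      conj (μ (GeneralLinearGroup.det p.1, GeneralLinearGroup.det p.2) : ℂ) :=
    Complex.continuous_conj.comp (Units.continuous_val.comp (hμ.comp
      ((continuous_GL_det.comp continuous_fst).prodMk (continuous_GL_det.comp continuous_snd))))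
  have hn : Measurable fun p : GL (Fin n) F × GL (Fin n) F =>
      (Real.sqrt (nabs (GeneralLinearGroup.det p.1) * nabs (GeneralLinearGroup.det p.2)) : ℂ) :=
    Complex.measurable_ofReal.comp (((measurable_nabs_det.comp measurable_fst).mul
      (measurable_nabs_det.comp measurable_snd)).sqrt)
  exact (hd.measurable.mul hn).mul hosc

variable {K : Type*} [CommRing K] [Algebra F K] [TopologicalSpace K]
  [Module.Finite F K] [IsModuleTopology F K] [Nontrivial K] [CharZero F]

include hψ hμ in
/-- On the support of the test functions, the Weil coefficient decays rapidly on `GL_n(F)`. -/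
theorem weilCoeff_le_glWeight (hψ1 : ψ ≠ 1) (hμd : ∀ a : Fˣ, μ (a, a) = 1)
    {φ₁ φ₂ : (Fin n → F) → ℂ} (h₁ : RapidDiff φ₁) (h₂ : RapidDiff φ₂)
    (σ : K ≃ₐ[F] K) {γ : GL (Fin n) K} {x y : Fin n → F}
    (hγ : Commute γ (γ * (GeneralLinearGroup.map (σ : K →+* K) γ)⁻¹))
    (hx : StronglyRSS₁ ((γ * (GeneralLinearGroup.map (σ : K →+* K) γ)⁻¹ : GL (Fin n) K) :
        Matrix (Fin n) (Fin n) K) (algebraMap F K ∘ x) (algebraMap F K ∘ y))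
    {C : Set (GL (Fin n) K)} (hC : IsCompact C) (N : ℕ) :
    ∃ B, 0 ≤ B ∧ ∀ g₁ g₂ : GL (Fin n) F, (GeneralLinearGroup.map (algebraMap F K) g₁)⁻¹ * γ *
        GeneralLinearGroup.map (algebraMap F K) g₂ ∈ C →
      ‖weilCoeff ν ψ μ φ₁ φ₂ x y g₁ g₂‖ ≤ B * glWeight N g₁ := by
  obtain ⟨C', Ω, hC', hΩ, hCΩ⟩ := exists_compact_of_orbit (F := F) σ hγ hx.2.1 hC
  have hC'' := hC'.image (Units.continuous_val (M := Matrix (Fin n) (Fin n) K))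
  obtain ⟨A₁, hA₁, hA₁'⟩ := exists_entrySup_le hx.2.1 hC''
  obtain ⟨A₂, hA₂, hA₂'⟩ := exists_entrySup_inv_le hx.2.2 hC''
  obtain ⟨D, hD, hD'⟩ := oscInt_decay ν hψ hψ1 h₁ h₂ hΩ N
  obtain ⟨M, hM⟩ : ∃ M, ∀ u ∈ Ω, ‖conj (μ (GeneralLinearGroup.det (1 : GL (Fin n) F),
      GeneralLinearGroup.det u) : ℂ)‖ ≤ M := by
    refine hΩ.exists_bound_of_continuousOn (Continuous.continuousOn ?_)
    exact Complex.continuous_conj.comp (Units.continuous_val.comp (hμ.comp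
      (continuous_const.prodMk continuous_GL_det)))
  obtain ⟨k, E, hE, hE'⟩ := exists_nabs_le F
  obtain ⟨G, hG⟩ : ∃ G, ∀ u ∈ Ω, ‖((GeneralLinearGroup.det u : Fˣ) : F)‖ ≤ G :=
    hΩ.exists_bound_of_continuousOn
      (Continuous.continuousOn (Units.continuous_val.comp continuous_GL_det))
  set T := Real.sqrt (nabs (GeneralLinearGroup.det (1 : GL (Fin n) F)) * (E * (1 + |G|) ^ k)) with hT
  have hT0 : 0 ≤ T := Real.sqrt_nonneg _
  refine ⟨|M| * T * D * (1 + A₁) ^ N * (1 + A₂) ^ N, by positivity, fun g₁ g₂ hg => ?_⟩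
  obtain ⟨hu, hδ⟩ := hCΩ g₁ g₂ hg
  set δ := γ * (GeneralLinearGroup.map (σ : K →+* K) γ)⁻¹ with hδdef
  set ι : GL (Fin n) F →* GL (Fin n) K := GeneralLinearGroup.map (algebraMap F K) with hι
  have e1 : entrySup (g₁ : Matrix (Fin n) (Fin n) F)
      ≤ A₁ * ‖x ᵥ* (g₁ : Matrix (Fin n) (Fin n) F)‖ := by
    refine hA₁' _ _ ⟨_, hδ, rfl⟩ ?_
    have h : δ * ι g₁ = ι g₁ * ((ι g₁)⁻¹ * δ * ι g₁) := by group
    exact congrArg Units.val h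
  have e2 : entrySup ((g₁⁻¹ : GL (Fin n) F) : Matrix (Fin n) (Fin n) F)
      ≤ A₂ * ‖((g₁⁻¹ : GL (Fin n) F) : Matrix (Fin n) (Fin n) F) *ᵥ y‖ := by
    refine hA₂' _ _ ⟨_, hδ, rfl⟩ ?_
    have h : ι g₁⁻¹ * δ = ((ι g₁)⁻¹ * δ * ι g₁) * ι g₁⁻¹ := by rw [map_inv]; group
    exact congrArg Units.val h
  -- Pulling `g₁` out leaves the pair `(1, u)` with `u` in a compact set, while `g₁` survives only
  -- through `x ᵥ* g₁` and `g₁⁻¹ *ᵥ y`.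
  have e3 := weilCoeff_mul_left ν ψ μ φ₁ φ₂ hμd x y g₁ 1 (g₁⁻¹ * g₂)
  rw [mul_one, mul_inv_cancel_left] at e3
  set u := g₁⁻¹ * g₂ with hudef
  set a := x ᵥ* (g₁ : Matrix (Fin n) (Fin n) F)
  set b := ((g₁⁻¹ : GL (Fin n) F) : Matrix (Fin n) (Fin n) F) *ᵥ y
  have e4 : Real.sqrt (nabs (GeneralLinearGroup.det (1 : GL (Fin n) F)) *
      nabs (GeneralLinearGroup.det u)) ≤ T := by
    apply Real.sqrt_le_sqrt
    refine mul_le_mul_of_nonneg_left ?_ (nabs_pos _).le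
    refine (hE' _).trans ?_
    gcongr
    exact (hG u hu).trans (le_abs_self _)
  have hpow : ∀ (A s t : ℝ), 0 ≤ A → 0 ≤ s → 0 ≤ t → s ≤ A * t →
      ((1 + t) ^ N)⁻¹ ≤ (1 + A) ^ N * ((1 + s) ^ N)⁻¹ := by
    intro A s t hA hs ht hst
    rw [← div_eq_mul_inv, le_div_iff₀ (by positivity), inv_mul_le_iff₀ (by positivity), ← mul_pow]
    refine pow_le_pow_left₀ (by positivity) ?_ _
    nlinarith
  have e5 := hpow A₁ _ _ hA₁ (entrySup_nonneg _) (norm_nonneg _) e1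
  have e6 := hpow A₂ _ _ hA₂ (entrySup_nonneg _) (norm_nonneg _) e2
  rw [e3, weilCoeff, norm_mul, norm_mul, Complex.norm_real, Real.norm_of_nonneg (Real.sqrt_nonneg _),
    glWeight]
  have e7 := hD' a b u hu
  have e8 := (hM u hu).trans (le_abs_self M)
  set s := entrySup (g₁ : Matrix (Fin n) (Fin n) F)
  set t := entrySup ((g₁⁻¹ : GL (Fin n) F) : Matrix (Fin n) (Fin n) F)
  have hs0 : 0 ≤ s := entrySup_nonneg _
  have ht0 : 0 ≤ t := entrySup_nonneg _
  have e9 : ((1 + ‖a‖) ^ N)⁻¹ * ((1 + ‖b‖) ^ N)⁻¹ ≤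
      ((1 + A₁) ^ N * ((1 + s) ^ N)⁻¹) * ((1 + A₂) ^ N * ((1 + t) ^ N)⁻¹) :=
    mul_le_mul e5 e6 (by positivity) (by positivity)
  calc _ ≤ |M| * T * (D * ((1 + ‖a‖) ^ N)⁻¹ * ((1 + ‖b‖) ^ N)⁻¹) := by
        refine mul_le_mul (mul_le_mul e8 e4 (Real.sqrt_nonneg _) (abs_nonneg _)) e7
          (norm_nonneg _) (by positivity)
    _ = |M| * T * D * (((1 + ‖a‖) ^ N)⁻¹ * ((1 + ‖b‖) ^ N)⁻¹) := by ring
    _ ≤ |M| * T * D * (((1 + A₁) ^ N * ((1 + s) ^ N)⁻¹) * ((1 + A₂) ^ N * ((1 + t) ^ N)⁻¹)) := by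
        gcongr
    _ = _ := by ring

variable [MeasurableSpace (GL (Fin n) F)] [BorelSpace (GL (Fin n) F)]
  [MeasurableSpace (GL (Fin n) K)] [BorelSpace (GL (Fin n) K)]
  (μF : Measure (GL (Fin n) F)) [μF.IsHaarMeasure]
  (μK : Measure (GL (Fin n) K)) [μK.IsHaarMeasure]

/-- Integrability of the majorant of the orbital integrals. -/
theorem lintegral_majorant_lt_top (ξ γ : GL (Fin n) K) {C₁ C : Set (GL (Fin n) K)}
    (hC₁ : IsCompact C₁) (hC : IsCompact C) {w : GL (Fin n) F → ℝ≥0∞} (hwm : Measurable w)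
    (hw : ∫⁻ g, w g ∂μF < ⊤) :
    ∫⁻ p : (GL (Fin n) F × GL (Fin n) F) × GL (Fin n) K,
      {p : (GL (Fin n) F × GL (Fin n) F) × GL (Fin n) K |
        (GeneralLinearGroup.map (algebraMap F K) p.1.1)⁻¹ * ξ * p.2 ∈ C₁ ∧
        (GeneralLinearGroup.map (algebraMap F K) p.1.1)⁻¹ * γ *
          GeneralLinearGroup.map (algebraMap F K) p.1.2 ∈ C}.indicator (fun p => w p.1.1) p
      ∂((μF.prod μF).prod μK) < ⊤ := by
  have := IsModuleTopology.isTopologicalRing F K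
  have := t2Space_of_moduleTopology F K
  have := secondCountable_of_locallyCompact F
  have := secondCountable_of_moduleTopology F K
  have := locallyCompact_of_moduleTopology F K
  have := secondCountable_GL (R := F) (n := n)
  have := secondCountable_GL (R := K) (n := n)
  have := locallyCompact_GL (R := F) (n := n)
  have := locallyCompact_GL (R := K) (n := n)
  set ι : GL (Fin n) F →* GL (Fin n) K := GeneralLinearGroup.map (algebraMap F K) with hι
  have hιc : Continuous ι := continuous_GL_map _ (continuous_algebraMap_moduleTopology F K)
  have hm1 : MeasurableSet {p : (GL (Fin n) F × GL (Fin n) F) × GL (Fin n) K |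
      (ι p.1.1)⁻¹ * ξ * p.2 ∈ C₁} := by
    refine (hC₁.isClosed.preimage ?_).measurableSet
    fun_prop
  have hm2 : MeasurableSet {p : GL (Fin n) F × GL (Fin n) F | (ι p.1)⁻¹ * γ * ι p.2 ∈ C} := by
    refine (hC.isClosed.preimage ?_).measurableSet
    fun_prop
  have hm3 : MeasurableSet {p : (GL (Fin n) F × GL (Fin n) F) × GL (Fin n) K |
      (ι p.1.1)⁻¹ * γ * ι p.1.2 ∈ C} := measurable_fst hm2
  have hm4 : Measurable ({p : (GL (Fin n) F × GL (Fin n) F) × GL (Fin n) K |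
      (ι p.1.1)⁻¹ * ξ * p.2 ∈ C₁ ∧ (ι p.1.1)⁻¹ * γ * ι p.1.2 ∈ C}.indicator fun p => w p.1.1) :=
    (hwm.comp (measurable_fst.comp measurable_fst)).indicator (hm1.inter hm3)
  rw [lintegral_prod _ hm4.aemeasurable]
  -- If `g₁⁻¹γg₀` and `g₁⁻¹γg₂` both lie in `C`, then `g₀⁻¹g₂` maps into `C⁻¹C`. This bounds the
  -- volume of the `g₂`-slices independently of `g₁`.
  set W := μF (ι ⁻¹' (C⁻¹ * C)) with hW
  have hWfin : W < ⊤ := (isCompact_preimage_GL_map (hC.inv.mul hC)).measure_lt_top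
  have hC₁fin : μK C₁ < ⊤ := hC₁.measure_lt_top
  have hinner : ∀ p : GL (Fin n) F × GL (Fin n) F,
      ∫⁻ k, {p : (GL (Fin n) F × GL (Fin n) F) × GL (Fin n) K |
        (ι p.1.1)⁻¹ * ξ * p.2 ∈ C₁ ∧ (ι p.1.1)⁻¹ * γ * ι p.1.2 ∈ C}.indicator
          (fun p => w p.1.1) (p, k) ∂μK
      ≤ {p : GL (Fin n) F × GL (Fin n) F | (ι p.1)⁻¹ * γ * ι p.2 ∈ C}.indicator
          (fun p => w p.1 * μK C₁) p := by
    intro p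
    by_cases hp : (ι p.1)⁻¹ * γ * ι p.2 ∈ C
    · rw [Set.indicator_of_mem (show p ∈ {p : GL (Fin n) F × GL (Fin n) F |
        (ι p.1)⁻¹ * γ * ι p.2 ∈ C} from hp)]
      have hle : ∀ k, {p : (GL (Fin n) F × GL (Fin n) F) × GL (Fin n) K |
          (ι p.1.1)⁻¹ * ξ * p.2 ∈ C₁ ∧ (ι p.1.1)⁻¹ * γ * ι p.1.2 ∈ C}.indicator
            (fun p => w p.1.1) (p, k)
          ≤ ((fun k => (ι p.1)⁻¹ * ξ * k) ⁻¹' C₁).indicator (fun _ => w p.1) k := by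
        intro k
        refine Set.indicator_apply_le' (fun hk => ?_) fun _ => zero_le
        rw [Set.indicator_of_mem (show k ∈ (fun k => (ι p.1)⁻¹ * ξ * k) ⁻¹' C₁ from hk.1)]
      refine (lintegral_mono hle).trans ?_
      rw [lintegral_indicator_const
        (hC₁.isClosed.preimage (continuous_const_mul _)).measurableSet, measure_preimage_mul]
    · have hz : ∀ k, {p : (GL (Fin n) F × GL (Fin n) F) × GL (Fin n) K |
          (ι p.1.1)⁻¹ * ξ * p.2 ∈ C₁ ∧ (ι p.1.1)⁻¹ * γ * ι p.1.2 ∈ C}.indicator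
            (fun p => w p.1.1) (p, k) = 0 := fun k => Set.indicator_of_notMem (fun h => hp h.2) _
      simp [hz]
  refine (lintegral_mono hinner).trans_lt ?_
  have hm5 : Measurable ({p : GL (Fin n) F × GL (Fin n) F | (ι p.1)⁻¹ * γ * ι p.2 ∈ C}.indicator
      fun p => w p.1 * μK C₁) := ((hwm.comp measurable_fst).mul_const _).indicator hm2
  rw [lintegral_prod _ hm5.aemeasurable]
  have houter : ∀ g₁, ∫⁻ g₂, {p : GL (Fin n) F × GL (Fin n) F |
      (ι p.1)⁻¹ * γ * ι p.2 ∈ C}.indicator (fun p => w p.1 * μK C₁) (g₁, g₂) ∂μF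
      ≤ w g₁ * (μK C₁ * W) := by
    intro g₁
    by_cases hex : ∃ g₀, (ι g₁)⁻¹ * γ * ι g₀ ∈ C
    · obtain ⟨g₀, hg₀⟩ := hex
      have hle : ∀ g₂, {p : GL (Fin n) F × GL (Fin n) F |
          (ι p.1)⁻¹ * γ * ι p.2 ∈ C}.indicator (fun p => w p.1 * μK C₁) (g₁, g₂)
          ≤ ((fun g => g₀⁻¹ * g) ⁻¹' (ι ⁻¹' (C⁻¹ * C))).indicator
            (fun _ => w g₁ * μK C₁) g₂ := by
        intro g₂
        refine Set.indicator_apply_le' (fun hg => ?_) fun _ => zero_le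
        rw [Set.indicator_of_mem]
        refine ⟨((ι g₁)⁻¹ * γ * ι g₀)⁻¹, Set.inv_mem_inv.2 hg₀, (ι g₁)⁻¹ * γ * ι g₂, hg, ?_⟩
        simp only [map_mul, map_inv]
        group
      refine (lintegral_mono hle).trans ?_
      rw [lintegral_indicator_const
        (((hC.inv.mul hC).isClosed.preimage hιc).preimage (continuous_const_mul _)).measurableSet,
        measure_preimage_mul, mul_assoc]
    · have hz : ∀ g₂, {p : GL (Fin n) F × GL (Fin n) F |
          (ι p.1)⁻¹ * γ * ι p.2 ∈ C}.indicator (fun p => w p.1 * μK C₁) (g₁, g₂) = 0 :=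
        fun g₂ => Set.indicator_of_notMem (show (g₁, g₂) ∉ {p : GL (Fin n) F × GL (Fin n) F |
          (ι p.1)⁻¹ * γ * ι p.2 ∈ C} from fun h => hex ⟨g₂, h⟩) _
      simp [hz]
  refine (lintegral_mono houter).trans_lt ?_
  rw [lintegral_mul_const _ hwm]
  exact ENNReal.mul_lt_top hw (ENNReal.mul_lt_top hC₁fin hWfin)

include hψ hμ in
/-- Absolute convergence of the general linear orbital integral. -/
theorem integrable_orbital (hψ1 : ψ ≠ 1) (hμd : ∀ a : Fˣ, μ (a, a) = 1)
    {φ₁ φ₂ : (Fin n → F) → ℂ} (h₁ : RapidDiff φ₁) (h₂ : RapidDiff φ₂)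
    (σ : K ≃ₐ[F] K) {ξ₁ ξ₂ γ : GL (Fin n) K} (hξ : γ = ξ₁ * ξ₂⁻¹) {x y : Fin n → F}
    (hγ : Commute γ (γ * (GeneralLinearGroup.map (σ : K →+* K) γ)⁻¹))
    (hx : StronglyRSS₁ ((γ * (GeneralLinearGroup.map (σ : K →+* K) γ)⁻¹ : GL (Fin n) K) :
        Matrix (Fin n) (Fin n) K) (algebraMap F K ∘ x) (algebraMap F K ∘ y))
    {f₁ f₂ : GL (Fin n) K → ℂ} (hf₁ : Continuous f₁) (hf₂ : Continuous f₂)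
    (hs₁ : HasCompactSupport f₁) (hs₂ : HasCompactSupport f₂) :
    Integrable (fun p : (GL (Fin n) F × GL (Fin n) F) × GL (Fin n) K =>
      f₁ ((GeneralLinearGroup.map (algebraMap F K) p.1.1)⁻¹ * ξ₁ * p.2) *
        f₂ ((GeneralLinearGroup.map (algebraMap F K) p.1.2)⁻¹ * ξ₂ * p.2) *
        weilCoeff ν ψ μ φ₁ φ₂ x y p.1.1 p.1.2) ((μF.prod μF).prod μK) := by
  have := IsModuleTopology.isTopologicalRing F K
  have := t2Space_of_moduleTopology F K
  have := secondCountable_of_locallyCompact F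
  have := secondCountable_of_moduleTopology F K
  have := secondCountable_GL (R := F) (n := n)
  have := secondCountable_GL (R := K) (n := n)
  set ι : GL (Fin n) F →* GL (Fin n) K := GeneralLinearGroup.map (algebraMap F K) with hι
  have hιc : Continuous ι := continuous_GL_map _ (continuous_algebraMap_moduleTopology F K)
  obtain ⟨N, hN⟩ := lintegral_glWeight_lt_top μF
  have hC : IsCompact (tsupport f₁ * (tsupport f₂)⁻¹) := hs₁.isCompact.mul hs₂.isCompact.inv
  obtain ⟨B, hB, hB'⟩ := weilCoeff_le_glWeight ν hψ hμ hψ1 hμd h₁ h₂ σ hγ hx hC N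
  obtain ⟨c₁, hc₁⟩ := hs₁.exists_bound_of_continuous hf₁
  obtain ⟨c₂, hc₂⟩ := hs₂.exists_bound_of_continuous hf₂
  have hc₁0 : 0 ≤ c₁ := (norm_nonneg _).trans (hc₁ 1)
  have hc₂0 : 0 ≤ c₂ := (norm_nonneg _).trans (hc₂ 1)
  have hwc : Continuous (glWeight N : GL (Fin n) F → ℝ) := by
    have c1 := (continuous_entrySup (F := F) (n := n)).comp Units.continuous_val
    have c2 := (continuous_entrySup (F := F) (n := n)).comp continuous_coe_inv
    refine Continuous.mul (Continuous.inv₀ ((continuous_const.add c1).pow N) fun g => ?_)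
      (Continuous.inv₀ ((continuous_const.add c2).pow N) fun g => ?_)
    · exact (pow_pos (add_pos_of_pos_of_nonneg one_pos (entrySup_nonneg _)) N).ne'
    · exact (pow_pos (add_pos_of_pos_of_nonneg one_pos (entrySup_nonneg _)) N).ne'
  have hw : ∫⁻ g, ENNReal.ofReal (c₁ * c₂ * B * glWeight N g) ∂μF < ⊤ := by
    simp_rw [ENNReal.ofReal_mul (show 0 ≤ c₁ * c₂ * B by positivity)]
    rw [lintegral_const_mul _ hwc.measurable.ennreal_ofReal]
    exact ENNReal.mul_lt_top ENNReal.ofReal_lt_top hN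
  refine ⟨?_, lt_of_le_of_lt (lintegral_mono fun p => ?_) (lintegral_majorant_lt_top μF μK ξ₁ γ
    hs₁.isCompact hC (hwc.measurable.const_mul (c₁ * c₂ * B)).ennreal_ofReal hw)⟩
  · refine Measurable.aestronglyMeasurable ?_
    refine Measurable.mul (Continuous.measurable ?_)
      ((measurable_weilCoeff ν hψ hμ h₁.1 h₂.1 x y).comp measurable_fst)
    fun_prop
  · by_cases hp : f₁ ((ι p.1.1)⁻¹ * ξ₁ * p.2) * f₂ ((ι p.1.2)⁻¹ * ξ₂ * p.2) = 0
    · simp only [hp, zero_mul, enorm_zero]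
      exact zero_le
    · have t1 : (ι p.1.1)⁻¹ * ξ₁ * p.2 ∈ tsupport f₁ :=
        subset_tsupport _ (left_ne_zero_of_mul hp)
      have t2 : (ι p.1.2)⁻¹ * ξ₂ * p.2 ∈ tsupport f₂ :=
        subset_tsupport _ (right_ne_zero_of_mul hp)
      -- The quotient of the two arguments is independent of the variable in `GL_n(K)`, which is how
      -- `γ` appears.
      have t3 : (ι p.1.1)⁻¹ * γ * ι p.1.2 ∈ tsupport f₁ * (tsupport f₂)⁻¹ := by
        refine ⟨_, t1, _, Set.inv_mem_inv.2 t2, ?_⟩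
        rw [hξ]
        group
      rw [Set.indicator_of_mem (show p ∈ {p : (GL (Fin n) F × GL (Fin n) F) × GL (Fin n) K |
        (ι p.1.1)⁻¹ * ξ₁ * p.2 ∈ tsupport f₁ ∧
        (ι p.1.1)⁻¹ * γ * ι p.1.2 ∈ tsupport f₁ * (tsupport f₂)⁻¹} from ⟨t1, t3⟩)]
      rw [← ofReal_norm]
      apply ENNReal.ofReal_le_ofReal
      rw [norm_mul, norm_mul, mul_assoc (c₁ * c₂)]
      exact mul_le_mul (mul_le_mul (hc₁ _) (hc₂ _) (norm_nonneg _) hc₁0) (hB' _ _ t3)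
        (norm_nonneg _) (by positivity)

end Bounds

end SplitTransfer

namespace SplitTransfer

open Filter Topology

/-! ### Comparison of the orbital integrals -/

/-! ### The involution of `K` and conjugacy of matching elements -/

section Quadratic

variable {F K : Type*} [Field F] [CommRing K] [Algebra F K] {n : ℕ}

/-- Automorphisms of a reduced quadratic algebra are involutions. -/
theorem involutive_of_quadratic [CharZero F] [IsReduced K] (hK : Module.finrank F K = 2)
    (σ : K ≃ₐ[F] K) (k : K) : σ (σ k) = k := by
  have hfin : Module.Finite F K := Module.finite_of_finrank_pos (by omega)
  have hnt : Nontrivial K := Module.nontrivial_of_finrank_pos (R := F) (by omega)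
  obtain ⟨a, ha⟩ : ∃ a : K, ∀ c : F, c • (1 : K) ≠ a := by
    by_contra! h
    have htop : Submodule.span F {(1 : K)} = ⊤ :=
      Submodule.eq_top_iff'.2 fun b => Submodule.mem_span_singleton.2 (h b)
    have h1 : Module.finrank F (Submodule.span F {(1 : K)}) = 1 :=
      finrank_span_singleton one_ne_zero
    rw [htop, finrank_top] at h1
    omega
  have hli : LinearIndependent F ![(1 : K), a] := (LinearIndependent.pair_iff' one_ne_zero).2 ha
  have hspan := hli.span_eq_top_of_card_eq_finrank' (by simp [hK])
  have hrep : ∀ b : K, ∃ u v : F, algebraMap F K u + algebraMap F K v * a = b := by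
    intro b
    have hb : b ∈ Submodule.span F (Set.range ![(1 : K), a]) := by rw [hspan]; trivial
    rw [Matrix.range_cons, Matrix.range_cons, Matrix.range_empty, Set.union_empty,
      Set.singleton_union, Submodule.mem_span_pair] at hb
    obtain ⟨u, v, h⟩ := hb
    exact ⟨u, v, by rw [← h, Algebra.smul_def, Algebra.smul_def, mul_one]⟩
  have huniq : ∀ u v : F, algebraMap F K u + algebraMap F K v * a = 0 → u = 0 ∧ v = 0 := by
    intro u v h
    refine LinearIndependent.pair_iff.1 hli u v ?_
    rw [Algebra.smul_def, Algebra.smul_def, mul_one, h]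
  obtain ⟨u, v, huv⟩ := hrep (a * a)
  obtain ⟨q, p, hpq⟩ := hrep (σ a)
  have hp0 : p ≠ 0 := by
    rintro rfl
    rw [map_zero, zero_mul, add_zero] at hpq
    have : σ (algebraMap F K q) = σ a := by rw [σ.commutes, hpq]
    have := σ.injective this
    exact ha q (by rw [Algebra.smul_def, mul_one, this])
  have hsq : σ a * σ a = algebraMap F K u + algebraMap F K v * σ a := by
    rw [← map_mul, ← huv, map_add, map_mul, σ.commutes, σ.commutes]
  rw [← hpq] at hsq
  -- With `a² = u + va` and `σ(a) = q + pa`, these are the coefficients of `1` and `a` in the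
  -- quadratic equation satisfied by `σ(a)`.
  have hrel := huniq (p ^ 2 * u + q ^ 2 - u - v * q) (p ^ 2 * v + 2 * p * q - v * p) (by
    simp only [map_add, map_sub, map_mul, map_pow, map_ofNat]
    linear_combination hsq + (algebraMap F K p) ^ 2 * huv)
  have hq : 2 * q = v * (1 - p) := by
    apply mul_left_cancel₀ hp0
    linear_combination hrel.2
  -- The second factor is the discriminant `(2a - v)²`. It cannot vanish, since in a reduced algebra
  -- `2a = v` would follow; hence `p² = 1`, and `q(1 + p) = 0` gives the involution.
  have hdisc : (1 - p ^ 2) * (v ^ 2 + 4 * u) = 0 := by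
    linear_combination (-4) * hrel.1 + (2 * q - v - v * p) * hq
  have hσσ : σ (σ a) = a := by
    rcases mul_eq_zero.1 hdisc with h | h
    · have h1 : q * (1 + p) = 0 := by
        have : 2 * (q * (1 + p)) = 0 := by linear_combination (1 + p) * hq + v * h
        exact (mul_eq_zero.1 this).resolve_left two_ne_zero
      have h2 : p * p = 1 := by linear_combination -h
      rw [← hpq, map_add, map_mul, σ.commutes, σ.commutes, ← hpq]
      have h3 := congrArg (algebraMap F K) h1
      have h4 := congrArg (algebraMap F K) h2
      simp only [map_mul, map_add, map_one, map_zero] at h3 h4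
      linear_combination h3 + a * h4
    · exfalso
      have h1 : (2 * a - algebraMap F K v) ^ 2 = 0 := by
        have h3 := congrArg (algebraMap F K) h
        simp only [map_mul, map_add, map_pow, map_zero, map_ofNat] at h3
        linear_combination h3 - 4 * huv
      have h2 : 2 * a - algebraMap F K v = 0 := eq_zero_of_pow_eq_zero h1
      have h3 := huniq (-v) 2 (by
        rw [map_neg, map_ofNat]
        linear_combination h2)
      exact two_ne_zero h3.2
  obtain ⟨s, t, rfl⟩ := hrep k
  simp only [map_add, map_mul, σ.commutes, hσσ]

theorem map_normOf_eq_inv {σ : K ≃ₐ[F] K} (hσσ : ∀ a, σ (σ a) = a) (γ : GL (Fin n) K) :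
    GeneralLinearGroup.map (σ : K →+* K) (γ * (GeneralLinearGroup.map (σ : K →+* K) γ)⁻¹)
      = (γ * (GeneralLinearGroup.map (σ : K →+* K) γ)⁻¹)⁻¹ := by
  have hττ : GeneralLinearGroup.map (σ : K →+* K) (GeneralLinearGroup.map (σ : K →+* K) γ) = γ := by
    refine Units.ext ?_
    ext i j
    exact hσσ _
  rw [map_mul, map_inv, hττ, _root_.mul_inv_rev, inv_inv]

/-- Matching elements with compatible representatives are conjugate over `F`. -/
theorem exists_conj_of_matches [CharZero F] [IsReduced K] (hK : Module.finrank F K = 2)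
    {σ : K ≃ₐ[F] K} (hσ : σ ≠ AlgEquiv.refl) {S R : Set (GL2 n K)} (hSR : Compatible σ S R)
    {γ ζ : GL2 n K} {x : Fin n → F} {y z : (Fin n → F) × (Fin n → F)}
    (hX : MemXrss σ S γ x y) (hY : MemYrss σ R ζ z) (hmatch : Matches σ γ x y ζ z) :
    ∃ h : GL (Fin n) F, (GeneralLinearGroup.map (algebraMap F K) h)⁻¹ * γ.1 *
        GeneralLinearGroup.map (algebraMap F K) h = ζ.1 ∧
      x ᵥ* (h : Matrix (Fin n) (Fin n) F) = z.1 ∧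
      ((h⁻¹ : GL (Fin n) F) : Matrix (Fin n) (Fin n) F) *ᵥ y.1 = z.2 := by
  have hσσ := involutive_of_quadratic hK σ
  obtain ⟨h₁, e₁, hx₁, hy₁⟩ := exists_descended_conj hK hσ (map_normOf_eq_inv hσσ γ.1)
    (map_normOf_eq_inv hσσ ζ.1) hX.2.2.1 hY.2.1 hmatch.1
  obtain ⟨h₂, e₂, -, -⟩ := exists_descended_conj hK hσ (map_normOf_eq_inv hσσ γ.2)
    (map_normOf_eq_inv hσσ ζ.2) hX.2.2.2 hY.2.2 hmatch.2
  -- Compatibility speaks of conjugators in `GL_n(E)`, so both components are needed here, although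
  -- only the first is used afterwards.
  have hc := hSR γ hX.1 ζ hY.1 (h₁, h₂) (Prod.ext e₁ e₂)
  refine ⟨h₁, congrArg Prod.fst hc, hx₁, ?_⟩
  rw [← hy₁, mulVec_mulVec, Units.inv_mul, one_mulVec]
  rfl

end Quadratic

/-! ### Integrating out the variable in `GL_n(K)` -/

section Convolution

/-- The substitution `h = ak` in the convolution turns `h⁻¹(ab⁻¹)` into `(bk)⁻¹`, which the check
involution inverts. -/
theorem integral_eq_conv {K : Type*} [CommRing K] [TopologicalSpace K] [IsTopologicalRing K]
    {n : ℕ} [MeasurableSpace (GL (Fin n) K)] [BorelSpace (GL (Fin n) K)]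
    [SecondCountableTopology K] (μK : Measure (GL (Fin n) K)) [μK.IsHaarMeasure]
    (f₁ f₂ : GL (Fin n) K → ℂ) (a b : GL (Fin n) K) :
    ∫ k, f₁ (a * k) * f₂ (b * k) ∂μK = conv μK f₁ (checkFun f₂) (a * b⁻¹) := by
  have := secondCountable_GL (R := K) (n := n)
  rw [conv, ← integral_mul_left_eq_self (fun h => f₁ h * checkFun f₂ (h⁻¹ * (a * b⁻¹))) a]
  congr 1
  ext k
  simp only [checkFun]
  congr 2
  group

end Convolution

end SplitTransfer

end

/-! ### The transfer identity -/

open SplitTransfer in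
theorem mainTheorem7
    {F : Type*} [NontriviallyNormedField F] [LocallyCompactSpace F] [CharZero F]
    [MeasurableSpace F] [BorelSpace F]
    {K : Type*} [CommRing K] [Algebra F K] [Algebra.Etale F K] (hK : Module.finrank F K = 2)
    [TopologicalSpace K] [IsModuleTopology F K]
    (σ : K ≃ₐ[F] K) (hσ : σ ≠ AlgEquiv.refl)
    (n : ℕ)
    [MeasurableSpace (GL (Fin n) F)] [BorelSpace (GL (Fin n) F)]
    [MeasurableSpace (GL (Fin n) K)] [BorelSpace (GL (Fin n) K)]
    (ν : Measure (Fin n → F)) [ν.IsAddHaarMeasure]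
    (μF : Measure (GL (Fin n) F)) [μF.IsHaarMeasure]
    (μK : Measure (GL (Fin n) K)) [μK.IsHaarMeasure]
    (ψ : AddChar F Circle) (hψ : Continuous ψ) (hψ_ne : ψ ≠ 1)
    (μ : Fˣ × Fˣ →* ℂˣ) (hμ : Continuous μ) (hμ_diag : ∀ a : Fˣ, μ (a, a) = 1)
    (j₀ : Fˣ)
    (S R : Set (GL (Fin n) K × GL (Fin n) K))
    (hS : IsNormalRepsGL σ S) (hR : IsNormalRepsU σ R) (hSR : Compatible σ S R)
    (f' : GL (Fin n) K × GL (Fin n) K → ℂ) (φ' : (Fin n → F) × (Fin n → F) → ℂ)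
    (f : GL (Fin n) K → ℂ) (φ₁ φ₂ : (Fin n → F) → ℂ)
    (hf : IsSplitTransfer μK f' φ' f φ₁ φ₂)
    (γ : GL (Fin n) K × GL (Fin n) K) (x : Fin n → F) (y : (Fin n → F) × (Fin n → F))
    (hX : MemXrss σ S γ x y)
    (ζ : GL (Fin n) K × GL (Fin n) K) (z : (Fin n → F) × (Fin n → F))
    (hY : MemYrss σ R ζ z)
    (hmatch : Matches σ γ x y ζ z)
    (ξ : GL (Fin n) K × GL (Fin n) K) (hξ : γ = ξ * (sigmaLK ξ)⁻¹) :
    Integrable (fun p : (GL (Fin n) F × GL (Fin n) F) × GL (Fin n) K =>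
        integrandGL ν ψ μ j₀ ξ x y f' φ' p.1 p.2) ((μF.prod μF).prod μK) ∧
      Integrable (fun p : GL (Fin n) F × GL (Fin n) F =>
        integrandU ν ψ μ ζ z f φ₁ φ₂ (toUnitary p.1) (toUnitary p.2)) (μF.prod μF) ∧
      orbGL ν μF μK ψ μ j₀ ξ x y f' φ' = orbU ν μF ψ μ ζ z f φ₁ φ₂ := by
  have : Module.Finite F K := Module.finite_of_finrank_pos (by omega)
  have : Nontrivial K := Module.nontrivial_of_finrank_pos (R := F) (by omega)
  have : IsReduced K := Algebra.FormallyUnramified.isReduced_of_field F K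
  have := IsModuleTopology.isTopologicalRing F K
  have := t2Space_of_moduleTopology F K
  have := secondCountable_of_locallyCompact F
  have := secondCountable_of_moduleTopology F K
  have := locallyCompact_of_moduleTopology F K
  have := secondCountable_GL (R := F) (n := n)
  have := secondCountable_GL (R := K) (n := n)
  have := locallyCompact_GL (R := F) (n := n)
  have := locallyCompact_GL (R := K) (n := n)
  obtain ⟨hφ₁, hφ₂, hφ', f₁, f₂, hf₁, hf₂, hf', rfl⟩ := hf
  obtain rfl : φ' = fun z => φ₁ z.1 * starRingEnd ℂ (φ₂ z.2) := funext hφ'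
  obtain ⟨h, hγζ, hxz, hyz⟩ := exists_conj_of_matches hK hσ hSR hX hY hmatch
  have hγ₁ : γ.1 = ξ.1 * ξ.2⁻¹ := congrArg Prod.fst hξ
  have hy : y = (y.1, -y.1) := Prod.ext rfl (congrArg Prod.fst hX.2.1)
  have hcomm : Commute γ.1 (γ.1 * (GeneralLinearGroup.map (σ : K →+* K) γ.1)⁻¹) :=
    congrArg Prod.fst (hS.1 γ hX.1).2.2.eq
  have hint := integrable_orbital ν hψ hμ μF μK hψ_ne hμ_diag hφ₁.rapidDiff hφ₂.rapidDiff σ hγ₁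
    hcomm hX.2.2.1 hf₁.continuous hf₂.continuous hf₁.1 hf₂.1
  have hGL : ∀ p : (GL (Fin n) F × GL (Fin n) F) × GL (Fin n) K,
      integrandGL ν ψ μ j₀ ξ x y f' (fun z => φ₁ z.1 * starRingEnd ℂ (φ₂ z.2)) p.1 p.2
        = f₁ ((GeneralLinearGroup.map (algebraMap F K) p.1.1)⁻¹ * ξ.1 * p.2) *
          f₂ ((GeneralLinearGroup.map (algebraMap F K) p.1.2)⁻¹ * ξ.2 * p.2) *
          weilCoeff ν ψ μ φ₁ φ₂ x y.1 p.1.1 p.1.2 := by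
    intro p
    rw [integrandGL, hf', ← conj_dagger_weilGL ν ψ μ φ₁ φ₂ j₀ x y.1 p.1.1 p.1.2, ← hy]
    simp only [etaLK, MonoidHom.one_apply, Units.val_one, one_pow, mul_one]
    rfl
  -- This is the linear integrand after integration over `GL_n(K)`; it no longer depends on `ξ`,
  -- only on `γ`.
  let H : GL (Fin n) F × GL (Fin n) F → ℂ := fun p =>
    conv μK f₁ (checkFun f₂) ((GeneralLinearGroup.map (algebraMap F K) p.1)⁻¹ * γ.1 *
      GeneralLinearGroup.map (algebraMap F K) p.2) * weilCoeff ν ψ μ φ₁ φ₂ x y.1 p.1 p.2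
  have hinner : ∀ p : GL (Fin n) F × GL (Fin n) F,
      ∫ k, f₁ ((GeneralLinearGroup.map (algebraMap F K) p.1)⁻¹ * ξ.1 * k) *
          f₂ ((GeneralLinearGroup.map (algebraMap F K) p.2)⁻¹ * ξ.2 * k) *
          weilCoeff ν ψ μ φ₁ φ₂ x y.1 p.1 p.2 ∂μK = H p := by
    intro p
    rw [integral_mul_const, integral_eq_conv]
    simp only [H]
    rw [hγ₁]
    congr 2
    group
  have hH : Integrable H (μF.prod μF) := by
    have := hint.integral_prod_left
    simp only [hinner] at this
    exact this
  -- Conjugation by `h` takes `γ` to `ζ` and `(x, y.1)` to `(z.1, z.2)`, so the unitary integrand is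
  -- a left translate of `H`. Integrability and the value of the integral then follow from
  -- invariance of the product measure.
  have hU : ∀ p : GL (Fin n) F × GL (Fin n) F,
      integrandU ν ψ μ ζ z (conv μK f₁ (checkFun f₂)) φ₁ φ₂ (toUnitary p.1) (toUnitary p.2)
        = H ((h, h) * p) := by
    intro p
    rw [integrandU, ddagger_weilU ν ψ μ φ₁ φ₂ hμ_diag]
    simp only [H, Prod.fst_mul, Prod.snd_mul]
    rw [weilCoeff_mul_left ν ψ μ φ₁ φ₂ hμ_diag, hxz, hyz]
    congr 2
    change (GeneralLinearGroup.map (algebraMap F K) p.1)⁻¹ * ζ.1 *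
      GeneralLinearGroup.map (algebraMap F K) p.2 = _
    rw [← hγζ, map_mul, map_mul]
    group
  have hHU : Integrable (fun p => H ((h, h) * p)) (μF.prod μF) := hH.comp_mul_left (h, h)
  refine ⟨by simpa only [hGL] using hint, by simpa only [hU] using hHU, ?_⟩
  have hL : orbGL ν μF μK ψ μ j₀ ξ x y f' (fun z => φ₁ z.1 * starRingEnd ℂ (φ₂ z.2))
      = ∫ p, H p ∂(μF.prod μF) := by
    rw [orbGL]
    refine integral_congr_ae (.of_forall fun p => ?_)
    simp only [fun k => hGL (p, k)]
    exact hinner p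
  have hR' : orbU ν μF ψ μ ζ z (conv μK f₁ (checkFun f₂)) φ₁ φ₂
      = ∫ p, H ((h, h) * p) ∂(μF.prod μF) := by
    rw [integral_prod _ hHU, orbU]
    simp only [fun g₁ g₂ => hU (g₁, g₂)]
  rw [hL, hR', integral_mul_left_eq_self]
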